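/- **Setting.** Fix a partition $I\sqcup J=[1,n]$ with $I=\{i_1<\dots<i_k\}$, $J=\{j_1<\dots<j_m\}$. *Networks.* A perfect planar network $N\in\mathrm{Net}_{I,J}$ is a finite directed planar graph without loops and parallel edges, drawn in a disk, with boundary vertices $b_1,\dots,b_n$ placed counterclockwise on the boundary circle and all other vertices inside. Each $b_i$ has degree one; $b_i$ is a source (one outgoing edge) if $i\in I$ and a sink (one incoming edge) if $i\in J$. Each internal vertex has degree three and is either white (exactly one incoming edge) or black (exactly one outgoing edge). The network is drawn with straight edges in a convex polygon having the $b_i$ among its corners, with everything else in the interior of the polygon. *Boundary measurements.* Give the edges independent weights $w_e$. For a closed polygonal curve $C$ and a line $l$ that is not collinear to any segment of $C$, let $c_l(C)\in\mathbb Z/2$ be the number modulo 2 of pairs of consecutive segments $(e',e'')$ of $C$ such that the directing vector of $l$ lies in the interior of the cone spanned by $e',e''$; it does not depend on $l$ and is denoted $c(C)$. For a path $P$ from $b_i$ to $b_j$ let $C_P$ be $P$ closed up by going counterclockwise along the boundary of the polygon from $b_j$ to $b_i$, and let $w_P=(-1)^{c(C_P)-1}\prod_{e\in P}w_e$. Let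 $M(i,j)=\sum_P w_P$ over all paths from $b_i$ to $b_j$, a formal power series in the weights, and $M_N=(M_{pq})$, $M_{pq}=M(i_p,j_q)$. *Brackets on edge weights.* At each internal vertex label the three flags by coordinates $x_v^1,x_v^2,x_v^3$ in clockwise order, $x_v^1$ being the flag of the unique incoming edge if $v$ is white and of the unique outgoing edge if $v$ is black; the flag at a boundary vertex has one coordinate. Given six real parameters $\alpha_{12},\alpha_{13},\alpha_{23},\beta_{12},\beta_{13},\beta_{23}$, the universal bracket is $\{x_v^i,x_v^j\}=\alpha_{ij}x_v^ix_v^j$ ($i<j$) at white $v$, $\{x_v^i,x_v^j\}=\beta_{ij}x_v^ix_v^j$ ($i<j$) at black $v$, all brackets of coordinates at different vertices being zero. The weight of an edge is the product of the coordinates of its two flags, and $\{\cdot,\cdot\}_N$ is the pushforward of the universal bracket to $(\mathbb R\setminus0)^{E}$. *The functions $s_=$ and $s_\times$.* Write $a\prec b\prec\cdots$ when distinct boundary points are met in this order going counterclockwise. For $i,i'\in I$, $j,j'\in J$, $$s_=(i,j,i',j')=\begin{cases}1&i\prec i'\prec j'\prec j,\\-1&i'\prec i\prec j\prec j',\\ \tfrac12&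 i=i'\prec j'\prec j\text{ or }i\prec i'\prec j'=j,\\-\tfrac12& i'=i\prec j\prec j'\text{ or }i'\prec i\prec j=j',\\0&\text{otherwise,}\end{cases}$$ $$s_\times(i,j,i',j')=\begin{cases}1&i'\prec i\prec j'\prec j,\\-1&i\prec i'\prec j\prec j',\\ \tfrac12& i'=i\prec j'\prec j\text{ or }i'\prec i\prec j'=j,\\-\tfrac12& i=i'\prec j\prec j'\text{ or }i\prec i'\prec j=j',\\0&\text{otherwise.}\end{cases}$$ **Theorem.** There is a family of Poisson brackets $\{\cdot,\cdot\}_{\alpha,\beta}$ ($\alpha,\beta\in\mathbb R$) on the smooth functions on $\mathrm{Mat}_{k,m}(\mathbb R)$ (bilinear, skew-symmetric, satisfying the Leibniz and Jacobi identities) such that for all $p,\bar p\in[1,k]$, $q,\bar q\in[1,m]$ the matrix entries satisfy $$\{M_{pq},M_{\bar p\bar q}\}_{\alpha,\beta}=(\alpha-\beta)\,s_=(i_p,j_q,i_{\bar p},j_{\bar q})\,M_{p\bar q}M_{\bar pq}+(\alpha+\beta)\,s_\times(i_p,j_q,i_{\bar p},j_{\bar q})\,M_{pq}M_{\bar p\bar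 q},$$ and with the following property. For any choice of the six parameters $\alpha_{ij},\beta_{ij}$ there is exactly one bracket in the family such that for every $N\in\mathrm{Net}_{I,J}$ the map $M_N$ from $(\mathbb R\setminus0)^{E}$ with $\{\cdot,\cdot\}_N$ to $\mathrm{Mat}_{k,m}(\mathbb R)$ is Poisson, namely the bracket with $$\alpha=\alpha_{23}+\alpha_{13}-\alpha_{12},\qquad \beta=\beta_{23}+\beta_{13}-\beta_{12}.$$ Here "$M_N$ is Poisson" means that the entries of $M_N$ are rational functions of the edge weights and that $\{f\circ M_N,g\circ M_N\}_N=\{f,g\}_{\alpha,\beta}\circ M_N$ for all smooth $f,g$ on $\mathrm{Mat}_{k,m}(\mathbb R)$ at every point of $(\mathbb R\setminus0)^{E}$ where all the entries of $M_N$ are regular. -/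

import Mathlib

open scoped ContDiff

/-! ### Poisson brackets -/

/-- A Poisson bracket on a commutative real algebra: bilinear, skew-symmetric, a derivation in
each argument (in the second one by the Leibniz rule, hence in the first one by skew-symmetry),
and satisfying the Jacobi identity. -/
structure PoissonBracket (A : Type*) [CommRing A] [Algebra ℝ A] where
  bracket : A →ₗ[ℝ] A →ₗ[ℝ] A
  skew : ∀ f g, bracket f g = -bracket g f
  leibniz : ∀ f g h, bracket f (g * h) = bracket f g * h + g * bracket f h
  jacobi : ∀ f g h,
    bracket f (bracket g h) + bracket g (bracket h f) + bracket h (bracket f g) = 0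

/-- The algebra of smooth real functions on the affine space with coordinates indexed by `ι`. -/
def smoothFunctions (ι : Type*) [Fintype ι] : Subalgebra ℝ ((ι → ℝ) → ℝ) where
  carrier := {f | ContDiff ℝ ∞ f}
  mul_mem' {f g} (hf : ContDiff ℝ ∞ f) (hg : ContDiff ℝ ∞ g) := by
    change ContDiff ℝ ∞ (fun x => f x * g x)
    exact hf.mul hg
  add_mem' {f g} (hf : ContDiff ℝ ∞ f) (hg : ContDiff ℝ ∞ g) := by
    change ContDiff ℝ ∞ (fun x => f x + g x)
    exact hf.add hg
  algebraMap_mem' c := by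
    change ContDiff ℝ ∞ (fun _ => c)
    exact contDiff_const

/-- A coordinate function. -/
def coordFn {ι : Type*} [Fintype ι] (a : ι) : smoothFunctions ι :=
  ⟨fun x => x a, by
    change ContDiff ℝ ∞ (fun x : ι → ℝ => x a)
    exact contDiff_apply ℝ ℝ a⟩

/-- The partial derivative `∂f/∂x_a` at the point `x`. -/
noncomputable def partialDeriv {ι : Type*} [Fintype ι] [DecidableEq ι]
    (f : (ι → ℝ) → ℝ) (a : ι) (x : ι → ℝ) : ℝ :=
  fderiv ℝ f x (Pi.single a 1)

/-- The quadratic bracket with `{x_a, x_b} = c a b * x_a * x_b` on coordinates, extended to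
functions by bilinearity and the Leibniz rule. -/
noncomputable def quadraticBracket {ι : Type*} [Fintype ι] [DecidableEq ι] (c : ι → ι → ℝ)
    (f g : (ι → ℝ) → ℝ) (x : ι → ℝ) : ℝ :=
  ∑ a, ∑ b, c a b * x a * x b * partialDeriv f a x * partialDeriv g b x

/-! ### Cyclic order and the functions `s_=` and `s_×` -/

/-- `a ≺ b ≺ c`: three distinct points met in this order going counterclockwise. -/
abbrev Cyc3 {n : ℕ} (a b c : Fin n) : Prop :=
  (a < b ∧ b < c) ∨ (b < c ∧ c < a) ∨ (c < a ∧ a < b)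

/-- `a ≺ b ≺ c ≺ d`: four distinct points met in this order going counterclockwise. -/
abbrev Cyc4 {n : ℕ} (a b c d : Fin n) : Prop :=
  (a < b ∧ b < c ∧ c < d) ∨ (b < c ∧ c < d ∧ d < a) ∨
    (c < d ∧ d < a ∧ a < b) ∨ (d < a ∧ a < b ∧ b < c)

/-- The function `s_=`. -/
noncomputable def sPar {n : ℕ} (i j i' j' : Fin n) : ℝ :=
  if Cyc4 i i' j' j then 1
  else if Cyc4 i' i j j' then -1
  else if (i = i' ∧ Cyc3 i j' j) ∨ (j' = j ∧ Cyc3 i i' j) then 1 / 2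
  else if (i = i' ∧ Cyc3 i j j') ∨ (j' = j ∧ Cyc3 i' i j) then -(1 / 2)
  else 0

/-- The function `s_×`. -/
noncomputable def sCross {n : ℕ} (i j i' j' : Fin n) : ℝ :=
  if Cyc4 i' i j' j then 1
  else if Cyc4 i i' j j' then -1
  else if (i = i' ∧ Cyc3 i j' j) ∨ (j' = j ∧ Cyc3 i' i j) then 1 / 2
  else if (i = i' ∧ Cyc3 i j j') ∨ (j' = j ∧ Cyc3 i i' j) then -(1 / 2)
  else 0

/-! ### Plane geometry and the concordance number -/

/-- The plane. -/
abbrev Plane : Type := ℝ × ℝ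

/-- The determinant of two plane vectors; it is positive when `v` is obtained from `u` by a
counterclockwise turn through an angle strictly between `0` and `π` (and a rescaling). -/
def planeDet (u v : Plane) : ℝ := u.1 * v.2 - u.2 * v.1

/-- The directions of the (pairwise non-codirectional) vectors `u`, `v`, `w` are met in this
order when turning clockwise. Equivalently, at least two of the three clockwise turns from `u` to
`v`, from `v` to `w`, from `w` to `u` are through angles less than `π`. -/
def ClockwiseDirs (u v w : Plane) : Prop :=
  (planeDet u v < 0 ∧ planeDet v w < 0) ∨ (planeDet v w < 0 ∧ planeDet w u < 0) ∨
    (planeDet w u < 0 ∧ planeDet u v < 0)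

/-- The vectors of the consecutive oriented segments of the closed polygonal curve with the given
cyclic list of vertices. -/
def segmentVectors (C : List Plane) : List Plane :=
  List.zipWith (fun a b => b - a) C (C.rotate 1)

/-- `d` is not collinear to any of the segments of the closed polygonal curve. -/
def IsGenericDirection (d : Plane) (C : List Plane) : Prop :=
  ∀ u ∈ segmentVectors C, planeDet u d ≠ 0

open Classical in
/-- `c_l(e', e'')` for a line `l` with directing vector `d`, where `u`, `v` are the vectors of
`e'`, `e''`: it is `1` if `d` belongs to the interior of the cone spanned by `u` and `v`, and `0`
otherwise. (Only used for `d` collinear to neither `u` nor `v`.) -/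
noncomputable def coneIndicator (d u v : Plane) : ZMod 2 :=
  if ∃ s t : ℝ, 0 < s ∧ 0 < t ∧ d = s • u + t • v then 1 else 0

/-- `c_l(C)`: the sum of `c_l(e', e'')` over all pairs of consecutive segments of `C`. -/
noncomputable def concordanceAlong (d : Plane) (C : List Plane) : ZMod 2 :=
  (List.zipWith (coneIndicator d) (segmentVectors C) ((segmentVectors C).rotate 1)).sum

open Classical in
/-- The concordance number `c(C)` of a closed polygonal curve: the value of `c_l(C)` for a line `l`
that is not collinear to any segment of `C` (it does not depend on the choice of `l`). -/
noncomputable def concordanceNumber (C : List Plane) : ZMod 2 :=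
  if h : ∃ d, IsGenericDirection d C then concordanceAlong h.choose C else 0

/-! ### Perfect planar networks in a disk -/

/-- The flags of a graph with `n` boundary vertices of degree one and a set `W` of internal vertices
of degree three: each boundary vertex has one flag, and each internal vertex `v` has three flags
`(v, 0)`, `(v, 1)`, `(v, 2)`, carrying the coordinates `x_v^1`, `x_v^2`, `x_v^3`. -/
abbrev NetFlag (n : ℕ) (W : Type) : Type := Fin n ⊕ (W × Fin 3)

/-- The vertex of a flag. -/
def NetFlag.vertex {n : ℕ} {W : Type} : NetFlag n W → Fin n ⊕ W
  | Sum.inl i => Sum.inl i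
  | Sum.inr (v, _) => Sum.inr v

/-- The abstract graph of a perfect network with boundary vertices `b_0, ..., b_{n-1}`,
of which those indexed by `I` are sources and the others are sinks. -/
structure PerfectGraph (n : ℕ) (I : Finset (Fin n)) where
  /-- internal vertices -/
  W : Type
  /-- edges -/
  E : Type
  [fintypeW : Fintype W]
  [fintypeE : Fintype E]
  [decEqW : DecidableEq W]
  [decEqE : DecidableEq E]
  /-- the flag at the tail of an edge -/
  src : E → NetFlag n W
  /-- the flag at the head of an edge -/
  tgt : E → NetFlag n W
  /-- Each flag belongs to exactly one edge, as its tail or as its head. In particular each boundary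
  vertex has degree one, and each internal vertex has degree three. -/
  flags_bijective : Function.Bijective (Sum.elim src tgt)
  /-- `b_i` has an outgoing edge exactly when `i ∈ I`; otherwise it has an incoming one. -/
  source_iff : ∀ i, i ∈ I ↔ ∃ e, src e = Sum.inl i
  /-- the colour of an internal vertex: `true` for white, `false` for black -/
  white : W → Bool
  /-- A white vertex has one incoming edge, with the first label, and two outgoing ones. -/
  white_spec : ∀ v, white v = true →
    (∃ e, tgt e = Sum.inr (v, 0)) ∧ (∃ e, src e = Sum.inr (v, 1)) ∧
      (∃ e, src e = Sum.inr (v, 2))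
  /-- A black vertex has one outgoing edge, with the first label, and two incoming ones. -/
  black_spec : ∀ v, white v = false →
    (∃ e, src e = Sum.inr (v, 0)) ∧ (∃ e, tgt e = Sum.inr (v, 1)) ∧
      (∃ e, tgt e = Sum.inr (v, 2))

attribute [instance] PerfectGraph.fintypeW PerfectGraph.fintypeE
  PerfectGraph.decEqW PerfectGraph.decEqE

/-- The disk, drawn as a strictly convex polygon whose corners include the boundary vertices
`b_0, ..., b_{n-1}` in counterclockwise order. -/
structure PolygonalDisk (n : ℕ) where
  /-- the number of corners -/
  numCorners : ℕ
  three_le_numCorners : 3 ≤ numCorners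
  /-- the corners, in counterclockwise order -/
  corner : Fin numCorners → Plane
  corner_convex : ∀ a b c, a < b → b < c → 0 < planeDet (corner b - corner a) (corner c - corner a)
  /-- the corner at which a boundary vertex is placed -/
  cornerIdx : Fin n → Fin numCorners
  cornerIdx_strictMono : StrictMono cornerIdx

/-- The interior of the polygon: the points strictly to the left of each of its sides. -/
def PolygonalDisk.interior {n : ℕ} (D : PolygonalDisk n) : Set Plane :=
  {x | ∀ a, 0 < planeDet (D.corner (finRotate _ a) - D.corner a) (x - D.corner a)}

/-- The positions of all vertices, given the positions of the internal ones. -/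
def PolygonalDisk.position {n : ℕ} (D : PolygonalDisk n) {W : Type} (innerPos : W → Plane) :
    Fin n ⊕ W → Plane :=
  Sum.elim (fun i => D.corner (D.cornerIdx i)) innerPos

/-- A perfect planar network in a disk, drawn with straight edges. The disk is drawn as a
convex polygon, and everything but the boundary vertices lies in its interior.
(When the boundary vertices are all the corners, the polygon is their convex hull.)
The conditions on the drawing exclude loops and parallel edges. -/
structure PerfectNetwork (n : ℕ) (I : Finset (Fin n)) extends PerfectGraph n I where
  disk : PolygonalDisk n
  /-- the positions of the internal vertices -/
  innerPos : W → Plane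
  innerPos_injective : Function.Injective innerPos
  innerPos_mem : ∀ v, innerPos v ∈ disk.interior
  /-- Edges, without their endpoints, are in the interior of the disk. -/
  edge_subset : ∀ e, openSegment ℝ (disk.position innerPos (src e).vertex)
    (disk.position innerPos (tgt e).vertex) ⊆ disk.interior
  /-- Distinct edges do not meet, except at endpoints. -/
  edge_disjoint : ∀ e e', e ≠ e' → Disjoint
    (openSegment ℝ (disk.position innerPos (src e).vertex)
      (disk.position innerPos (tgt e).vertex))
    (openSegment ℝ (disk.position innerPos (src e').vertex)
      (disk.position innerPos (tgt e').vertex))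
  /-- Edges do not pass through vertices. -/
  vertex_notMem_edge : ∀ e v, disk.position innerPos v ∉
    openSegment ℝ (disk.position innerPos (src e).vertex) (disk.position innerPos (tgt e).vertex)
  /-- The three edges at a white vertex, in the order of their labels, go clockwise. -/
  white_clockwise : ∀ v e₁ e₂ e₃, tgt e₁ = Sum.inr (v, 0) → src e₂ = Sum.inr (v, 1) →
    src e₃ = Sum.inr (v, 2) → ClockwiseDirs
      (disk.position innerPos (src e₁).vertex - innerPos v)
      (disk.position innerPos (tgt e₂).vertex - innerPos v)
      (disk.position innerPos (tgt e₃).vertex - innerPos v)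
  /-- The three edges at a black vertex, in the order of their labels, go clockwise. -/
  black_clockwise : ∀ v e₁ e₂ e₃, src e₁ = Sum.inr (v, 0) → tgt e₂ = Sum.inr (v, 1) →
    tgt e₃ = Sum.inr (v, 2) → ClockwiseDirs
      (disk.position innerPos (tgt e₁).vertex - innerPos v)
      (disk.position innerPos (src e₂).vertex - innerPos v)
      (disk.position innerPos (src e₃).vertex - innerPos v)

/-- The six parameters of the universal bracket: `a12`, `a13`, `a23` are used at white vertices
and `b12`, `b13`, `b23` at black ones. -/
structure UniversalParams where
  a12 : ℝ
  a13 : ℝ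
  a23 : ℝ
  b12 : ℝ
  b13 : ℝ
  b23 : ℝ

/-- The skew-symmetric array with the given entries above the diagonal. -/
def skewArray (c12 c13 c23 : ℝ) : Matrix (Fin 3) (Fin 3) ℝ :=
  !![0, c12, c13; -c12, 0, c23; -c13, -c23, 0]

namespace PerfectNetwork

variable {n : ℕ} {I : Finset (Fin n)} (N : PerfectNetwork n I)

/-- The position of a vertex in the plane. -/
def pos : Fin n ⊕ N.W → Plane := N.disk.position N.innerPos

/-! #### Paths and boundary measurements -/

/-- `P` is the list of edges of a path from `b_i` to `b_j`. -/
def IsPath (i j : Fin n) (P : List N.E) : Prop :=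
  P.IsChain (fun e e' => (N.tgt e).vertex = (N.src e').vertex) ∧
    P.head?.map (fun e => (N.src e).vertex) = some (Sum.inl i) ∧
    P.getLast?.map (fun e => (N.tgt e).vertex) = some (Sum.inl j)

/-- The corners met when going counterclockwise along the boundary of the disk from `b_j`
(included) to `b_i` (excluded). -/
def closingCorners (i j : Fin n) : List Plane :=
  (((List.finRange N.disk.numCorners).rotate (N.disk.cornerIdx j)).takeWhile
    (fun a => decide (a ≠ N.disk.cornerIdx i))).map N.disk.corner

/-- The closed polygonal curve `C_P` for a path `P` from `b_i` to `b_j`: the path, followed by the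
part of the boundary of the disk that goes counterclockwise from `b_j` to `b_i`. -/
def closedCurve (i j : Fin n) (P : List N.E) : List Plane :=
  P.map (fun e => N.pos (N.src e).vertex) ++ N.closingCorners i j

/-- The sign `(-1)^(c(C_P) - 1)` of a path. -/
noncomputable def pathSign (i j : Fin n) (P : List N.E) : ℤ :=
  (-1) ^ (concordanceNumber (N.closedCurve i j P) - 1).val

open Classical in
/-- The boundary measurement `M(i, j)` as a formal power series in the edge weights: the sum over
all paths `P` from `b_i` to `b_j` of the weights `(-1)^(c(C_P) - 1) ∏_{e ∈ P} w_e`. The coefficient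
of a monomial is the sum of the signs of the (finitely many) paths with this monomial. -/
noncomputable def boundarySeries (i j : Fin n) : MvPowerSeries N.E ℤ :=
  fun m => ∑ P ∈ (Finsupp.toMultiset m).lists.toFinset with N.IsPath i j P, N.pathSign i j P

end PerfectNetwork

/-- The power series `g` is the rational function `p / q`. -/
def IsFractionOf {E : Type} (g : MvPowerSeries E ℤ) (p q : MvPolynomial E ℤ) : Prop :=
  q ≠ 0 ∧ (q : MvPowerSeries E ℤ) * g = (p : MvPowerSeries E ℤ)

/-- The power series `g` is a rational function that is regular at the real point `y`. -/
def RegularAt {E : Type} (g : MvPowerSeries E ℤ) (y : E → ℝ) : Prop :=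
  ∃ p q, IsFractionOf g p q ∧ MvPolynomial.aeval y q ≠ 0

open Classical in
/-- The value at `y` of a rational function regular at `y` (`0` when it is not regular). -/
noncomputable def rationalValue {E : Type} (g : MvPowerSeries E ℤ) (y : E → ℝ) : ℝ :=
  if h : ∃ r : ℝ, ∃ p q, IsFractionOf g p q ∧ MvPolynomial.aeval y q ≠ 0 ∧
    r = MvPolynomial.aeval y p / MvPolynomial.aeval y q then h.choose else 0

namespace PerfectNetwork

variable {n : ℕ} {I : Finset (Fin n)} (N : PerfectNetwork n I)

section Measurement

variable {k m : ℕ} (hk : I.card = k) (hm : Iᶜ.card = m)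

/-- The entry `(p, q)` of the boundary measurement matrix, as a power series; rows are indexed by
sources and columns by sinks, in increasing order. -/
noncomputable def entrySeries (a : Fin k × Fin m) : MvPowerSeries N.E ℤ :=
  N.boundarySeries (I.orderEmbOfFin hk a.1) (Iᶜ.orderEmbOfFin hm a.2)

/-- The boundary measurement map `M_N` from edge weights to `k × m` matrices. -/
noncomputable def boundaryMap (y : N.E → ℝ) : Fin k × Fin m → ℝ :=
  fun a => rationalValue (N.entrySeries hk hm a) y

/-- The points of the space of edge weights `(ℝ ∖ 0)^E` at which `M_N` is regular. -/
def domain : Set (N.E → ℝ) :=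
  {y | (∀ e, y e ≠ 0) ∧ ∀ a, RegularAt (N.entrySeries hk hm a) y}

end Measurement

/-! #### Brackets on flags and on edge weights -/

section Brackets

variable (P : UniversalParams)

/-- The coefficients of the universal bracket: `{x_v^i, x_v^j} = α_ij x_v^i x_v^j` at white vertices,
`{x_v^i, x_v^j} = β_ij x_v^i x_v^j` at black ones, and all the other brackets of flag coordinates
are zero. -/
def flagCoeff : NetFlag n N.W → NetFlag n N.W → ℝ
  | Sum.inr (v, i), Sum.inr (v', j) =>
      if v = v' then
        if N.white v then skewArray P.a12 P.a13 P.a23 i j else skewArray P.b12 P.b13 P.b23 i j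
      else 0
  | _, _ => 0

/-- The universal bracket on functions of the flag coordinates. -/
noncomputable def flagBracket (f g : (NetFlag n N.W → ℝ) → ℝ) (x : NetFlag n N.W → ℝ) : ℝ :=
  quadraticBracket (N.flagCoeff P) f g x

/-- The weight map: the weight of an edge is the product of the coordinates of its two flags. -/
def weightMap (x : NetFlag n N.W → ℝ) : N.E → ℝ := fun e => x (N.src e) * x (N.tgt e)

/-- The coefficients of the bracket induced on edge weights:
`{w_e, w_e'} = {x_s x_t, x_s' x_t'}` for `w_e = x_s x_t` and `w_e' = x_s' x_t'`. -/
def edgeCoeff (e e' : N.E) : ℝ :=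
  N.flagCoeff P (N.src e) (N.src e') + N.flagCoeff P (N.src e) (N.tgt e') +
    N.flagCoeff P (N.tgt e) (N.src e') + N.flagCoeff P (N.tgt e) (N.tgt e')

/-- The bracket on functions of edge weights; it is the pushforward of the
universal bracket under the weight map, see `edgeBracket_weightMap`. -/
noncomputable def edgeBracket (f g : (N.E → ℝ) → ℝ) (y : N.E → ℝ) : ℝ :=
  quadraticBracket (N.edgeCoeff P) f g y

/-- The universal bracket and the bracket on edge weights are related by the weight map. -/
theorem edgeBracket_weightMap (f g : (N.E → ℝ) → ℝ) (x : NetFlag n N.W → ℝ)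
    (hf : DifferentiableAt ℝ f (N.weightMap x)) (hg : DifferentiableAt ℝ g (N.weightMap x)) :
    N.flagBracket P (f ∘ N.weightMap) (g ∘ N.weightMap) x = N.edgeBracket P f g (N.weightMap x) := by
  classical
  have key : ∀ h : (N.E → ℝ) → ℝ, DifferentiableAt ℝ h (N.weightMap x) → ∀ s : NetFlag n N.W,
      x s * partialDeriv (h ∘ N.weightMap) s x = ∑ e, partialDeriv h e (N.weightMap x) *
        N.weightMap x e * ((if s = N.src e then 1 else 0) + (if s = N.tgt e then 1 else 0)) := by
    intro h hh s
    have hw : HasFDerivAt N.weightMap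
        (ContinuousLinearMap.pi fun e =>
          x (N.src e) • (ContinuousLinearMap.proj (R := ℝ) (φ := fun _ : NetFlag n N.W => ℝ) (N.tgt e))
            + x (N.tgt e) •
              (ContinuousLinearMap.proj (R := ℝ) (φ := fun _ : NetFlag n N.W => ℝ) (N.src e))) x := by
      rw [hasFDerivAt_pi]
      intro e
      exact (hasFDerivAt_apply (N.src e) x).mul (hasFDerivAt_apply (N.tgt e) x)
    have hc := hh.hasFDerivAt.comp x hw
    unfold partialDeriv
    rw [hc.fderiv, ContinuousLinearMap.comp_apply]
    set v := (ContinuousLinearMap.pi fun e =>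
          x (N.src e) • (ContinuousLinearMap.proj (R := ℝ) (φ := fun _ : NetFlag n N.W => ℝ) (N.tgt e))
            + x (N.tgt e) •
              (ContinuousLinearMap.proj (R := ℝ) (φ := fun _ : NetFlag n N.W => ℝ) (N.src e)))
          (Pi.single s (1 : ℝ)) with hv
    have hv' : v = ∑ e, v e • (Pi.single e (1 : ℝ) : N.E → ℝ) := by
      ext a
      simp [Finset.sum_apply, Pi.single_apply]
    rw [hv', map_sum, Finset.mul_sum]
    refine Finset.sum_congr rfl fun e _ => ?_
    have hve : x s * v e = N.weightMap x e *
        ((if s = N.src e then 1 else 0) + (if s = N.tgt e then 1 else 0)) := by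
      simp only [hv, weightMap, ContinuousLinearMap.pi_apply, add_apply,
        smul_apply, ContinuousLinearMap.proj_apply, Pi.single_apply, smul_eq_mul]
      by_cases h1 : s = N.src e <;> by_cases h2 : s = N.tgt e
      · subst h1; simp [← h2]; ring
      · subst h1; simp [h2, Ne.symm h2]
      · subst h2; simp [h1, Ne.symm h1, mul_comm]
      · simp [h1, h2, Ne.symm h1, Ne.symm h2]
    rw [map_smul, smul_eq_mul, ← mul_assoc, hve]
    ring
  unfold flagBracket edgeBracket quadraticBracket
  have step : ∀ s s' : NetFlag n N.W, N.flagCoeff P s s' * x s * x s' *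
      partialDeriv (f ∘ N.weightMap) s x * partialDeriv (g ∘ N.weightMap) s' x =
      ∑ e, ∑ e', partialDeriv f e (N.weightMap x) * N.weightMap x e *
        (partialDeriv g e' (N.weightMap x) * N.weightMap x e') * (N.flagCoeff P s s' *
          ((if s = N.src e then 1 else 0) + (if s = N.tgt e then 1 else 0)) *
          ((if s' = N.src e' then 1 else 0) + (if s' = N.tgt e' then 1 else 0))) := by
    intro s s'
    have h1 := key f hf s
    have h2 := key g hg s'
    calc _ = N.flagCoeff P s s' * ((x s * partialDeriv (f ∘ N.weightMap) s x) *
          (x s' * partialDeriv (g ∘ N.weightMap) s' x)) := by ring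
      _ = _ := by
        rw [h1, h2, Finset.sum_mul_sum, Finset.mul_sum]
        refine Finset.sum_congr rfl fun e _ => ?_
        rw [Finset.mul_sum]
        refine Finset.sum_congr rfl fun e' _ => ?_
        ring
  simp_rw [step]
  have swap : ∀ F : NetFlag n N.W → NetFlag n N.W → N.E → N.E → ℝ,
      ∑ s, ∑ s', ∑ e, ∑ e', F s s' e e' = ∑ e, ∑ e', ∑ s, ∑ s', F s s' e e' := by
    intro F
    calc _ = ∑ s, ∑ e, ∑ s', ∑ e', F s s' e e' :=
          Finset.sum_congr rfl fun s _ => Finset.sum_comm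
      _ = ∑ e, ∑ s, ∑ s', ∑ e', F s s' e e' := Finset.sum_comm
      _ = ∑ e, ∑ s, ∑ e', ∑ s', F s s' e e' :=
          Finset.sum_congr rfl fun e _ => Finset.sum_congr rfl fun s _ => Finset.sum_comm
      _ = _ := Finset.sum_congr rfl fun e _ => Finset.sum_comm
  rw [swap]
  refine Finset.sum_congr rfl fun e _ => Finset.sum_congr rfl fun e' _ => ?_
  have hsum : ∑ s, ∑ s', N.flagCoeff P s s' *
      ((if s = N.src e then (1 : ℝ) else 0) + (if s = N.tgt e then 1 else 0)) *
      ((if s' = N.src e' then (1 : ℝ) else 0) + (if s' = N.tgt e' then 1 else 0)) =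
      N.edgeCoeff P e e' := by
    simp [mul_add, Finset.sum_add_distrib, edgeCoeff]
    ring
  simp_rw [← Finset.mul_sum]
  rw [hsum]
  ring

end Brackets

/-- `M_N` is a Poisson map from the space of edge weights, with the bracket obtained from the universal
bracket with parameters `P`, to the space of `k × m` matrices with the bracket `B`: the entries of `M_N`
are rational functions of the edge weights, and `{f ∘ M_N, g ∘ M_N}_N = {f, g} ∘ M_N` on the domain of
`M_N`. -/
def IsPoissonMap (P : UniversalParams) {k m : ℕ} (hk : I.card = k) (hm : Iᶜ.card = m)
    (B : PoissonBracket (smoothFunctions (Fin k × Fin m))) : Prop :=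
  (∀ a, ∃ p q, IsFractionOf (N.entrySeries hk hm a) p q) ∧
    ∀ f g : smoothFunctions (Fin k × Fin m), ∀ y ∈ N.domain hk hm,
      N.edgeBracket P (f.1 ∘ N.boundaryMap hk hm) (g.1 ∘ N.boundaryMap hk hm) y =
        (B.bracket f g).1 (N.boundaryMap hk hm y)

end PerfectNetwork

/-!
The brackets. They have the form `∑ π_{ab} ∂_a f ∂_b g` with quadratic coefficients `π_{ab}`. As the
derivations `∂_a` commute, the Jacobi identity only has to be checked on coordinates. There both `s_=` and `s_×` are expressed
through the signs of the differences of the indices, and the identity reduces to the cyclic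
relation `ordSign_cyclic` between three signs, which is the modified classical Yang-Baxter
equation in disguise.

Signs. The concordance number of a closed curve does not depend on the direction used to compute
it. With one generic direction fixed for the whole network, the sign of a path is a product of
local factors along the path times a factor depending only on the endpoints (`pathSign_eq`). Hence
the boundary measurements are, up to signs depending on the endpoints, sums of entries of the series
`∑_r A^r` for a signed transfer matrix `A`, and they are rational by Cramer's rule. A path through an
edge `e` splits into a part before and a part after `e`, so the derivatives factor:
`w_e ∂_e M(i,j) = ± U_i(e) V_j(e)` (`exists_factorization`).

The bracket. The bracket of edge weights is a sum of local terms over the vertices. Paired with two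
unit flows, each local term depends on the six parameters only through `α` at a white vertex and
through `β` at a black one (`sum_edgeCoeff`). Thus the bracket of two measurements is a combination
of the sum of a universal antisymmetric vertex pairing over all vertices, and of the same sum with
opposite signs at black and white vertices. Two facts evaluate them.

* The sum of the vertex pairing over all vertices equals `2 s_×`, for arbitrary flows with the given
  sources and sinks (`sum_vertexPairing`). This is where planarity enters, by way of angles. For
  disjoint edges, the alternating sum of the angles under which the endpoints see each other
  vanishes (`viewAngle_exchange`), so a double sum over pairs of edges collapses to
  contributions of edges with a common vertex. Those at an internal vertex add up to `π` times
  the pairing (`cornerAngle_sum`), and those at the boundary are read off from the convex position of the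
  boundary vertices (`chordAngle_eq_sCross`).
* Exchanging the sinks of the two flows reverses the local term at white vertices and preserves it
  at black ones, up to a common sign (`vertexBracket_exchange`). This follows from the
  factorization, and the common sign is `1` where `s_=` does not vanish (`endpointSign_mul`). As `s_=(i,j,i',j') = -s_×(i,j',i',j)`, the evaluation
  of the exchanged pairing produces the term with `s_=`.

Together they give the identity of formal power series `sum_edgeCoeff_smul_eulerDeriv`. It passes to
the values of the rational functions at every regular point through the predicate `HasValueAt`.

Uniqueness. The network formed by a cycle with one leg to every boundary vertex has measurements
that are all nonzero series (`boundarySeries_cycleNetwork_ne_zero`), so at some point all the entries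
are regular and nonzero. There the bracket of two different entries of one row determines `α`, and
that of two different entries of one column determines `β`. When there are no such entries, the
bracket does not depend on the parameter in question (`boundaryBracket_unique`).
-/

/-! ### Quadratic Poisson brackets from commuting derivations -/

/-- The bracket `{f, g} = ∑ π a b * ∂_a f * ∂_b g` defined by commuting derivations `∂_a` and a
skew-symmetric array `π`. The Jacobi identity holds as soon as it holds for the array. -/
noncomputable def PoissonBracket.ofDerivations {A : Type*} [CommRing A] [Algebra ℝ A]
    {ι : Type*} [Fintype ι] (D : ι → Derivation ℝ A A)
    (hD : ∀ a b f, D a (D b f) = D b (D a f)) (π : ι → ι → A) (hπ : ∀ a b, π a b = -π b a)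
    (hJ : ∀ a b c,
      ∑ d, (π a d * D d (π b c) + π b d * D d (π c a) + π c d * D d (π a b)) = 0) :
    PoissonBracket A where
  bracket := LinearMap.mk₂ ℝ (fun f g => ∑ a, ∑ b, π a b * D a f * D b g)
    (fun f f' g => by
      simp only [map_add, mul_add, add_mul, Finset.sum_add_distrib])
    (fun c f g => by
      simp only [Derivation.map_smul, mul_smul_comm, smul_mul_assoc, Finset.smul_sum])
    (fun f g g' => by
      simp only [map_add, mul_add, Finset.sum_add_distrib])
    (fun c f g => by
      simp only [Derivation.map_smul, mul_smul_comm, Finset.smul_sum])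
  skew f g := by
    simp only [LinearMap.mk₂_apply]
    rw [Finset.sum_comm, ← Finset.sum_neg_distrib]
    refine Finset.sum_congr rfl fun a _ => ?_
    rw [← Finset.sum_neg_distrib]
    refine Finset.sum_congr rfl fun b _ => ?_
    rw [hπ b a]
    ring
  leibniz f g h := by
    simp only [LinearMap.mk₂_apply, Finset.sum_mul, Finset.mul_sum, ← Finset.sum_add_distrib]
    refine Finset.sum_congr rfl fun a _ => Finset.sum_congr rfl fun b _ => ?_
    rw [Derivation.leibniz, smul_eq_mul, smul_eq_mul]
    ring
  jacobi := by
    -- `F` collects the terms with first derivatives only, `U` and `S` those in which the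
    -- last, respectively the middle function is differentiated twice.
    let F : A → A → A → A := fun f g h => ∑ a, ∑ b, ∑ c,
      (∑ d, π a d * D d (π b c)) * (D a f * D b g * D c h)
    let S : A → A → A → A := fun f g h => ∑ a, ∑ d, ∑ b, ∑ c,
      π a d * π b c * (D a f * D d (D b g) * D c h)
    let U : A → A → A → A := fun f g h => ∑ a, ∑ d, ∑ b, ∑ c,
      π a d * π b c * (D a f * D b g * D d (D c h))
    have expand : ∀ f g h, (∑ a, ∑ d, π a d * D a f * D d (∑ b, ∑ c, π b c * D b g * D c h)) =
        F f g h + S f g h + U f g h := by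
      intro f g h
      have hF : F f g h = ∑ a, ∑ d, ∑ b, ∑ c,
          π a d * D d (π b c) * (D a f * D b g * D c h) := by
        refine Finset.sum_congr rfl fun a _ => ?_
        have : ∀ b, (∑ c, (∑ d, π a d * D d (π b c)) * (D a f * D b g * D c h)) =
            ∑ d, ∑ c, π a d * D d (π b c) * (D a f * D b g * D c h) := by
          intro b
          simp only [Finset.sum_mul]
          exact Finset.sum_comm
        simp only [this]
        exact Finset.sum_comm
      rw [hF]
      simp only [S, U, ← Finset.sum_add_distrib]
      refine Finset.sum_congr rfl fun a _ => Finset.sum_congr rfl fun d _ => ?_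
      simp only [map_sum, Finset.mul_sum]
      refine Finset.sum_congr rfl fun b _ => Finset.sum_congr rfl fun c _ => ?_
      simp only [Derivation.leibniz, smul_eq_mul]
      ring
    have cancel : ∀ f g h, S g h f = -U f g h := by
      intro f g h
      have h1 : S g h f = ∑ c, ∑ a, ∑ d, ∑ b,
          π b c * π d a * (D b g * D c (D d h) * D a f) := by
        simp only [S]
        rw [Finset.sum_comm]
        refine Finset.sum_congr rfl fun c _ => ?_
        calc _ = ∑ b, ∑ a, ∑ d, π b c * π d a * (D b g * D c (D d h) * D a f) :=
              Finset.sum_congr rfl fun b _ => Finset.sum_comm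
          _ = ∑ a, ∑ b, ∑ d, π b c * π d a * (D b g * D c (D d h) * D a f) := Finset.sum_comm
          _ = _ := Finset.sum_congr rfl fun a _ => Finset.sum_comm
      have h2 : U f g h = ∑ c, ∑ a, ∑ d, ∑ b,
          π a d * π b c * (D a f * D b g * D d (D c h)) := by
        simp only [U]
        calc _ = ∑ a, ∑ d, ∑ c, ∑ b, π a d * π b c * (D a f * D b g * D d (D c h)) :=
              Finset.sum_congr rfl fun a _ => Finset.sum_congr rfl fun d _ => Finset.sum_comm
          _ = ∑ a, ∑ c, ∑ d, ∑ b, π a d * π b c * (D a f * D b g * D d (D c h)) :=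
              Finset.sum_congr rfl fun a _ => Finset.sum_comm
          _ = _ := Finset.sum_comm
      rw [h1, h2]
      simp only [← Finset.sum_neg_distrib]
      refine Finset.sum_congr rfl fun c _ => Finset.sum_congr rfl fun a _ =>
        Finset.sum_congr rfl fun d _ => Finset.sum_congr rfl fun b _ => ?_
      rw [hπ d a, hD d c]
      ring
    have first : ∀ f g h, F f g h + F g h f + F h f g = 0 := by
      intro f g h
      have h1 : F g h f = ∑ a, ∑ b, ∑ c,
          (∑ d, π b d * D d (π c a)) * (D a f * D b g * D c h) := by
        simp only [F]
        calc _ = ∑ b, ∑ a, ∑ c, (∑ d, π b d * D d (π c a)) * (D b g * D c h * D a f) :=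
              Finset.sum_congr rfl fun b _ => Finset.sum_comm
          _ = ∑ a, ∑ b, ∑ c, (∑ d, π b d * D d (π c a)) * (D b g * D c h * D a f) :=
              Finset.sum_comm
          _ = _ := Finset.sum_congr rfl fun a _ => Finset.sum_congr rfl fun b _ =>
              Finset.sum_congr rfl fun c _ => by ring
      have h2 : F h f g = ∑ a, ∑ b, ∑ c,
          (∑ d, π c d * D d (π a b)) * (D a f * D b g * D c h) := by
        simp only [F]
        calc _ = ∑ a, ∑ c, ∑ b, (∑ d, π c d * D d (π a b)) * (D c h * D a f * D b g) :=
              Finset.sum_comm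
          _ = ∑ a, ∑ b, ∑ c, (∑ d, π c d * D d (π a b)) * (D c h * D a f * D b g) :=
              Finset.sum_congr rfl fun a _ => Finset.sum_comm
          _ = _ := Finset.sum_congr rfl fun a _ => Finset.sum_congr rfl fun b _ =>
              Finset.sum_congr rfl fun c _ => by ring
      rw [h1, h2]
      simp only [F, ← Finset.sum_add_distrib]
      refine Finset.sum_eq_zero fun a _ => Finset.sum_eq_zero fun b _ =>
        Finset.sum_eq_zero fun c _ => ?_
      rw [← add_mul, ← add_mul, ← Finset.sum_add_distrib, ← Finset.sum_add_distrib, hJ, zero_mul]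
    intro f g h
    simp only [LinearMap.mk₂_apply]
    rw [expand, expand, expand]
    linear_combination first f g h + cancel f g h + cancel g h f + cancel h f g

section Smooth

variable {ι : Type*} [Fintype ι]

theorem contDiff_smoothFunctions (f : smoothFunctions ι) : ContDiff ℝ ∞ f.1 := f.2

theorem differentiable_smoothFunctions (f : smoothFunctions ι) : Differentiable ℝ f.1 :=
  (contDiff_smoothFunctions f).differentiable (by simp)

variable [DecidableEq ι]

theorem contDiff_partialDeriv {f : (ι → ℝ) → ℝ} (hf : ContDiff ℝ ∞ f) (a : ι) :
    ContDiff ℝ ∞ (partialDeriv f a) :=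
  (hf.fderiv_right (m := ∞) (by simp)).clm_apply contDiff_const

/-- The partial derivative as a derivation of the algebra of smooth functions. -/
noncomputable def partialDerivation (a : ι) :
    Derivation ℝ (smoothFunctions ι) (smoothFunctions ι) where
  toFun f := ⟨partialDeriv f.1 a, contDiff_partialDeriv (contDiff_smoothFunctions f) a⟩
  map_add' f g := by
    ext x
    change partialDeriv (f.1 + g.1) a x = partialDeriv f.1 a x + partialDeriv g.1 a x
    simp [partialDeriv, fderiv_add (differentiable_smoothFunctions f x) (differentiable_smoothFunctions g x)]
  map_smul' c f := by
    ext x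
    change partialDeriv (c • f.1) a x = c • partialDeriv f.1 a x
    simp [partialDeriv, fderiv_const_smul (differentiable_smoothFunctions f x)]
  map_one_eq_zero' := by
    ext x
    change partialDeriv (1 : (ι → ℝ) → ℝ) a x = 0
    simp [partialDeriv]
  leibniz' f g := by
    ext x
    change partialDeriv (f.1 * g.1) a x = f.1 x * partialDeriv g.1 a x + g.1 x * partialDeriv f.1 a x
    simp [partialDeriv, fderiv_mul (differentiable_smoothFunctions f x) (differentiable_smoothFunctions g x)]

@[simp]
theorem partialDerivation_apply (a : ι) (f : smoothFunctions ι) (x : ι → ℝ) :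
    (partialDerivation a f).1 x = partialDeriv f.1 a x := rfl

theorem partialDerivation_comm (a b : ι) (f : smoothFunctions ι) :
    partialDerivation a (partialDerivation b f) = partialDerivation b (partialDerivation a f) := by
  have key : ∀ (c d : ι) (x : ι → ℝ), partialDeriv (partialDeriv f.1 c) d x =
      fderiv ℝ (fderiv ℝ f.1) x (Pi.single d 1) (Pi.single c 1) := by
    intro c d x
    have hd : DifferentiableAt ℝ (fderiv ℝ f.1) x :=
      (((contDiff_smoothFunctions f).fderiv_right (m := ∞) (by simp)).differentiable (by simp)) x
    simp only [partialDeriv]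
    rw [show partialDeriv f.1 c = fun y => fderiv ℝ f.1 y (Pi.single c 1) from rfl]
    rw [fderiv_clm_apply hd (differentiableAt_const _)]
    simp
  ext x
  change partialDeriv (partialDeriv f.1 b) a x = partialDeriv (partialDeriv f.1 a) b x
  rw [key, key]
  have hs : IsSymmSndFDerivAt ℝ f.1 x :=
    ((contDiff_smoothFunctions f).contDiffAt (x := x)).isSymmSndFDerivAt
      (by simpa using WithTop.coe_le_coe.2 (le_top : (2 : ℕ∞) ≤ ⊤))
  exact hs _ _

theorem partialDerivation_coordFn (a b : ι) :
    partialDerivation a (coordFn b) = if a = b then 1 else 0 := by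
  ext x
  change fderiv ℝ (fun x : ι → ℝ => x b) x (Pi.single a 1) = _
  rw [(hasFDerivAt_apply b x).fderiv]
  by_cases h : a = b
  · subst h; simp
  · simp [h, Ne.symm h]

end Smooth

/-! ### The functions `s_=` and `s_×` in terms of signs of differences -/

/-- The sign of `b - a` for the linear order of the boundary points. -/
noncomputable def ordSign {n : ℕ} (a b : Fin n) : ℝ :=
  if a < b then 1 else if b < a then -1 else 0

theorem ordSign_self {n : ℕ} (a : Fin n) : ordSign a a = 0 := by simp [ordSign]

theorem ordSign_swap {n : ℕ} (a b : Fin n) : ordSign b a = -ordSign a b := by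
  rcases lt_trichotomy a b with h | h | h
  · simp [ordSign, h, h.not_gt]
  · simp [ordSign, h]
  · simp [ordSign, h, h.not_gt]

/-- The signs of a linear order satisfy a modified classical Yang-Baxter equation. -/
theorem ordSign_cyclic {n : ℕ} (a b c : Fin n) :
    ordSign a b * ordSign b c + ordSign b c * ordSign c a + ordSign c a * ordSign a b =
      (if a = b ∧ b = c then 1 else 0) - 1 := by
  rcases lt_trichotomy a b with h | h | h <;> rcases lt_trichotomy b c with h' | h' | h' <;>
    rcases lt_trichotomy a c with h'' | h'' | h'' <;> first
      | (exfalso; omega)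
      | (simp [ordSign, h, h', h'', h.not_gt, h'.not_gt, h''.not_gt, h.ne, h.ne', h'.ne, h'.ne'])
      | (subst_vars; simp [ordSign, *, not_lt_of_gt]; done)
      | (subst_vars; simp [ordSign, *, not_lt_of_gt, ne_of_gt, ne_of_lt])

theorem sCross_eq {n : ℕ} {i j i' j' : Fin n} (h₁ : i ≠ j) (h₂ : i ≠ j') (h₃ : i' ≠ j)
    (h₄ : i' ≠ j') : sCross i j i' j' =
      -(ordSign j j' - ordSign j i' - ordSign i j' + ordSign i i') / 2 := by
  rcases lt_or_gt_of_ne h₁ with h₁ | h₁ <;> rcases lt_or_gt_of_ne h₂ with h₂ | h₂ <;>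
  rcases lt_or_gt_of_ne h₃ with h₃ | h₃ <;> rcases lt_or_gt_of_ne h₄ with h₄ | h₄ <;>
  rcases lt_trichotomy i i' with h₅ | h₅ | h₅ <;> rcases lt_trichotomy j j' with h₆ | h₆ | h₆ <;>
  first
    | (exfalso; omega)
    | (subst_vars; simp [sCross, Cyc3, Cyc4, ordSign, *, not_lt_of_gt, ne_of_gt, ne_of_lt]; done)
    | (subst_vars; simp [sCross, Cyc3, Cyc4, ordSign, *, not_lt_of_gt, ne_of_gt, ne_of_lt]; norm_num)

theorem sPar_eq_neg_sCross {n : ℕ} {i j i' j' : Fin n} (h₁ : i ≠ j) (h₂ : i ≠ j') (h₃ : i' ≠ j)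
    (h₄ : i' ≠ j') : sPar i j i' j' = -sCross i j' i' j := by
  rw [sCross_eq h₂ h₁ h₄ h₃]
  rcases lt_or_gt_of_ne h₁ with h₁ | h₁ <;> rcases lt_or_gt_of_ne h₂ with h₂ | h₂ <;>
  rcases lt_or_gt_of_ne h₃ with h₃ | h₃ <;> rcases lt_or_gt_of_ne h₄ with h₄ | h₄ <;>
  rcases lt_trichotomy i i' with h₅ | h₅ | h₅ <;> rcases lt_trichotomy j j' with h₆ | h₆ | h₆ <;>
  first
    | (exfalso; omega)
    | (subst_vars; simp [sPar, Cyc3, Cyc4, ordSign, *, not_lt_of_gt, ne_of_gt, ne_of_lt]; done)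
    | (subst_vars; simp [sPar, Cyc3, Cyc4, ordSign, *, not_lt_of_gt, ne_of_gt, ne_of_lt]; norm_num)

/-! ### The family of brackets on matrices -/

section MatrixBracket

variable {n k m : ℕ} (r : Fin k → Fin n) (c : Fin m → Fin n)

/-- The brackets of the matrix entries, as functions of the matrix. The rows and columns of
the matrix are indexed by the boundary points `r p` and `c q`. -/
noncomputable def entryBracket (α β : ℝ) (a b : Fin k × Fin m) : smoothFunctions (Fin k × Fin m) :=
  ((α - β) * sPar (r a.1) (c a.2) (r b.1) (c b.2)) • (coordFn (a.1, b.2) * coordFn (b.1, a.2)) +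
    ((α + β) * sCross (r a.1) (c a.2) (r b.1) (c b.2)) • (coordFn a * coordFn b)

variable {r c}

theorem entryBracket_skew (h : ∀ p q, r p ≠ c q) (α β : ℝ) (a b : Fin k × Fin m) :
    entryBracket r c α β a b = -entryBracket r c α β b a := by
  have h1 : sPar (r b.1) (c b.2) (r a.1) (c a.2) = -sPar (r a.1) (c a.2) (r b.1) (c b.2) := by
    rw [sPar_eq_neg_sCross (h _ _) (h _ _) (h _ _) (h _ _),
      sPar_eq_neg_sCross (h _ _) (h _ _) (h _ _) (h _ _),
      sCross_eq (h _ _) (h _ _) (h _ _) (h _ _), sCross_eq (h _ _) (h _ _) (h _ _) (h _ _),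
      ordSign_swap (c a.2) (c b.2), ordSign_swap (r a.1) (r b.1),
      ordSign_swap (r a.1) (c a.2), ordSign_swap (r b.1) (c b.2)]
    ring
  have h2 : sCross (r b.1) (c b.2) (r a.1) (c a.2) =
      -sCross (r a.1) (c a.2) (r b.1) (c b.2) := by
    rw [sCross_eq (h _ _) (h _ _) (h _ _) (h _ _), sCross_eq (h _ _) (h _ _) (h _ _) (h _ _),
      ordSign_swap (c a.2) (c b.2), ordSign_swap (r a.1) (r b.1),
      ordSign_swap (r a.1) (c b.2), ordSign_swap (r b.1) (c a.2)]
    ring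
  simp only [entryBracket, h1, h2, mul_neg, neg_smul, neg_add, neg_neg]
  rw [mul_comm (coordFn (b.1, a.2)), mul_comm (coordFn b)]

theorem entryBracket_hamiltonian (α β : ℝ) (a b d : Fin k × Fin m) :
    ∑ e, entryBracket r c α β a e * partialDerivation e (entryBracket r c α β b d) =
      ((α - β) * sPar (r b.1) (c b.2) (r d.1) (c d.2)) •
        (entryBracket r c α β a (b.1, d.2) * coordFn (d.1, b.2) +
          coordFn (b.1, d.2) * entryBracket r c α β a (d.1, b.2)) +
      ((α + β) * sCross (r b.1) (c b.2) (r d.1) (c d.2)) •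
        (entryBracket r c α β a b * coordFn d + coordFn b * entryBracket r c α β a d) := by
  have h1 : ∀ e, partialDerivation e (entryBracket r c α β b d) =
      ((α - β) * sPar (r b.1) (c b.2) (r d.1) (c d.2)) •
        ((if e = (b.1, d.2) then 1 else 0) * coordFn (d.1, b.2) +
          coordFn (b.1, d.2) * (if e = (d.1, b.2) then 1 else 0)) +
      ((α + β) * sCross (r b.1) (c b.2) (r d.1) (c d.2)) •
        ((if e = b then 1 else 0) * coordFn d + coordFn b * (if e = d then 1 else 0)) := by
    intro e
    simp only [entryBracket, map_add, Derivation.map_smul, Derivation.leibniz,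
      partialDerivation_coordFn, smul_eq_mul]
    congr 2 <;> ring
  simp only [h1, mul_add, mul_smul_comm, Finset.sum_add_distrib, ← Finset.smul_sum]
  simp only [← mul_assoc, mul_ite, mul_one, mul_zero, ite_mul, zero_mul, Finset.sum_ite_eq',
    Finset.mem_univ, if_true]
  simp only [mul_comm (coordFn _) (entryBracket _ _ _ _ _ _)]

theorem entryBracket_jacobi (hr : Function.Injective r) (hc : Function.Injective c)
    (h : ∀ p q, r p ≠ c q) (α β : ℝ) (a b d : Fin k × Fin m) :
    ∑ e, (entryBracket r c α β a e * partialDerivation e (entryBracket r c α β b d) +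
      entryBracket r c α β b e * partialDerivation e (entryBracket r c α β d a) +
      entryBracket r c α β d e * partialDerivation e (entryBracket r c α β a b)) = 0 := by
  rw [Finset.sum_add_distrib, Finset.sum_add_distrib, entryBracket_hamiltonian,
    entryBracket_hamiltonian, entryBracket_hamiltonian]
  obtain ⟨i₁, j₁⟩ := a
  obtain ⟨i₂, j₂⟩ := b
  obtain ⟨i₃, j₃⟩ := d
  ext M
  simp only [entryBracket, sPar_eq_neg_sCross (h _ _) (h _ _) (h _ _) (h _ _),
    sCross_eq (h _ _) (h _ _) (h _ _) (h _ _)]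
  simp only [Subalgebra.coe_add, Subalgebra.coe_mul, Subalgebra.coe_smul, Pi.add_apply,
    Pi.mul_apply, Pi.smul_apply, smul_eq_mul, Subalgebra.coe_zero, Pi.zero_apply]
  have hx : ∀ a : Fin k × Fin m, (coordFn a).1 M = M a := fun _ => rfl
  simp only [hx]
  -- A triple containing both rows and columns is not constant; a constant triple of rows
  -- or of columns contributes a multiple of a `3 × 3` determinant with equal lines.
  have T : ∀ x y z : Fin n, ¬(x = y ∧ y = z) →
      ordSign x y * ordSign y z + ordSign y z * ordSign z x + ordSign z x * ordSign x y = -1 := by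
    intro x y z hxyz
    rw [ordSign_cyclic, if_neg hxyz]
    ring
  have T112 : ∀ x y z, _ := fun x y z =>
    T (r x) (r y) (c z) (fun hh => h _ _ hh.2)
  have T122 : ∀ x y z, _ := fun x y z =>
    T (r x) (c y) (c z) (fun hh => h _ _ hh.1)
  have TI : (M (i₁, j₃) * M (i₂, j₁) * M (i₃, j₂) - M (i₁, j₂) * M (i₂, j₃) * M (i₃, j₁)) *
      (ordSign (r i₁) (r i₂) * ordSign (r i₂) (r i₃) + ordSign (r i₂) (r i₃) * ordSign (r i₃) (r i₁)
        + ordSign (r i₃) (r i₁) * ordSign (r i₁) (r i₂) + 1) = 0 := by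
    rw [ordSign_cyclic]
    split_ifs with hh
    · rw [← hr hh.1, ← hr (hh.1.trans hh.2)]
      ring
    · ring
  have TJ : (M (i₁, j₃) * M (i₂, j₁) * M (i₃, j₂) - M (i₁, j₂) * M (i₂, j₃) * M (i₃, j₁)) *
      (ordSign (c j₁) (c j₂) * ordSign (c j₂) (c j₃) + ordSign (c j₂) (c j₃) * ordSign (c j₃) (c j₁)
        + ordSign (c j₃) (c j₁) * ordSign (c j₁) (c j₂) + 1) = 0 := by
    rw [ordSign_cyclic]
    split_ifs with hh
    · rw [← hc hh.1, ← hc (hh.1.trans hh.2)]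
      ring
    · ring
  have e1 := T112 i₁ i₂ j₁
  have e2 := T112 i₁ i₂ j₂
  have e3 := T112 i₁ i₃ j₁
  have e4 := T112 i₁ i₃ j₃
  have e5 := T112 i₂ i₃ j₂
  have e6 := T112 i₂ i₃ j₃
  have f1 := T122 i₁ j₁ j₂
  have f2 := T122 i₁ j₁ j₃
  have f3 := T122 i₂ j₁ j₂
  have f4 := T122 i₂ j₂ j₃
  have f5 := T122 i₃ j₁ j₃
  have f6 := T122 i₃ j₂ j₃
  simp only [ordSign_swap (r _) (c _), ordSign_swap (r i₁) (r i₂), ordSign_swap (r i₁) (r i₃),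
    ordSign_swap (r i₂) (r i₃), ordSign_swap (c j₁) (c j₂), ordSign_swap (c j₁) (c j₃),
    ordSign_swap (c j₂) (c j₃)] at e1 e2 e3 e4 e5 e6 f1 f2 f3 f4 f5 f6 TI TJ ⊢
  linear_combination (α - β) ^ 2 / 4 * (TI - TJ +
    M (i₁, j₂) * M (i₂, j₃) * M (i₃, j₁) * (e1 + e4 - f2 + e5 - f3 - f6) +
    M (i₁, j₃) * M (i₂, j₁) * M (i₃, j₂) * (-e2 - e3 + f1 - e6 + f4 + f5))

/-- The Poisson bracket on the space of `k × m` matrices with parameters `α` and `β`. -/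
noncomputable def matrixBracket (hr : Function.Injective r) (hc : Function.Injective c)
    (h : ∀ p q, r p ≠ c q) (α β : ℝ) : PoissonBracket (smoothFunctions (Fin k × Fin m)) :=
  PoissonBracket.ofDerivations partialDerivation partialDerivation_comm (entryBracket r c α β)
    (entryBracket_skew h α β) (entryBracket_jacobi hr hc h α β)

variable (hr : Function.Injective r) (hc : Function.Injective c) (h : ∀ p q, r p ≠ c q)

theorem matrixBracket_apply (α β : ℝ) (f g : smoothFunctions (Fin k × Fin m))
    (M : Fin k × Fin m → ℝ) : ((matrixBracket hr hc h α β).bracket f g).1 M =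
      ∑ a, ∑ b, (entryBracket r c α β a b).1 M * partialDeriv f.1 a M * partialDeriv g.1 b M := by
  have h1 : (matrixBracket hr hc h α β).bracket f g = ∑ a, ∑ b,
    entryBracket r c α β a b * partialDerivation a f * partialDerivation b g := rfl
  rw [h1]
  simp [Finset.sum_apply]

theorem matrixBracket_coordFn (α β : ℝ) (a b : Fin k × Fin m) :
    (matrixBracket hr hc h α β).bracket (coordFn a) (coordFn b) = entryBracket r c α β a b := by
  have h1 : (matrixBracket hr hc h α β).bracket (coordFn a) (coordFn b) = ∑ a', ∑ b',
    entryBracket r c α β a' b' * partialDerivation a' (coordFn a) *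
      partialDerivation b' (coordFn b) := rfl
  rw [h1]
  simp [partialDerivation_coordFn]

/-- A bracket of the family is determined by the brackets of the entries. -/
theorem matrixBracket_congr {α β α' β' : ℝ}
    (he : ∀ a b, entryBracket r c α β a b = entryBracket r c α' β' a b) :
    matrixBracket hr hc h α β = matrixBracket hr hc h α' β' := by
  have : entryBracket r c α β = entryBracket r c α' β' := funext fun a => funext fun b => he a b
  simp only [matrixBracket, this]

end MatrixBracket

/-! ### Concordance numbers -/

theorem planeDet_swap (u v : Plane) : planeDet v u = -planeDet u v := by
  simp only [planeDet]; ring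

theorem planeDet_self (u : Plane) : planeDet u u = 0 := by
  simp only [planeDet]; ring

theorem planeDet_smul_left (t : ℝ) (u v : Plane) : planeDet (t • u) v = t * planeDet u v := by
  simp only [planeDet, Prod.smul_fst, Prod.smul_snd, smul_eq_mul]; ring

theorem planeDet_smul_right (t : ℝ) (u v : Plane) : planeDet u (t • v) = t * planeDet u v := by
  simp only [planeDet, Prod.smul_fst, Prod.smul_snd, smul_eq_mul]; ring

theorem planeDet_add_right (u v w : Plane) : planeDet u (v + w) = planeDet u v + planeDet u w := by
  simp only [planeDet, Prod.fst_add, Prod.snd_add]; ring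

theorem planeDet_sub_left (u v w : Plane) : planeDet (u - v) w = planeDet u w - planeDet v w := by
  simp only [planeDet, Prod.fst_sub, Prod.snd_sub]; ring

theorem planeDet_neg_right (u v : Plane) : planeDet u (-v) = -planeDet u v := by
  simp only [planeDet, Prod.fst_neg, Prod.snd_neg]; ring

/-- A nonzero vector spans its orthogonal complement for the determinant form. -/
theorem exists_eq_smul_of_planeDet_eq_zero {u v : Plane} (hu : u ≠ 0) (h : planeDet u v = 0) :
    ∃ t : ℝ, v = t • u := by
  by_cases h1 : u.1 = 0
  · have h2 : u.2 ≠ 0 := fun h2 => hu (Prod.ext h1 h2)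
    refine ⟨v.2 / u.2, Prod.ext ?_ ?_⟩
    · simp only [planeDet, h1, zero_mul, zero_sub, neg_eq_zero, mul_eq_zero, h2, false_or] at h
      simp [h1, h]
    · simp [h2]
  · refine ⟨v.1 / u.1, Prod.ext ?_ ?_⟩
    · simp [h1]
    · simp only [planeDet] at h
      simp only [Prod.smul_snd, smul_eq_mul]
      field_simp
      linarith

theorem coneIndicator_eq_one_iff {d u v : Plane} (hu : planeDet u d ≠ 0) :
    coneIndicator d u v = 1 ↔
      (0 < planeDet u v ∧ 0 < planeDet u d ∧ planeDet v d < 0) ∨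
        (planeDet u v < 0 ∧ planeDet u d < 0 ∧ 0 < planeDet v d) := by
  have key : (∃ s t : ℝ, 0 < s ∧ 0 < t ∧ d = s • u + t • v) ↔
      (0 < planeDet u v ∧ 0 < planeDet u d ∧ planeDet v d < 0) ∨
        (planeDet u v < 0 ∧ planeDet u d < 0 ∧ 0 < planeDet v d) := by
    constructor
    · rintro ⟨s, t, hs, ht, rfl⟩
      simp only [planeDet_add_right, planeDet_smul_right, planeDet_self, planeDet_swap u v,
        mul_zero, zero_add, add_zero, mul_neg] at hu ⊢
      rcases lt_trichotomy (planeDet u v) 0 with hz | hz | hz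
      · right
        exact ⟨hz, mul_neg_of_pos_of_neg ht hz, by nlinarith⟩
      · simp [hz] at hu
      · left
        exact ⟨hz, mul_pos ht hz, by nlinarith⟩
    · have cramer : planeDet u v ≠ 0 →
          d = (-planeDet v d / planeDet u v) • u + (planeDet u d / planeDet u v) • v := by
        intro hz
        refine Prod.ext ?_ ?_
        · simp only [Prod.fst_add, Prod.smul_fst, smul_eq_mul]
          field_simp
          simp only [planeDet]; ring
        · simp only [Prod.snd_add, Prod.smul_snd, smul_eq_mul]
          field_simp
          simp only [planeDet]; ring
      rintro (⟨h1, h2, h3⟩ | ⟨h1, h2, h3⟩)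
      · exact ⟨_, _, div_pos (by linarith) h1, div_pos h2 h1, cramer h1.ne'⟩
      · exact ⟨_, _, div_pos_of_neg_of_neg (by linarith) h1, div_pos_of_neg_of_neg h2 h1,
          cramer h1.ne⟩
  rw [← key]
  simp only [coneIndicator]
  split_ifs with h
  · exact iff_of_true rfl h
  · exact iff_of_false (by decide) h

/-- The vector `v` is nonzero and does not point in the direction opposite to `u`. -/
def NotOpposite (u v : Plane) : Prop := ∀ t : ℝ, 0 ≤ t → v ≠ -(t • u)

theorem NotOpposite.of_planeDet_ne_zero {u v : Plane} (h : planeDet u v ≠ 0) : NotOpposite u v := by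
  rintro t - rfl
  simp [planeDet_neg_right, planeDet_smul_right, planeDet_self] at h

open Classical in
/-- The side of `u` with respect to the pair of directions `d` and `d'`: when both directions
are generic, this function of `u` jumps exactly when `u` rotates through one of them. -/
noncomputable def sideIndicator (d d' u : Plane) : ZMod 2 :=
  if 0 ≤ planeDet d d' then (if planeDet u d < 0 ∧ 0 < planeDet u d' then 1 else 0)
  else (if planeDet u d' < 0 ∧ 0 < planeDet u d then 1 else 0)

theorem zmod_two_eq_zero {x : ZMod 2} (h : x ≠ 1) : x = 0 := by
  revert h; revert x; decide

/-- Changing the direction from `d` to `d'` changes the contribution of a pair of segments by a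
coboundary, which disappears in the sum over a closed curve. -/
theorem coneIndicator_add {d d' u v : Plane} (hu : planeDet u d ≠ 0) (hu' : planeDet u d' ≠ 0)
    (hv : planeDet v d ≠ 0) (hv' : planeDet v d' ≠ 0) (huv : NotOpposite u v) :
    coneIndicator d u v + coneIndicator d' u v = sideIndicator d d' u + sideIndicator d d' v := by
  have hu0 : u ≠ 0 := by rintro rfl; simp [planeDet] at hu
  have plucker : planeDet u v * planeDet d d' =
      planeDet u d * planeDet v d' - planeDet u d' * planeDet v d := by
    simp only [planeDet]; ring
  -- The value of the indicator in terms of the signs of determinants.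
  have val : ∀ d : Plane, planeDet u d ≠ 0 → planeDet v d ≠ 0 → coneIndicator d u v =
      if (0 < planeDet u v ∧ 0 < planeDet u d ∧ planeDet v d < 0) ∨
        (planeDet u v < 0 ∧ planeDet u d < 0 ∧ 0 < planeDet v d) then 1 else 0 := by
    intro d hd _
    split_ifs with h
    · exact (coneIndicator_eq_one_iff hd).2 h
    · exact zmod_two_eq_zero fun h' => h ((coneIndicator_eq_one_iff hd).1 h')
  rw [val d hu hv, val d' hu' hv']
  simp only [sideIndicator]
  have two : (1 : ZMod 2) + 1 = 0 := by decide
  rcases lt_trichotomy (planeDet u v) 0 with hz | hz | hz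
  · have hzD : (planeDet d d' < 0 ∧ 0 < planeDet u v * planeDet d d') ∨
        (0 ≤ planeDet d d' ∧ planeDet u v * planeDet d d' ≤ 0) := by
      rcases lt_or_ge (planeDet d d') 0 with hD | hD
      · exact Or.inl ⟨hD, by nlinarith⟩
      · exact Or.inr ⟨hD, by nlinarith⟩
    rcases hzD with ⟨hD, hzD⟩ | ⟨hD, hzD⟩ <;>
    rcases lt_or_gt_of_ne hu with h1 | h1 <;> rcases lt_or_gt_of_ne hu' with h2 | h2 <;>
    rcases lt_or_gt_of_ne hv with h3 | h3 <;> rcases lt_or_gt_of_ne hv' with h4 | h4 <;>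
    first
      | (exfalso; linarith [mul_pos_of_neg_of_neg h1 h4, mul_neg_of_neg_of_pos h2 h3])
      | (exfalso; linarith [mul_pos_of_neg_of_neg h1 h4, mul_neg_of_pos_of_neg h2 h3])
      | (exfalso; linarith [mul_pos h1 h4, mul_neg_of_neg_of_pos h2 h3])
      | (exfalso; linarith [mul_pos h1 h4, mul_neg_of_pos_of_neg h2 h3])
      | (exfalso; linarith [mul_neg_of_neg_of_pos h1 h4, mul_pos_of_neg_of_neg h2 h3])
      | (exfalso; linarith [mul_neg_of_neg_of_pos h1 h4, mul_pos h2 h3])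
      | (exfalso; linarith [mul_neg_of_pos_of_neg h1 h4, mul_pos_of_neg_of_neg h2 h3])
      | (exfalso; linarith [mul_neg_of_pos_of_neg h1 h4, mul_pos h2 h3])
      | simp [hz, hD, h1, h2, h3, h4, not_lt_of_gt, two, not_le_of_gt]
  · obtain ⟨t, rfl⟩ := exists_eq_smul_of_planeDet_eq_zero hu0 hz
    have ht : 0 < t := by
      by_contra ht
      exact huv (-t) (by linarith) (by simp)
    simp [planeDet_smul_left, hz, ht, mul_pos_iff_of_pos_left, mul_neg_iff, ht.not_gt,
      CharTwo.add_self_eq_zero]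
  · have hzD : (planeDet d d' < 0 ∧ planeDet u v * planeDet d d' < 0) ∨
        (0 ≤ planeDet d d' ∧ 0 ≤ planeDet u v * planeDet d d') := by
      rcases lt_or_ge (planeDet d d') 0 with hD | hD
      · exact Or.inl ⟨hD, by nlinarith⟩
      · exact Or.inr ⟨hD, by nlinarith⟩
    rcases hzD with ⟨hD, hzD⟩ | ⟨hD, hzD⟩ <;>
    rcases lt_or_gt_of_ne hu with h1 | h1 <;> rcases lt_or_gt_of_ne hu' with h2 | h2 <;>
    rcases lt_or_gt_of_ne hv with h3 | h3 <;> rcases lt_or_gt_of_ne hv' with h4 | h4 <;>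
    first
      | (exfalso; linarith [mul_pos_of_neg_of_neg h1 h4, mul_neg_of_neg_of_pos h2 h3])
      | (exfalso; linarith [mul_pos_of_neg_of_neg h1 h4, mul_neg_of_pos_of_neg h2 h3])
      | (exfalso; linarith [mul_pos h1 h4, mul_neg_of_neg_of_pos h2 h3])
      | (exfalso; linarith [mul_pos h1 h4, mul_neg_of_pos_of_neg h2 h3])
      | (exfalso; linarith [mul_neg_of_neg_of_pos h1 h4, mul_pos_of_neg_of_neg h2 h3])
      | (exfalso; linarith [mul_neg_of_neg_of_pos h1 h4, mul_pos h2 h3])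
      | (exfalso; linarith [mul_neg_of_pos_of_neg h1 h4, mul_pos_of_neg_of_neg h2 h3])
      | (exfalso; linarith [mul_neg_of_pos_of_neg h1 h4, mul_pos h2 h3])
      | simp [hz, hD, h1, h2, h3, h4, not_lt_of_gt, two, not_le_of_gt]

/-! #### Cyclic lists of vectors -/

/-- The sum of `f a b` over all pairs `(a, b)` of consecutive elements of a list. -/
def pairSum {α M : Type*} [AddCommMonoid M] (f : α → α → M) : List α → M
  | [] => 0
  | [_] => 0
  | a :: b :: l => f a b + pairSum f (b :: l)

@[simp]
theorem pairSum_cons_cons {α M : Type*} [AddCommMonoid M] (f : α → α → M) (a b : α) (l : List α) :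
    pairSum f (a :: b :: l) = f a b + pairSum f (b :: l) := rfl

@[simp]
theorem pairSum_singleton {α M : Type*} [AddCommMonoid M] (f : α → α → M) (a : α) :
    pairSum f [a] = 0 := rfl

theorem pairSum_append_cons {α M : Type*} [AddCommMonoid M] (f : α → α → M) (l l' : List α)
    (x : α) : pairSum f (l ++ x :: l') = pairSum f (l ++ [x]) + pairSum f (x :: l') := by
  induction l with
  | nil => simp
  | cons a l ih =>
    cases l with
    | nil => simp
    | cons b l =>
      simp only [List.cons_append, pairSum_cons_cons] at ih ⊢
      rw [ih, add_assoc]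

theorem pairSum_map {α β M : Type*} [AddCommMonoid M] (f : β → β → M) (g : α → β) (l : List α) :
    pairSum f (l.map g) = pairSum (fun a b => f (g a) (g b)) l := by
  induction l with
  | nil => rfl
  | cons a l ih =>
    cases l with
    | nil => rfl
    | cons b l =>
      simp only [List.map_cons, pairSum_cons_cons] at ih ⊢
      rw [ih]

theorem sum_zipWith_rotate {α M : Type*} [AddCommMonoid M] (f : α → α → M) (a : α) (l : List α) :
    (List.zipWith f (a :: l) ((a :: l).rotate 1)).sum = pairSum f (a :: l ++ [a]) := by
  have key : ∀ (l : List α) (a b : α),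
      (List.zipWith f (a :: l) (l ++ [b])).sum = pairSum f (a :: l ++ [b]) := by
    intro l
    induction l with
    | nil => intro a b; simp
    | cons c l ih =>
      intro a b
      simp only [List.cons_append, List.zipWith_cons_cons, List.sum_cons, pairSum_cons_cons]
      rw [ih c b, List.cons_append]
  rw [List.rotate_cons_succ, List.rotate_zero]
  exact key l a a

/-- Along a path, the sum over consecutive elements of a difference of the values of a function
modulo `2` telescopes. -/
theorem pairSum_add_zmod_two {α : Type*} (χ : α → ZMod 2) (l : List α) (a b : α) :
    pairSum (fun x y => χ x + χ y) (a :: l ++ [b]) = χ a + χ b := by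
  induction l generalizing a with
  | nil => simp
  | cons c l ih =>
    rw [List.cons_append, List.cons_append, pairSum_cons_cons, ← List.cons_append, ih]
    linear_combination CharTwo.add_self_eq_zero (χ c)

theorem pairSum_congr {α M : Type*} [AddCommMonoid M] {f g : α → α → M} {R : α → α → Prop}
    {l : List α} (hl : l.IsChain R) (h : ∀ a b, R a b → f a b = g a b) :
    pairSum f l = pairSum g l := by
  induction l with
  | nil => rfl
  | cons a l ih =>
    cases l with
    | nil => rfl
    | cons b l =>
      rw [List.isChain_cons_cons] at hl
      simp only [pairSum_cons_cons]
      rw [h a b hl.1, ih hl.2]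

theorem pairSum_add {α M : Type*} [AddCommMonoid M] (f g : α → α → M) (l : List α) :
    pairSum (fun a b => f a b + g a b) l = pairSum f l + pairSum g l := by
  induction l with
  | nil => simp [pairSum]
  | cons a l ih =>
    cases l with
    | nil => simp
    | cons b l =>
      simp only [pairSum_cons_cons] at ih ⊢
      rw [ih]
      exact add_add_add_comm _ _ _ _

/-- The concordance number of a closed curve does not depend on the direction. -/
theorem pairSum_coneIndicator_eq {d d' : Plane} {u : Plane} {l : List Plane}
    (hd : ∀ v ∈ u :: l, planeDet v d ≠ 0) (hd' : ∀ v ∈ u :: l, planeDet v d' ≠ 0)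
    (hl : (u :: l ++ [u]).IsChain NotOpposite) :
    pairSum (coneIndicator d) (u :: l ++ [u]) = pairSum (coneIndicator d') (u :: l ++ [u]) := by
  have hall : ∀ v ∈ u :: l ++ [u], planeDet v d ≠ 0 ∧ planeDet v d' ≠ 0 := by
    intro v hv
    have : v ∈ u :: l := by
      rcases List.mem_append.1 hv with h | h
      · exact h
      · exact List.mem_singleton.1 h ▸ List.mem_cons_self
    exact ⟨hd v this, hd' v this⟩
  have hchain : (u :: l ++ [u]).IsChain (fun v w => NotOpposite v w ∧
      (planeDet v d ≠ 0 ∧ planeDet v d' ≠ 0) ∧ (planeDet w d ≠ 0 ∧ planeDet w d' ≠ 0)) := by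
    refine List.IsChain.imp_of_mem_imp ?_ hl
    intro v w hv hw hvw
    exact ⟨hvw, hall v hv, hall w hw⟩
  have h1 := pairSum_congr (f := fun a b => coneIndicator d a b + coneIndicator d' a b)
    (g := fun a b => sideIndicator d d' a + sideIndicator d d' b) hchain
    (fun a b h => coneIndicator_add h.2.1.1 h.2.1.2 h.2.2.1 h.2.2.2 h.1)
  rw [pairSum_add, pairSum_add_zmod_two, CharTwo.add_self_eq_zero] at h1
  exact CharTwo.add_eq_zero.1 h1

theorem concordanceNumber_eq {C : List Plane} {d u : Plane} {l : List Plane}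
    (hC : segmentVectors C = u :: l) (hd : ∀ v ∈ u :: l, planeDet v d ≠ 0)
    (hl : (u :: l ++ [u]).IsChain NotOpposite) :
    concordanceNumber C = pairSum (coneIndicator d) (u :: l ++ [u]) := by
  have hex : ∃ d, IsGenericDirection d C := ⟨d, by rw [IsGenericDirection, hC]; exact hd⟩
  have hspec := hex.choose_spec
  rw [IsGenericDirection, hC] at hspec
  rw [concordanceNumber, dif_pos hex, concordanceAlong, hC, sum_zipWith_rotate]
  exact pairSum_coneIndicator_eq hspec hd hl

/-! ### Convex polygons -/

namespace PolygonalDisk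

variable {n : ℕ} (D : PolygonalDisk n)

theorem numCorners_pos : 0 < D.numCorners := lt_of_lt_of_le (by norm_num) D.three_le_numCorners

theorem val_finRotate {M : ℕ} (a : Fin M) :
    (finRotate M a : ℕ) = if (a : ℕ) + 1 < M then (a : ℕ) + 1 else 0 := by
  cases M with
  | zero => exact a.elim0
  | succ M =>
    split_ifs with h
    · exact coe_finRotate_of_ne_last (fun h' => by simp [h'] at h)
    · have : a = Fin.last M := Fin.ext (by simp only [Fin.val_last]; omega)
      rw [this, finRotate_last]; rfl

/-- The vector of the side of the polygon that starts at a corner, counterclockwise. -/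
def side (a : Fin D.numCorners) : Plane := D.corner (finRotate _ a) - D.corner a

theorem planeDet_side_pos {a b : Fin D.numCorners} (h : b ≠ a) (h' : b ≠ finRotate _ a) :
    0 < planeDet (D.side a) (D.corner b - D.corner a) := by
  have hv := val_finRotate a
  have hne : (b : ℕ) ≠ a := fun hh => h (Fin.ext hh)
  have hne' : (b : ℕ) ≠ (finRotate _ a : Fin _) := fun hh => h' (Fin.ext hh)
  have hb := b.isLt
  have ha := a.isLt
  split_ifs at hv with hlt
  · rcases lt_or_gt_of_ne hne with hba | hba
    · have := D.corner_convex b a (finRotate _ a) (Fin.lt_def.2 hba) (Fin.lt_def.2 (by omega))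
      simp only [side, planeDet, Prod.fst_sub, Prod.snd_sub] at this ⊢
      linarith
    · have := D.corner_convex a (finRotate _ a) b (Fin.lt_def.2 (by omega)) (Fin.lt_def.2 (by omega))
      exact this
  · have := D.corner_convex (finRotate _ a) b a (Fin.lt_def.2 (by omega)) (Fin.lt_def.2 (by omega))
    simp only [side, planeDet, Prod.fst_sub, Prod.snd_sub] at this ⊢
    linarith

theorem planeDet_side_nonneg (a b : Fin D.numCorners) :
    0 ≤ planeDet (D.side a) (D.corner b - D.corner a) := by
  by_cases h : b = a
  · simp [h, planeDet]
  · by_cases h' : b = finRotate _ a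
    · rw [h', ← side, planeDet_self]
    · exact (D.planeDet_side_pos h h').le

theorem finRotate_ne (a : Fin D.numCorners) : finRotate _ a ≠ a := by
  intro h
  have h1 := congrArg Fin.val h
  rw [val_finRotate] at h1
  have := D.three_le_numCorners
  split_ifs at h1 <;> omega

theorem finRotate_finRotate_ne (a : Fin D.numCorners) : finRotate _ (finRotate _ a) ≠ a := by
  intro h
  have h1 := congrArg Fin.val h
  rw [val_finRotate, val_finRotate] at h1
  have := D.three_le_numCorners
  have := a.isLt
  split_ifs at h1 <;> omega

theorem planeDet_side_side (a : Fin D.numCorners) :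
    0 < planeDet (D.side a) (D.side (finRotate _ a)) := by
  have := D.planeDet_side_pos (D.finRotate_finRotate_ne a) (D.finRotate_ne _)
  simp only [side, planeDet, Prod.fst_sub, Prod.snd_sub] at this ⊢
  linarith

theorem side_ne_zero (a : Fin D.numCorners) : D.side a ≠ 0 := by
  intro h
  have := D.planeDet_side_side a
  simp [h, planeDet] at this

theorem corner_injective : Function.Injective D.corner := by
  intro a b h
  by_contra hab
  by_cases h' : b = finRotate _ a
  · exact D.side_ne_zero a (by rw [side, ← h', h, sub_self])
  · have := D.planeDet_side_pos (Ne.symm hab) h'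
    simp [h, planeDet] at this

/-- A corner at which a linear function has a local maximum is its only global maximum. -/
theorem planeDet_corner_lt {d : Plane} {a b : Fin D.numCorners} (h1 : 0 < planeDet (D.side a) d)
    (h2 : planeDet (D.side (finRotate _ a)) d < 0) (hb : b ≠ finRotate _ a) :
    planeDet (D.corner b) d < planeDet (D.corner (finRotate _ a)) d := by
  by_cases hba : b = a
  · rw [side, planeDet_sub_left] at h1
    rw [hba]
    linarith
  · have h3 := D.planeDet_side_pos hba hb
    have h4 := D.planeDet_side_nonneg (finRotate _ a) b
    have h5 := D.planeDet_side_side a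
    have h3' : 0 < planeDet (D.side a) (D.corner b - D.corner (finRotate _ a)) := by
      have : planeDet (D.side a) (D.corner b - D.corner (finRotate _ a)) =
          planeDet (D.side a) (D.corner b - D.corner a) := by
        simp only [side, planeDet, Prod.fst_sub, Prod.snd_sub]; ring
      rwa [this]
    have key : planeDet (D.side a) (D.side (finRotate _ a)) *
        planeDet (D.corner b - D.corner (finRotate _ a)) d =
        planeDet (D.side a) (D.corner b - D.corner (finRotate _ a)) *
          planeDet (D.side (finRotate _ a)) d -
        planeDet (D.side (finRotate _ a)) (D.corner b - D.corner (finRotate _ a)) *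
          planeDet (D.side a) d := by
      simp only [planeDet]; ring
    have : planeDet (D.side a) (D.side (finRotate _ a)) *
        planeDet (D.corner b - D.corner (finRotate _ a)) d < 0 := by
      rw [key]
      nlinarith [mul_neg_of_pos_of_neg h3' h2, mul_nonneg h4 h1.le]
    have := neg_of_mul_neg_right this h5.le
    rw [planeDet_sub_left] at this
    linarith

/-- The tangent direction of a convex polygon makes one full turn. -/
theorem sum_coneIndicator_side {d : Plane} (hd : ∀ a, planeDet (D.side a) d ≠ 0) :
    ∑ a, coneIndicator d (D.side a) (D.side (finRotate _ a)) = 1 := by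
  have iff1 : ∀ a, coneIndicator d (D.side a) (D.side (finRotate _ a)) = 1 ↔
      0 < planeDet (D.side a) d ∧ planeDet (D.side (finRotate _ a)) d < 0 := by
    intro a
    rw [coneIndicator_eq_one_iff (hd a)]
    have := D.planeDet_side_side a
    constructor
    · rintro (h | h)
      · exact h.2
      · linarith [h.1]
    · exact fun h => Or.inl ⟨this, h⟩
  have : Nonempty (Fin D.numCorners) := ⟨⟨0, D.numCorners_pos⟩⟩
  obtain ⟨b, hb⟩ := Finite.exists_max (fun a => planeDet (D.corner a) d)
  obtain ⟨a, rfl⟩ := (finRotate _).surjective b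
  have ha : 0 < planeDet (D.side a) d ∧ planeDet (D.side (finRotate _ a)) d < 0 := by
    constructor
    · refine lt_of_le_of_ne ?_ (hd a).symm
      rw [side, planeDet_sub_left]
      linarith [hb a]
    · refine lt_of_le_of_ne ?_ (hd _)
      rw [side, planeDet_sub_left]
      linarith [hb (finRotate _ (finRotate _ a))]
  rw [Finset.sum_eq_single a]
  · exact (iff1 a).2 ha
  · intro c _ hc
    refine zmod_two_eq_zero fun h => ?_
    rw [iff1] at h
    have hne : finRotate _ c ≠ finRotate _ a := fun hh => hc ((finRotate _).injective hh)
    exact lt_asymm (D.planeDet_corner_lt h.1 h.2 hne.symm) (D.planeDet_corner_lt ha.1 ha.2 hne)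
  · simp

/-- The corner reached after `t` counterclockwise steps from the corner `0`. -/
def cyclicIdx (t : ℕ) : Fin D.numCorners := ⟨t % D.numCorners, Nat.mod_lt _ D.numCorners_pos⟩

theorem cyclicIdx_val (a : Fin D.numCorners) : D.cyclicIdx a = a :=
  Fin.ext (Nat.mod_eq_of_lt a.isLt)

theorem cyclicIdx_add_numCorners (t : ℕ) : D.cyclicIdx (t + D.numCorners) = D.cyclicIdx t :=
  Fin.ext (Nat.add_mod_right _ _)

theorem finRotate_cyclicIdx (t : ℕ) : finRotate _ (D.cyclicIdx t) = D.cyclicIdx (t + 1) := by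
  apply Fin.ext
  have h0 := val_finRotate (D.cyclicIdx t)
  have h1 := D.three_le_numCorners
  have h2 := Nat.mod_lt t D.numCorners_pos
  change _ = (t + 1) % D.numCorners
  change _ = if t % D.numCorners + 1 < D.numCorners then t % D.numCorners + 1 else 0 at h0
  rw [h0, Nat.add_mod, Nat.mod_eq_of_lt (show 1 < D.numCorners by omega)]
  by_cases h : t % D.numCorners + 1 < D.numCorners
  · rw [if_pos h, Nat.mod_eq_of_lt h]
  · rw [if_neg h, show t % D.numCorners + 1 = D.numCorners by omega, Nat.mod_self]

/-- The number of times, modulo `2`, that the tangent direction passes the direction `d` while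
the first `t` sides after the first one are traversed. -/
noncomputable def turns (d : Plane) (t : ℕ) : ZMod 2 :=
  ∑ s ∈ Finset.range t, coneIndicator d (D.side (D.cyclicIdx s)) (D.side (D.cyclicIdx (s + 1)))

theorem turns_add_numCorners {d : Plane} (hd : ∀ a, planeDet (D.side a) d ≠ 0) (t : ℕ) :
    D.turns d (D.numCorners + t) = D.turns d t + 1 := by
  rw [turns, Finset.sum_range_add, add_comm]
  congr 1
  · refine Finset.sum_congr rfl fun s _ => ?_
    rw [add_comm D.numCorners s, cyclicIdx_add_numCorners, add_right_comm,
      cyclicIdx_add_numCorners]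
  · rw [Finset.sum_range, ← D.sum_coneIndicator_side hd]
    refine Finset.sum_congr rfl fun a _ => ?_
    rw [← finRotate_cyclicIdx, cyclicIdx_val]

/-- The number of steps from the corner `a` to the corner `b`, going counterclockwise. -/
def stepCount (a b : Fin D.numCorners) : ℕ := if a < b then b - a else D.numCorners + b - a

theorem cyclicIdx_add_stepCount {a b : Fin D.numCorners} (hab : a ≠ b) :
    D.cyclicIdx (a + D.stepCount a b) = b := by
  have hval : (a : ℕ) ≠ b := fun h => hab (Fin.ext h)
  have ha := a.isLt
  have hb := b.isLt
  apply Fin.ext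
  simp only [cyclicIdx, stepCount, Fin.lt_def]
  split_ifs
  · rw [show (a : ℕ) + (b - a) = b by omega, Nat.mod_eq_of_lt hb]
  · rw [show (a : ℕ) + (D.numCorners + b - a) = b + D.numCorners by omega, Nat.add_mod_right,
      Nat.mod_eq_of_lt hb]

theorem stepCount_pos {a b : Fin D.numCorners} : 0 < D.stepCount a b := by
  have ha := a.isLt
  rw [stepCount]
  simp only [Fin.lt_def]
  split_ifs <;> omega

theorem turns_add_stepCount {d : Plane} (hd : ∀ a, planeDet (D.side a) d ≠ 0)
    {a b : Fin D.numCorners} (hab : a ≠ b) :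
    D.turns d (a + D.stepCount a b) = D.turns d b + if b < a then 1 else 0 := by
  have hval : (a : ℕ) ≠ b := fun h => hab (Fin.ext h)
  have ha := a.isLt
  simp only [stepCount, Fin.lt_def]
  by_cases h : (a : ℕ) < b
  · rw [if_pos h, if_neg (by omega), add_zero, show (a : ℕ) + (b - a) = b by omega]
  · rw [if_neg h, if_pos (by omega), show (a : ℕ) + (D.numCorners + b - a) = D.numCorners + b by omega,
      D.turns_add_numCorners hd]

theorem takeWhile_finRange_rotate {a b : Fin D.numCorners} (hab : a ≠ b) :
    ((List.finRange D.numCorners).rotate a).takeWhile (fun c => decide (c ≠ b)) =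
      (List.range (D.stepCount a b)).map (fun t => D.cyclicIdx (a + t)) := by
  have h1 : (List.finRange D.numCorners).rotate a =
      (List.range D.numCorners).map (fun t => D.cyclicIdx (a + t)) := by
    refine List.ext_getElem (by simp) fun t h _ => ?_
    simp only [List.getElem_rotate, List.getElem_finRange, List.getElem_map, List.getElem_range]
    apply Fin.ext
    simp [cyclicIdx, add_comm]
  have hval : (a : ℕ) ≠ b := fun h => hab (Fin.ext h)
  have ha := a.isLt
  have hb := b.isLt
  have hle : D.stepCount a b < D.numCorners := by
    rw [stepCount]
    simp only [Fin.lt_def]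
    split_ifs <;> omega
  obtain ⟨l, hl⟩ : ∃ l, List.range D.numCorners =
      List.range (D.stepCount a b) ++ D.stepCount a b :: l := by
    obtain ⟨q, hq⟩ := Nat.exists_eq_add_of_lt hle
    refine ⟨(List.range q).map (fun t => D.stepCount a b + 1 + t), ?_⟩
    rw [hq, show D.stepCount a b + q + 1 = D.stepCount a b + (q + 1) by ring, List.range_add,
      List.range_succ_eq_map]
    simp only [List.map_cons, List.map_map, Function.comp_def, add_zero]
    simp only [Nat.succ_eq_add_one, add_assoc, add_comm]
  have hend := D.cyclicIdx_add_stepCount hab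
  rw [h1, hl, List.map_append, List.map_cons, List.takeWhile_append_of_pos]
  · rw [List.takeWhile_cons_of_neg (by simp [hend]), List.append_nil]
  · intro c hc
    obtain ⟨t, ht, rfl⟩ := List.mem_map.1 hc
    rw [List.mem_range] at ht
    simp only [ne_eq, decide_not, Bool.not_eq_eq_eq_not, Bool.not_true, decide_eq_false_iff_not]
    intro h
    have h2 := congrArg Fin.val h
    simp only [cyclicIdx] at h2
    simp only [stepCount, Fin.lt_def] at ht
    split_ifs at ht with hlt
    · rw [Nat.mod_eq_of_lt (by omega)] at h2
      omega
    · by_cases h3 : (a : ℕ) + t < D.numCorners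
      · rw [Nat.mod_eq_of_lt h3] at h2
        omega
      · rw [Nat.mod_eq_sub_mod (by omega), Nat.mod_eq_of_lt (by omega)] at h2
        omega

end PolygonalDisk

/-! ### Signs of paths -/

namespace PerfectNetwork

variable {n : ℕ} {I : Finset (Fin n)} (N : PerfectNetwork n I)

theorem src_injective : Function.Injective N.src := fun e e' h =>
  Sum.inl_injective (N.flags_bijective.1 (show Sum.elim N.src N.tgt (Sum.inl e) =
    Sum.elim N.src N.tgt (Sum.inl e') from h))

theorem tgt_injective : Function.Injective N.tgt := fun e e' h =>
  Sum.inr_injective (N.flags_bijective.1 (show Sum.elim N.src N.tgt (Sum.inr e) =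
    Sum.elim N.src N.tgt (Sum.inr e') from h))

theorem src_ne_tgt (e e' : N.E) : N.src e ≠ N.tgt e' := fun h =>
  Sum.inl_ne_inr (N.flags_bijective.1 (show Sum.elim N.src N.tgt (Sum.inl e) =
    Sum.elim N.src N.tgt (Sum.inr e') from h))

theorem vertex_eq_inl {f : NetFlag n N.W} {i : Fin n} : f.vertex = Sum.inl i ↔ f = Sum.inl i := by
  rcases f with j | ⟨v, a⟩ <;> simp [NetFlag.vertex]

/-- The vector of an edge. -/
def edgeVec (e : N.E) : Plane := N.pos (N.tgt e).vertex - N.pos (N.src e).vertex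

theorem openSegment_subset_interior (e : N.E) :
    openSegment ℝ (N.pos (N.src e).vertex) (N.pos (N.tgt e).vertex) ⊆ N.disk.interior :=
  N.edge_subset e

theorem src_vertex_ne_tgt_vertex (e : N.E) : (N.src e).vertex ≠ (N.tgt e).vertex := by
  intro h
  have h1 := N.vertex_notMem_edge e (N.src e).vertex
  rw [← h, openSegment_same] at h1
  exact h1 rfl

theorem corner_notMem_interior (a : Fin N.disk.numCorners) : N.disk.corner a ∉ N.disk.interior := by
  intro h
  have := h a
  simp [planeDet] at this

theorem pos_injective : Function.Injective N.pos := by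
  rintro (i | v) (j | w) h
  · exact congrArg _ (N.disk.cornerIdx_strictMono.injective (N.disk.corner_injective h))
  · have h' : N.disk.corner (N.disk.cornerIdx i) = N.innerPos w := h
    exact absurd (h' ▸ N.innerPos_mem w) (N.corner_notMem_interior _)
  · have h' : N.innerPos v = N.disk.corner (N.disk.cornerIdx j) := h
    exact absurd (h' ▸ N.innerPos_mem v) (N.corner_notMem_interior _)
  · exact congrArg _ (N.innerPos_injective h)

theorem edgeVec_ne_zero (e : N.E) : N.edgeVec e ≠ 0 := fun h =>
  N.src_vertex_ne_tgt_vertex e (N.pos_injective (sub_eq_zero.1 h).symm)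

theorem src_add_smul_edgeVec_mem (e : N.E) {t : ℝ} (h0 : 0 < t) (h1 : t < 1) :
    N.pos (N.src e).vertex + t • N.edgeVec e ∈
      openSegment ℝ (N.pos (N.src e).vertex) (N.pos (N.tgt e).vertex) :=
  ⟨1 - t, t, by linarith, h0, by ring, by rw [edgeVec]; module⟩

/-- An edge path never turns back: the next edge is not directed along the previous one. -/
theorem notOpposite_edgeVec {e e' : N.E} (h : (N.tgt e).vertex = (N.src e').vertex) :
    NotOpposite (N.edgeVec e) (N.edgeVec e') := by
  intro t ht h'
  have hne : e ≠ e' := by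
    rintro rfl
    exact N.src_vertex_ne_tgt_vertex e h.symm
  -- Otherwise the two edges overlap near their common vertex.
  have ht0 : t ≠ 0 := by
    rintro rfl
    exact N.edgeVec_ne_zero e' (by simpa using h')
  have htpos : 0 < t := lt_of_le_of_ne ht (Ne.symm ht0)
  set s : ℝ := 1 / (2 * (1 + t)) with hs
  have hs0 : 0 < s := by positivity
  have hs1 : s * (1 + t) = 1 / 2 := by rw [hs]; field_simp
  have hst : s * t < 1 := by nlinarith
  have m1 := N.src_add_smul_edgeVec_mem e' hs0 (by nlinarith)
  have m2 := N.src_add_smul_edgeVec_mem e (t := 1 - s * t) (by linarith) (by nlinarith)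
  have heq : N.pos (N.src e).vertex + (1 - s * t) • N.edgeVec e =
      N.pos (N.src e').vertex + s • N.edgeVec e' := by
    rw [h', ← h, edgeVec]
    module
  rw [heq] at m2
  exact Set.disjoint_left.1 (N.edge_disjoint e e' hne) m2 m1

theorem planeDet_side_edgeVec_tgt {e : N.E} {j : Fin n} (he : N.tgt e = Sum.inl j)
    (a : Fin N.disk.numCorners) (ha : planeDet (N.disk.side a)
      (N.disk.corner (N.disk.cornerIdx j) - N.disk.corner a) = 0) :
    planeDet (N.disk.side a) (N.edgeVec e) < 0 := by
  have h1 := N.openSegment_subset_interior e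
    (N.src_add_smul_edgeVec_mem e (t := 1 / 2) (by norm_num) (by norm_num)) a
  have hp : N.pos (N.tgt e).vertex = N.disk.corner (N.disk.cornerIdx j) := by rw [he]; rfl
  have h2 : N.pos (N.src e).vertex + (1 / 2 : ℝ) • N.edgeVec e - N.disk.corner a =
      (N.disk.corner (N.disk.cornerIdx j) - N.disk.corner a) + (-1 / 2 : ℝ) • N.edgeVec e := by
    rw [← hp, edgeVec]
    module
  rw [h2, planeDet_add_right, planeDet_smul_right] at h1
  change 0 < planeDet (N.disk.side a) _ + _ * planeDet (N.disk.side a) _ at h1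
  rw [ha] at h1
  linarith

theorem planeDet_side_edgeVec_src {e : N.E} {i : Fin n} (he : N.src e = Sum.inl i)
    (a : Fin N.disk.numCorners) (ha : planeDet (N.disk.side a)
      (N.disk.corner (N.disk.cornerIdx i) - N.disk.corner a) = 0) :
    0 < planeDet (N.disk.side a) (N.edgeVec e) := by
  have h1 := N.openSegment_subset_interior e
    (N.src_add_smul_edgeVec_mem e (t := 1 / 2) (by norm_num) (by norm_num)) a
  have hp : N.pos (N.src e).vertex = N.disk.corner (N.disk.cornerIdx i) := by rw [he]; rfl
  rw [hp, add_sub_right_comm, planeDet_add_right, planeDet_smul_right] at h1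
  change 0 < planeDet (N.disk.side a) _ + _ * planeDet (N.disk.side a) _ at h1
  rw [ha] at h1
  linarith

theorem exists_generic_direction : ∃ d : Plane, (∀ e, planeDet (N.edgeVec e) d ≠ 0) ∧
    ∀ a, planeDet (N.disk.side a) d ≠ 0 := by
  -- The slopes of the edges and of the sides are finite in number.
  let u : N.E ⊕ Fin N.disk.numCorners → Plane := Sum.elim N.edgeVec N.disk.side
  have hu : ∀ x, u x ≠ 0 := by
    rintro (e | a)
    · exact N.edgeVec_ne_zero e
    · exact N.disk.side_ne_zero a
  obtain ⟨t, ht⟩ := Infinite.exists_notMem_finset (Finset.univ.image fun x => (u x).2 / (u x).1)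
  have hgen : ∀ x, planeDet (u x) (1, t) ≠ 0 := by
    intro x h
    simp only [planeDet, mul_one] at h
    by_cases h1 : (u x).1 = 0
    · exact hu x (Prod.ext h1 (by simpa [h1] using h))
    · refine ht (Finset.mem_image.2 ⟨x, Finset.mem_univ _, ?_⟩)
      field_simp
      linarith
  exact ⟨(1, t), fun e => hgen (Sum.inl e), fun a => hgen (Sum.inr a)⟩

end PerfectNetwork

/-- The vectors between consecutive points of a list. -/
def stepVectors : List Plane → List Plane
  | [] => []
  | [_] => []
  | a :: b :: l => (b - a) :: stepVectors (b :: l)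

theorem segmentVectors_cons (a : Plane) (l : List Plane) :
    segmentVectors (a :: l) = stepVectors (a :: l ++ [a]) := by
  have key : ∀ (l : List Plane) (a b : Plane),
      List.zipWith (fun a b => b - a) (a :: l) (l ++ [b]) = stepVectors (a :: l ++ [b]) := by
    intro l
    induction l with
    | nil => intro a b; rfl
    | cons c l ih =>
      intro a b
      simp only [List.cons_append, List.zipWith_cons_cons, stepVectors]
      rw [ih c b, List.cons_append]
  rw [segmentVectors, List.rotate_cons_succ, List.rotate_zero]
  exact key l a a

theorem stepVectors_map_range (g : ℕ → Plane) (t : ℕ) :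
    stepVectors ((List.range (t + 1)).map g) =
      (List.range t).map (fun s => g (s + 1) - g s) := by
  induction t generalizing g with
  | zero => rfl
  | succ t ih =>
    have h := ih (fun s => g (s + 1))
    rw [List.range_succ_eq_map, List.map_cons, List.map_map] at h ⊢
    rw [List.range_succ_eq_map (n := t), List.map_cons, List.map_map] at ⊢
    simp only [List.map_cons, stepVectors, Function.comp_def, List.map_map] at h ⊢
    rw [h]

theorem pairSum_map_range {M : Type*} [AddCommMonoid M] (f : Plane → Plane → M) (g : ℕ → Plane)
    (t : ℕ) : pairSum f ((List.range (t + 1)).map g) =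
      ∑ s ∈ Finset.range t, f (g s) (g (s + 1)) := by
  induction t with
  | zero => rfl
  | succ t ih =>
    rw [List.range_succ, List.map_append, List.range_succ, List.map_append, List.append_assoc]
    simp only [List.map_cons, List.map_nil, List.cons_append, List.nil_append]
    rw [pairSum_append_cons, Finset.sum_range_succ, ← ih, List.range_succ, List.map_append]
    simp

theorem isChain_map_range {R : Plane → Plane → Prop} (g : ℕ → Plane) (t : ℕ)
    (h : ∀ s, R (g s) (g (s + 1))) : ((List.range t).map g).IsChain R := by
  rw [List.isChain_map]
  exact (List.isChain_range _ _).2 (fun s _ => h s)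

namespace PerfectNetwork

variable {n : ℕ} {I : Finset (Fin n)} (N : PerfectNetwork n I)

theorem stepVectors_path {P : List N.E} {x : Fin n ⊕ N.W} (K : List Plane)
    (hP : P.IsChain (fun e e' => (N.tgt e).vertex = (N.src e').vertex))
    (hx : P.getLast?.map (fun e => (N.tgt e).vertex) = some x) :
    stepVectors (P.map (fun e => N.pos (N.src e).vertex) ++ N.pos x :: K) =
      P.map N.edgeVec ++ stepVectors (N.pos x :: K) := by
  induction P with
  | nil => simp at hx
  | cons e P ih =>
    cases P with
    | nil =>
      simp only [List.getLast?_singleton, Option.map_some, Option.some.injEq] at hx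
      subst hx
      rfl
    | cons e' P =>
      rw [List.isChain_cons_cons] at hP
      have := ih hP.2 (by simpa using hx)
      simp only [List.map_cons, List.cons_append, stepVectors] at this ⊢
      rw [this, ← hP.1]
      rfl

/-- The side of the polygon that ends at the corner of a boundary vertex. -/
def prevSide (i : Fin n) : Plane := N.disk.side ((finRotate _).symm (N.disk.cornerIdx i))

/-- The side of the polygon that starts at the corner of a boundary vertex. -/
def nextSide (i : Fin n) : Plane := N.disk.side (N.disk.cornerIdx i)

/-- The segments of the closed curve of a path. -/
theorem segmentVectors_closedCurve {i j : Fin n} (hij : i ≠ j) {P : List N.E} (hP : N.IsPath i j P) :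
    segmentVectors (N.closedCurve i j P) = P.map N.edgeVec ++
      (List.range (N.disk.stepCount (N.disk.cornerIdx j) (N.disk.cornerIdx i))).map
        (fun t => N.disk.side (N.disk.cyclicIdx (N.disk.cornerIdx j + t))) := by
  obtain ⟨hc, hh, hl⟩ := hP
  have hne : N.disk.cornerIdx j ≠ N.disk.cornerIdx i := fun h =>
    hij (N.disk.cornerIdx_strictMono.injective h).symm
  set J := N.disk.cornerIdx j
  set I' := N.disk.cornerIdx i
  set g : ℕ → Plane := fun t => N.disk.corner (N.disk.cyclicIdx (J + t)) with hg
  have hclosing : N.closingCorners i j ++ [N.disk.corner I'] =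
      (List.range (N.disk.stepCount J I' + 1)).map g := by
    rw [closingCorners, N.disk.takeWhile_finRange_rotate hne, List.range_succ, List.map_append,
      List.map_map]
    simp [hg, N.disk.cyclicIdx_add_stepCount hne, Function.comp_def]
  obtain ⟨K, hK⟩ : ∃ K, (List.range (N.disk.stepCount J I' + 1)).map g = N.pos (Sum.inl j) :: K := by
    have h0 : g 0 = N.pos (Sum.inl j) := by
      simp only [hg, add_zero, N.disk.cyclicIdx_val]
      rfl
    rw [List.range_succ_eq_map, List.map_cons, h0]
    exact ⟨_, rfl⟩
  have hcurve : segmentVectors (N.closedCurve i j P) =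
      stepVectors (N.closedCurve i j P ++ [N.disk.corner I']) := by
    cases P with
    | nil => simp at hh
    | cons e P =>
      have he : N.pos (N.src e).vertex = N.disk.corner I' := by
        simp only [List.head?_cons, Option.map_some, Option.some.injEq] at hh
        rw [hh]; rfl
      rw [closedCurve, List.map_cons, List.cons_append, segmentVectors_cons, he]
  rw [hcurve, closedCurve, List.append_assoc, hclosing, hK, N.stepVectors_path K hc hl, ← hK,
    stepVectors_map_range]
  congr 1
  refine List.map_congr_left fun t _ => ?_
  simp only [hg, PolygonalDisk.side, N.disk.finRotate_cyclicIdx, add_assoc]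

theorem notOpposite_edgeVec_nextSide {e : N.E} {j : Fin n} (he : N.tgt e = Sum.inl j) :
    NotOpposite (N.edgeVec e) (N.nextSide j) := by
  apply NotOpposite.of_planeDet_ne_zero
  have := N.planeDet_side_edgeVec_tgt he (N.disk.cornerIdx j) (by simp [planeDet])
  rw [planeDet_swap]
  exact (neg_pos.2 this).ne'

theorem notOpposite_prevSide_edgeVec {e : N.E} {i : Fin n} (he : N.src e = Sum.inl i) :
    NotOpposite (N.prevSide i) (N.edgeVec e) := by
  apply NotOpposite.of_planeDet_ne_zero
  refine (N.planeDet_side_edgeVec_src he _ ?_).ne'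
  conv_lhs => rw [PolygonalDisk.side, Equiv.apply_symm_apply]
  exact planeDet_self _

/-- The contribution of the corner `b_i` to the concordance numbers of the paths that
start at `b_i`. -/
noncomputable def sourceTerm (d : Plane) (i : Fin n) : ZMod 2 :=
  open Classical in
  N.disk.turns d (N.disk.cornerIdx i) + coneIndicator d (N.prevSide i) (N.nextSide i) +
    if h : ∃ e, N.src e = Sum.inl i then coneIndicator d (N.prevSide i) (N.edgeVec h.choose) else 0

/-- The contribution of the corner `b_j` to the concordance numbers of the paths that
end at `b_j`. -/
noncomputable def sinkTerm (d : Plane) (j : Fin n) : ZMod 2 :=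
  open Classical in
  N.disk.turns d (N.disk.cornerIdx j) +
    if h : ∃ e, N.tgt e = Sum.inl j then coneIndicator d (N.edgeVec h.choose) (N.nextSide j) else 0

/-- The concordance number of a path is a sum of contributions of pairs of consecutive edges and
of a term that depends only on the endpoints. -/
theorem concordanceNumber_closedCurve {d : Plane} (hd : ∀ e, planeDet (N.edgeVec e) d ≠ 0)
    (hd' : ∀ a, planeDet (N.disk.side a) d ≠ 0) {i j : Fin n} (hij : i ≠ j) {P : List N.E}
    (hP : N.IsPath i j P) : concordanceNumber (N.closedCurve i j P) =
      pairSum (fun e e' => coneIndicator d (N.edgeVec e) (N.edgeVec e')) P +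
        (N.sourceTerm d i + N.sinkTerm d j + if i < j then 1 else 0) := by
  have hseg := N.segmentVectors_closedCurve hij hP
  obtain ⟨hc, hh, hl⟩ := hP
  have hne : N.disk.cornerIdx j ≠ N.disk.cornerIdx i := fun h =>
    hij (N.disk.cornerIdx_strictMono.injective h).symm
  have hlt : N.disk.cornerIdx i < N.disk.cornerIdx j ↔ i < j := N.disk.cornerIdx_strictMono.lt_iff_lt
  have hturn := N.disk.turns_add_stepCount hd' hne
  have hend := N.disk.cyclicIdx_add_stepCount hne
  obtain ⟨t, ht⟩ : ∃ t, N.disk.stepCount (N.disk.cornerIdx j) (N.disk.cornerIdx i) = t + 1 :=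
    ⟨_, (Nat.succ_pred_eq_of_pos N.disk.stepCount_pos).symm⟩
  rw [ht] at hseg hturn hend
  rw [← add_assoc] at hturn hend
  set J : ℕ := (N.disk.cornerIdx j).val with hJ
  set s : ℕ → Plane := fun t => N.disk.side (N.disk.cyclicIdx (J + t)) with hs
  have hs0 : s 0 = N.nextSide j := by
    simp only [hs, hJ, add_zero, N.disk.cyclicIdx_val]; rfl
  have hst : s t = N.prevSide i := by
    simp only [hs, prevSide]
    rw [← hend, ← N.disk.finRotate_cyclicIdx, Equiv.symm_apply_apply]
  have hst1 : s (t + 1) = N.nextSide i := by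
    simp only [hs, nextSide, ← hend, add_assoc]
  obtain ⟨e₁, Q, rfl⟩ : ∃ e Q, P = e :: Q := by
    cases P with
    | nil => simp at hh
    | cons e Q => exact ⟨e, Q, rfl⟩
  have he₁ : N.src e₁ = Sum.inl i := by
    simpa [N.vertex_eq_inl] using hh
  obtain ⟨R, e₂, hR⟩ : ∃ R e, e₁ :: Q = R ++ [e] :=
    ⟨_, _, (List.dropLast_append_getLast (List.cons_ne_nil e₁ Q)).symm⟩
  have he₂ : N.tgt e₂ = Sum.inl j := by
    rw [hR] at hl
    simpa [N.vertex_eq_inl] using hl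
  have hsource : N.sourceTerm d i = N.disk.turns d (N.disk.cornerIdx i) +
      coneIndicator d (N.prevSide i) (N.nextSide i) +
      coneIndicator d (N.prevSide i) (N.edgeVec e₁) := by
    have hex : ∃ e, N.src e = Sum.inl i := ⟨e₁, he₁⟩
    rw [sourceTerm, dif_pos hex, N.src_injective (hex.choose_spec.trans he₁.symm)]
  have hsink : N.sinkTerm d j = N.disk.turns d J +
      coneIndicator d (N.edgeVec e₂) (N.nextSide j) := by
    have hex : ∃ e, N.tgt e = Sum.inl j := ⟨e₂, he₂⟩
    rw [sinkTerm, dif_pos hex, N.tgt_injective (hex.choose_spec.trans he₂.symm)]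
  have hrange : (List.range (t + 1)).map s = (List.range t).map s ++ [s t] := by
    rw [List.range_succ, List.map_append]; rfl
  have hrange' : ∃ S, (List.range (t + 1)).map s = s 0 :: S := by
    rw [List.range_succ_eq_map, List.map_cons]; exact ⟨_, rfl⟩
  obtain ⟨S, hS⟩ := hrange'
  -- The sum over the part of the curve on the boundary of the disk.
  have hside : pairSum (coneIndicator d) ((List.range (t + 1)).map s) =
      N.disk.turns d (J + t) + N.disk.turns d J := by
    rw [pairSum_map_range, PolygonalDisk.turns, Finset.sum_range_add, ← PolygonalDisk.turns]
    simp only [hs, add_assoc]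
    linear_combination -CharTwo.add_self_eq_zero (N.disk.turns d J)
  have hturn' : N.disk.turns d (J + t) + coneIndicator d (N.prevSide i) (N.nextSide i) =
      N.disk.turns d (N.disk.cornerIdx i) + if i < j then 1 else 0 := by
    simp only [hlt] at hturn
    rw [← hturn, PolygonalDisk.turns, PolygonalDisk.turns, Finset.sum_range_succ, ← hst, ← hst1]
    simp only [hs, add_assoc]
  have hchainE : ((e₁ :: Q).map N.edgeVec).IsChain NotOpposite := by
    rw [List.isChain_map]
    exact hc.imp fun _ _ h => N.notOpposite_edgeVec h
  have hchainS : ((List.range (t + 1)).map s).IsChain NotOpposite := by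
    refine isChain_map_range s _ fun a => NotOpposite.of_planeDet_ne_zero ?_
    simp only [hs]
    rw [← add_assoc, ← N.disk.finRotate_cyclicIdx]
    exact (N.disk.planeDet_side_side _).ne'
  have hchain : (N.edgeVec e₁ :: (Q.map N.edgeVec ++ (List.range (t + 1)).map s) ++
      [N.edgeVec e₁]).IsChain NotOpposite := by
    rw [← List.cons_append, ← List.map_cons, List.append_assoc, List.isChain_append]
    refine ⟨hchainE, ?_, ?_⟩
    · rw [List.isChain_append]
      refine ⟨hchainS, List.isChain_singleton _, ?_⟩
      rw [hrange]
      simp only [List.getLast?_append, List.getLast?_singleton, Option.some_or,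
        Option.mem_def, Option.some.injEq, List.head?_cons]
      rintro x rfl y rfl
      rw [hst]
      exact N.notOpposite_prevSide_edgeVec he₁
    · rw [hR, hS]
      simp only [List.map_append, List.map_cons, List.map_nil, List.getLast?_append,
        List.getLast?_singleton, Option.some_or, Option.mem_def, Option.some.injEq,
        List.cons_append, List.head?_cons]
      rintro x rfl y rfl
      rw [hs0]
      exact N.notOpposite_edgeVec_nextSide he₂
  have hgen : ∀ v ∈ N.edgeVec e₁ :: (Q.map N.edgeVec ++ (List.range (t + 1)).map s),
      planeDet v d ≠ 0 := by
    intro v hv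
    rw [← List.cons_append, ← List.map_cons, List.mem_append] at hv
    rcases hv with hv | hv
    · obtain ⟨e, -, rfl⟩ := List.mem_map.1 hv
      exact hd e
    · obtain ⟨a, -, rfl⟩ := List.mem_map.1 hv
      exact hd' _
  rw [concordanceNumber_eq (by rw [hseg, List.map_cons, List.cons_append]) hgen hchain,
    ← List.cons_append, ← List.map_cons, List.append_assoc]
  have e1 : pairSum (coneIndicator d) ((e₁ :: Q).map N.edgeVec ++
      ((List.range (t + 1)).map s ++ [N.edgeVec e₁])) =
      pairSum (coneIndicator d) ((e₁ :: Q).map N.edgeVec) +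
      (coneIndicator d (N.edgeVec e₂) (N.nextSide j) +
        pairSum (coneIndicator d) ((List.range (t + 1)).map s ++ [N.edgeVec e₁])) := by
    rw [hR, hS, List.map_append, ← hs0]
    simp only [List.map_cons, List.map_nil, List.append_assoc, List.cons_append, List.nil_append]
    rw [pairSum_append_cons, pairSum_cons_cons]
  have e2 : pairSum (coneIndicator d) ((List.range (t + 1)).map s ++ [N.edgeVec e₁]) =
      pairSum (coneIndicator d) ((List.range (t + 1)).map s) +
        coneIndicator d (N.prevSide i) (N.edgeVec e₁) := by
    rw [hrange, List.append_assoc, ← hst]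
    simp only [List.cons_append, List.nil_append]
    rw [pairSum_append_cons]
    simp
  rw [e1, e2, hside, hsource, hsink, pairSum_map]
  linear_combination hturn' - CharTwo.add_self_eq_zero (coneIndicator d (N.prevSide i) (N.nextSide i))

/-- The sign `(-1)^x` of a residue modulo `2`. -/
def paritySign (x : ZMod 2) : ℤ := (-1) ^ x.val

theorem paritySign_add (x y : ZMod 2) : paritySign (x + y) = paritySign x * paritySign y := by
  revert x y; decide

theorem paritySign_mul_self (x : ZMod 2) : paritySign x * paritySign x = 1 := by
  revert x; decide

/-- The sign of a pair of consecutive edges with respect to the direction `d`. -/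
noncomputable def turnSign (d : Plane) (e e' : N.E) : ℤ :=
  paritySign (coneIndicator d (N.edgeVec e) (N.edgeVec e'))

/-- The product of the signs of all pairs of consecutive edges of a path. -/
noncomputable def chainSign (d : Plane) : List N.E → ℤ
  | [] => 1
  | [_] => 1
  | e :: e' :: P => N.turnSign d e e' * chainSign d (e' :: P)

theorem chainSign_eq (d : Plane) (P : List N.E) : N.chainSign d P =
    paritySign (pairSum (fun e e' => coneIndicator d (N.edgeVec e) (N.edgeVec e')) P) := by
  induction P with
  | nil => rfl
  | cons e P ih =>
    cases P with
    | nil => rfl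
    | cons e' P => rw [chainSign, ih, pairSum_cons_cons, paritySign_add, turnSign]

/-- The factor of the sign of a path that depends only on its endpoints. -/
noncomputable def endpointSign (d : Plane) (i j : Fin n) : ℤ :=
  paritySign (N.sourceTerm d i + N.sinkTerm d j + (if i < j then 1 else 0) - 1)

theorem pathSign_eq {d : Plane} (hd : ∀ e, planeDet (N.edgeVec e) d ≠ 0)
    (hd' : ∀ a, planeDet (N.disk.side a) d ≠ 0) {i j : Fin n} (hij : i ≠ j) {P : List N.E}
    (hP : N.IsPath i j P) :
    N.pathSign i j P = N.endpointSign d i j * N.chainSign d P := by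
  rw [pathSign, N.concordanceNumber_closedCurve hd hd' hij hP, chainSign_eq, endpointSign,
    ← paritySign_add]
  change paritySign _ = _
  congr 1
  ring

/-- Where `s_=` does not vanish, exchanging the two sinks does not change the product of the signs. -/
theorem endpointSign_mul (d : Plane) {i j i' j' : Fin n} (h₁ : i ≠ j) (h₂ : i ≠ j') (h₃ : i' ≠ j)
    (h₄ : i' ≠ j') (hs : sPar i j i' j' ≠ 0) :
    N.endpointSign d i j * N.endpointSign d i' j' =
      N.endpointSign d i j' * N.endpointSign d i' j := by
  have hpar : ((if i < j then 1 else 0) + (if i' < j' then 1 else 0) : ZMod 2) =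
      (if i < j' then 1 else 0) + (if i' < j then 1 else 0) := by
    by_contra hne
    apply hs
    rw [sPar_eq_neg_sCross h₁ h₂ h₃ h₄, sCross_eq h₂ h₁ h₄ h₃]
    revert hne
    rcases lt_or_gt_of_ne h₁ with h₁ | h₁ <;> rcases lt_or_gt_of_ne h₂ with h₂ | h₂ <;>
    rcases lt_or_gt_of_ne h₃ with h₃ | h₃ <;> rcases lt_or_gt_of_ne h₄ with h₄ | h₄ <;>
    first
      | (simp [h₁, h₂, h₃, h₄, not_lt_of_gt]; done)
      | (have hi : i < i' := by omega
         have hj : j < j' := by omega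
         simp [ordSign, h₁, h₂, h₃, h₄, hi, hj, not_lt_of_gt])
      | (have hi : i' < i := by omega
         have hj : j < j' := by omega
         simp [ordSign, h₁, h₂, h₃, h₄, hi, hj, not_lt_of_gt])
      | (have hi : i < i' := by omega
         have hj : j' < j := by omega
         simp [ordSign, h₁, h₂, h₃, h₄, hi, hj, not_lt_of_gt])
      | (have hi : i' < i := by omega
         have hj : j' < j := by omega
         simp [ordSign, h₁, h₂, h₃, h₄, hi, hj, not_lt_of_gt])
  simp only [endpointSign, ← paritySign_add]
  congr 1
  linear_combination hpar

end PerfectNetwork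

/-! ### Power series with logarithmic derivatives -/

section EulerDeriv

variable {E R S : Type*} [CommRing R] [CommRing S]

/-- The derivation `X_b ∂/∂X_b` of the ring of power series. -/
noncomputable def eulerDeriv (b : E) : Derivation R (MvPowerSeries E R) (MvPowerSeries E R) :=
  (MvPowerSeries.X b : MvPowerSeries E R) • MvPowerSeries.pderiv R b

theorem coeff_eulerDeriv (b : E) (f : MvPowerSeries E R) (m : E →₀ ℕ) :
    MvPowerSeries.coeff m (eulerDeriv b f) = (m b : R) * MvPowerSeries.coeff m f := by
  change MvPowerSeries.coeff m (MvPowerSeries.monomial (Finsupp.single b 1) 1 *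
    MvPowerSeries.pderiv R b f) = _
  rw [MvPowerSeries.coeff_monomial_mul]
  split_ifs with h
  · have h1 : 1 ≤ m b := by simpa using h b
    rw [MvPowerSeries.coeff_pderiv, one_mul, tsub_add_cancel_of_le h, mul_comm]
    congr 1
    rw [Finsupp.tsub_apply, Finsupp.single_eq_same, ← Nat.cast_add_one, Nat.sub_add_cancel h1]
  · have h1 : m b = 0 := by
      by_contra h0
      exact h (Finsupp.single_le_iff.2 (Nat.one_le_iff_ne_zero.2 h0))
    rw [h1, Nat.cast_zero, zero_mul]

theorem eulerDeriv_map (g : R →+* S) (b : E) (f : MvPowerSeries E R) :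
    eulerDeriv b (MvPowerSeries.map g f) = MvPowerSeries.map g (eulerDeriv b f) := by
  ext m
  simp [coeff_eulerDeriv]

theorem eulerDeriv_X [DecidableEq E] (b e : E) :
    eulerDeriv b (MvPowerSeries.X e : MvPowerSeries E R) =
      if e = b then MvPowerSeries.X e else 0 := by
  classical
  ext m
  rw [coeff_eulerDeriv]
  split_ifs with h
  · rw [MvPowerSeries.coeff_X]
    split_ifs with h'
    · rw [h', h]; simp
    · simp
  · rw [MvPowerSeries.coeff_X]
    split_ifs with h'
    · rw [h', Finsupp.single_eq_of_ne (Ne.symm h)]; simp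
    · simp

end EulerDeriv

/-! ### The transfer matrix of a network -/

namespace PerfectNetwork

variable {n : ℕ} {I : Finset (Fin n)} (N : PerfectNetwork n I)

open Classical in
/-- The signed transfer matrix: the entry at `(e, e')` is the signed weight of `e` when `e'`
starts where `e` ends. -/
noncomputable def transferMatrix (d : Plane) : Matrix N.E N.E (MvPolynomial N.E ℤ) := fun e e' =>
  if (N.tgt e).vertex = (N.src e').vertex then N.turnSign d e e' • MvPolynomial.X e else 0

open Classical in
/-- The weights of the edges that end at a sink. -/
noncomputable def exitVector (j : Fin n) (e : N.E) : MvPolynomial N.E ℤ :=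
  if N.tgt e = Sum.inl j then MvPolynomial.X e else 0

/-- The list of edges is a path from the edge `e` to the sink `b_j`. -/
def IsPathFrom (j : Fin n) (e : N.E) (P : List N.E) : Prop :=
  P.IsChain (fun e e' => (N.tgt e).vertex = (N.src e').vertex) ∧ P.head? = some e ∧
    P.getLast?.map (fun e => (N.tgt e).vertex) = some (Sum.inl j)

open Classical in
/-- The signed contribution of a list of edges to `pathSeries`. -/
noncomputable def pathCoeff (d : Plane) (j : Fin n) (e : N.E) (P : List N.E) : ℤ :=
  if N.IsPathFrom j e P then N.chainSign d P else 0

/-- The generating series of the paths from the edge `e` to the sink `b_j`. -/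
noncomputable def pathSeries (d : Plane) (j : Fin n) (e : N.E) : MvPowerSeries N.E ℤ :=
  fun m => ∑ P ∈ (Finsupp.toMultiset m).lists.toFinset, N.pathCoeff d j e P

theorem pathCoeff_nil (d : Plane) (j : Fin n) (e : N.E) : N.pathCoeff d j e [] = 0 := by
  rw [pathCoeff, if_neg]
  rintro ⟨-, h, -⟩
  simp at h

theorem pathCoeff_of_head_ne (d : Plane) (j : Fin n) {e e' : N.E} (h : e' ≠ e) (P : List N.E) :
    N.pathCoeff d j e (e' :: P) = 0 := by
  rw [pathCoeff, if_neg]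
  rintro ⟨-, h', -⟩
  simp [h] at h'

open Classical in
theorem pathCoeff_cons (d : Plane) (j : Fin n) (e : N.E) (P : List N.E) :
    N.pathCoeff d j e (e :: P) =
      (if P = [] then (if N.tgt e = Sum.inl j then 1 else 0) else 0) +
        ∑ e', (if (N.tgt e).vertex = (N.src e').vertex then
          N.turnSign d e e' * N.pathCoeff d j e' P else 0) := by
  cases P with
  | nil => simp [pathCoeff, IsPathFrom, N.vertex_eq_inl, chainSign]
  | cons f P =>
    rw [Finset.sum_eq_single f]
    · have : N.IsPathFrom j e (e :: f :: P) ↔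
          (N.tgt e).vertex = (N.src f).vertex ∧ N.IsPathFrom j f (f :: P) := by
        simp only [IsPathFrom, List.isChain_cons_cons, List.head?_cons, true_and,
          List.getLast?_cons_cons]
        tauto
      simp only [pathCoeff, this, chainSign, reduceCtorEq, if_false, zero_add]
      by_cases h1 : (N.tgt e).vertex = (N.src f).vertex
      · by_cases h2 : N.IsPathFrom j f (f :: P) <;> simp [h1, h2]
      · simp [h1]
    · intro e' _ h
      rw [N.pathCoeff_of_head_ne d j h.symm]
      simp
    · simp

theorem mem_lists_toMultiset {E : Type*} [DecidableEq E] {m : E →₀ ℕ} {P : List E} :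
    P ∈ (Finsupp.toMultiset m).lists.toFinset ↔ Finsupp.toMultiset m = (P : Multiset E) := by
  rw [Multiset.mem_toFinset, Multiset.mem_lists_iff]
  rfl

/-- The equation satisfied by the generating series of paths: a path from `e` is either the
edge `e` alone or continues with one of the next edges. -/
theorem pathSeries_eq (d : Plane) (j : Fin n) (e : N.E) :
    N.pathSeries d j e = (N.exitVector j e : MvPowerSeries N.E ℤ) +
      ∑ e', (N.transferMatrix d e e' : MvPowerSeries N.E ℤ) * N.pathSeries d j e' := by
  classical
  have hfac : (N.exitVector j e : MvPowerSeries N.E ℤ) +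
      ∑ e', (N.transferMatrix d e e' : MvPowerSeries N.E ℤ) * N.pathSeries d j e' =
      MvPowerSeries.monomial (Finsupp.single e 1) 1 *
        ((if N.tgt e = Sum.inl j then 1 else 0) + ∑ e',
          (if (N.tgt e).vertex = (N.src e').vertex then
            N.turnSign d e e' • N.pathSeries d j e' else 0)) := by
    rw [mul_add, Finset.mul_sum]
    change _ = MvPowerSeries.X e * _ + ∑ e', MvPowerSeries.X e * _
    congr 1
    · rw [exitVector]
      split_ifs <;> simp
    · refine Finset.sum_congr rfl fun e' _ => ?_
      rw [transferMatrix]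
      split_ifs
      · rw [MvPolynomial.coe_smul, MvPolynomial.coe_X, smul_mul_assoc, mul_smul_comm]
        rfl
      · simp
  rw [hfac]
  ext m
  rw [MvPowerSeries.coeff_monomial_mul]
  change ∑ P ∈ (Finsupp.toMultiset m).lists.toFinset, N.pathCoeff d j e P = _
  by_cases h : Finsupp.single e 1 ≤ m
  · rw [if_pos h]
    obtain ⟨m', rfl⟩ : ∃ m', m = Finsupp.single e 1 + m' :=
      ⟨m - Finsupp.single e 1, (add_tsub_cancel_of_le h).symm⟩
    have himage : ∀ P, N.pathCoeff d j e P ≠ 0 →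
        P ∈ (Finsupp.toMultiset (Finsupp.single e 1 + m')).lists.toFinset →
        P ∈ (Finsupp.toMultiset m').lists.toFinset.image (List.cons e) := by
      intro P h0 hP
      cases P with
      | nil => exact absurd (N.pathCoeff_nil d j e) h0
      | cons f P =>
        by_cases hf : f = e
        · subst hf
          rw [mem_lists_toMultiset, map_add, Finsupp.toMultiset_single, one_smul,
            Multiset.singleton_add, ← Multiset.cons_coe, Multiset.cons_inj_right] at hP
          exact Finset.mem_image_of_mem _ (mem_lists_toMultiset.2 hP)
        · exact absurd (N.pathCoeff_of_head_ne d j hf P) h0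
    have hsub : (Finsupp.toMultiset m').lists.toFinset.image (List.cons e) ⊆
        (Finsupp.toMultiset (Finsupp.single e 1 + m')).lists.toFinset := by
      intro P hP
      obtain ⟨Q, hQ, rfl⟩ := Finset.mem_image.1 hP
      rw [mem_lists_toMultiset] at hQ ⊢
      rw [map_add, Finsupp.toMultiset_single, one_smul, hQ]
      rfl
    rw [← Finset.sum_subset hsub (fun P hP hP' => by
      by_contra h0
      exact hP' (himage P h0 hP)), Finset.sum_image (fun _ _ _ _ hh => (List.cons.inj hh).2)]
    simp only [N.pathCoeff_cons, Finset.sum_add_distrib]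
    rw [add_tsub_cancel_left, one_mul, map_add, map_sum, Finset.sum_comm]
    congr 1
    · rw [Finset.sum_ite_eq']
      have : ([] ∈ (Finsupp.toMultiset m').lists.toFinset) ↔ m' = 0 := by
        rw [mem_lists_toMultiset, Multiset.coe_nil]
        refine ⟨fun h0 => Finsupp.ext fun f => ?_, fun h0 => by rw [h0, map_zero]⟩
        rw [← Finsupp.count_toMultiset, h0, Multiset.count_zero, Finsupp.zero_apply]
      simp only [this]
      by_cases h1 : N.tgt e = Sum.inl j
      · simp [h1, MvPowerSeries.coeff_one]
      · simp [h1]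
    · refine Finset.sum_congr rfl fun e' _ => ?_
      split_ifs
      · rw [← Finset.mul_sum, map_zsmul, smul_eq_mul]
        rfl
      · simp
  · rw [if_neg h]
    refine Finset.sum_eq_zero fun P hP => ?_
    cases P with
    | nil => exact N.pathCoeff_nil d j e
    | cons f P =>
      by_cases hf : f = e
      · exfalso
        subst hf
        rw [mem_lists_toMultiset] at hP
        apply h
        have h1 : 0 < m f := by
          rw [← Finsupp.count_toMultiset, hP, Multiset.count_pos]
          simp
        exact Finsupp.single_le_iff.2 h1
      · exact N.pathCoeff_of_head_ne d j hf P

theorem boundarySeries_eq {d : Plane} (hd : ∀ e, planeDet (N.edgeVec e) d ≠ 0)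
    (hd' : ∀ a, planeDet (N.disk.side a) d ≠ 0) {i j : Fin n} (hij : i ≠ j) {e : N.E}
    (he : N.src e = Sum.inl i) :
    N.boundarySeries i j = N.endpointSign d i j • N.pathSeries d j e := by
  classical
  ext m
  rw [map_zsmul, smul_eq_mul]
  change (∑ P ∈ _ with N.IsPath i j P, N.pathSign i j P) = _ * ∑ P ∈ _, N.pathCoeff d j e P
  rw [Finset.mul_sum, Finset.sum_filter]
  refine Finset.sum_congr (by congr) fun P _ => ?_
  have hiff : N.IsPath i j P ↔ N.IsPathFrom j e P := by
    rw [IsPath, IsPathFrom]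
    refine and_congr_right fun _ => and_congr_left fun _ => ?_
    cases P with
    | nil => simp
    | cons f P =>
      simp only [List.head?_cons, Option.map_some, Option.some.injEq, N.vertex_eq_inl]
      exact ⟨fun h => N.src_injective (h.trans he.symm), fun h => h ▸ he⟩
  rw [pathCoeff]
  by_cases h : N.IsPath i j P
  · rw [if_pos h, if_pos (hiff.1 h), N.pathSign_eq hd hd' hij h]
  · rw [if_neg h, if_neg (fun h' => h (hiff.2 h')), mul_zero]

theorem exists_src_eq {i : Fin n} (hi : i ∈ I) : ∃ e, N.src e = Sum.inl i := (N.source_iff i).1 hi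

theorem exists_tgt_eq {j : Fin n} (hj : j ∉ I) : ∃ e, N.tgt e = Sum.inl j := by
  obtain ⟨x, hx⟩ := N.flags_bijective.2 (Sum.inl j)
  rcases x with e | e
  · exact absurd ((N.source_iff j).2 ⟨e, hx⟩) hj
  · exact ⟨e, hx⟩

/-- The matrix `1 - T` over the polynomials. -/
noncomputable def kirchhoffMatrix (d : Plane) : Matrix N.E N.E (MvPolynomial N.E ℤ) :=
  1 - N.transferMatrix d

theorem constantCoeff_det_kirchhoffMatrix (d : Plane) :
    MvPolynomial.constantCoeff (N.kirchhoffMatrix d).det = 1 := by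
  rw [RingHom.map_det]
  have : MvPolynomial.constantCoeff.mapMatrix (N.kirchhoffMatrix d) = 1 := by
    ext e e'
    simp only [kirchhoffMatrix, map_sub, map_one, Matrix.sub_apply, RingHom.mapMatrix_apply,
      Matrix.map_apply, transferMatrix]
    split_ifs <;> simp
  rw [this, Matrix.det_one]

/-- The transfer matrix over the power series. -/
noncomputable def transferSeries (d : Plane) : Matrix N.E N.E (MvPowerSeries N.E ℤ) := fun e e' =>
  (N.transferMatrix d e e' : MvPowerSeries N.E ℤ)

/-- The matrix `1 - T` over the power series. -/
noncomputable def kirchhoffSeries (d : Plane) : Matrix N.E N.E (MvPowerSeries N.E ℤ) :=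
  (MvPolynomial.coeToMvPowerSeries.ringHom (R := ℤ)).mapMatrix (N.kirchhoffMatrix d)

theorem kirchhoffSeries_eq (d : Plane) : N.kirchhoffSeries d =
    1 - N.transferSeries d := by
  rw [kirchhoffSeries, kirchhoffMatrix, map_sub, map_one]
  rfl

theorem det_kirchhoffSeries (d : Plane) : (N.kirchhoffSeries d).det =
    ((N.kirchhoffMatrix d).det : MvPowerSeries N.E ℤ) :=
  (RingHom.map_det _ _).symm

theorem isUnit_det_kirchhoffSeries (d : Plane) : IsUnit (N.kirchhoffSeries d).det := by
  rw [det_kirchhoffSeries, MvPowerSeries.isUnit_iff_constantCoeff]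
  have : MvPowerSeries.constantCoeff ((N.kirchhoffMatrix d).det : MvPowerSeries N.E ℤ) =
      MvPolynomial.constantCoeff (N.kirchhoffMatrix d).det := by
    rw [← MvPowerSeries.coeff_zero_eq_constantCoeff_apply, MvPolynomial.coeff_coe]
    rfl
  rw [this, constantCoeff_det_kirchhoffMatrix]
  exact isUnit_one

theorem kirchhoffSeries_mulVec (d : Plane) (j : Fin n) :
    (N.kirchhoffSeries d).mulVec (N.pathSeries d j) =
      fun e => (N.exitVector j e : MvPowerSeries N.E ℤ) := by
  rw [kirchhoffSeries_eq, Matrix.sub_mulVec, Matrix.one_mulVec]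
  funext e
  rw [Pi.sub_apply, N.pathSeries_eq d j e]
  exact add_sub_cancel_right _ _

/-- The generating series of paths are rational, by Cramer's rule. -/
theorem isFractionOf_pathSeries (d : Plane) (j : Fin n) (e : N.E) :
    IsFractionOf (N.pathSeries d j e) (((N.kirchhoffMatrix d).adjugate.mulVec (N.exitVector j)) e)
      (N.kirchhoffMatrix d).det := by
  constructor
  · intro h
    have := N.constantCoeff_det_kirchhoffMatrix d
    rw [h, map_zero] at this
    exact zero_ne_one this
  · rw [← det_kirchhoffSeries]
    have h := congrArg ((N.kirchhoffSeries d).adjugate.mulVec) (N.kirchhoffSeries_mulVec d j)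
    rw [Matrix.mulVec_mulVec, Matrix.adjugate_mul, Matrix.smul_mulVec, Matrix.one_mulVec] at h
    have h' := congrFun h e
    rw [Pi.smul_apply, smul_eq_mul] at h'
    rw [h', kirchhoffSeries, ← RingHom.map_adjugate]
    simp only [Matrix.mulVec, dotProduct, RingHom.mapMatrix_apply, Matrix.map_apply]
    change _ = MvPolynomial.coeToMvPowerSeries.ringHom _
    rw [map_sum]
    simp only [map_mul]
    rfl

theorem exists_isFractionOf_boundarySeries {i j : Fin n} (hi : i ∈ I) (hij : i ≠ j) :
    ∃ p q, IsFractionOf (N.boundarySeries i j) p q := by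
  obtain ⟨d, hd, hd'⟩ := N.exists_generic_direction
  obtain ⟨e, he⟩ := N.exists_src_eq hi
  have h := N.isFractionOf_pathSeries d j e
  refine ⟨N.endpointSign d i j • ((N.kirchhoffMatrix d).adjugate.mulVec (N.exitVector j)) e, _,
    h.1, ?_⟩
  rw [N.boundarySeries_eq hd hd' hij he, mul_smul_comm, h.2, MvPolynomial.coe_smul]
  rfl

end PerfectNetwork

namespace PerfectNetwork

variable {n : ℕ} {I : Finset (Fin n)} (N : PerfectNetwork n I)

theorem src_vertex_white {v : N.W} (hv : N.white v = true) {e : N.E}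
    (he : (N.tgt e).vertex = Sum.inr v) : N.tgt e = Sum.inr (v, 0) := by
  obtain ⟨-, ⟨e₁, h₁⟩, ⟨e₂, h₂⟩⟩ := N.white_spec v hv
  rcases h : N.tgt e with i | ⟨w, a⟩
  · simp [h, NetFlag.vertex] at he
  · obtain rfl : w = v := by simpa [h, NetFlag.vertex] using he
    fin_cases a
    · rfl
    · exact absurd (h₁.trans h.symm) (N.src_ne_tgt _ _)
    · exact absurd (h₂.trans h.symm) (N.src_ne_tgt _ _)

theorem tgt_vertex_black {v : N.W} (hv : N.white v = false) {e : N.E}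
    (he : (N.src e).vertex = Sum.inr v) : N.src e = Sum.inr (v, 0) := by
  obtain ⟨-, ⟨e₁, h₁⟩, ⟨e₂, h₂⟩⟩ := N.black_spec v hv
  rcases h : N.src e with i | ⟨w, a⟩
  · simp [h, NetFlag.vertex] at he
  · obtain rfl : w = v := by simpa [h, NetFlag.vertex] using he
    fin_cases a
    · rfl
    · exact absurd (h.trans h₁.symm) (N.src_ne_tgt _ _)
    · exact absurd (h.trans h₂.symm) (N.src_ne_tgt _ _)

theorem eulerDeriv_transferSeries (d : Plane) (b e e' : N.E) :
    eulerDeriv b (N.transferSeries d e e') = if e = b then N.transferSeries d e e' else 0 := by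
  rw [transferSeries, transferMatrix]
  split_ifs with h1 h2
  · rw [MvPolynomial.coe_smul, MvPolynomial.coe_X, Derivation.map_smul, eulerDeriv_X, if_pos h2]
  · rw [MvPolynomial.coe_smul, MvPolynomial.coe_X, Derivation.map_smul, eulerDeriv_X, if_neg h2]
    exact smul_zero (A := MvPowerSeries N.E ℤ) _
  · simp
  · simp

theorem eulerDeriv_exitVector (j : Fin n) (b e : N.E) :
    eulerDeriv b (N.exitVector j e : MvPowerSeries N.E ℤ) =
      if e = b then (N.exitVector j e : MvPowerSeries N.E ℤ) else 0 := by
  rw [exitVector]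
  split_ifs with h1 h2
  · rw [MvPolynomial.coe_X, eulerDeriv_X, if_pos h2]
  · rw [MvPolynomial.coe_X, eulerDeriv_X, if_neg h2]
  · simp
  · simp

/-- The generating series of the paths through the edge `b` factors at `b`. -/
theorem eulerDeriv_pathSeries (d : Plane) (j : Fin n) (b e : N.E) :
    eulerDeriv b (N.pathSeries d j e) = (N.kirchhoffSeries d)⁻¹ e b * N.pathSeries d j b := by
  have h1 : (N.kirchhoffSeries d).mulVec (fun e => eulerDeriv b (N.pathSeries d j e)) =
      Pi.single b (N.pathSeries d j b) := by
    rw [kirchhoffSeries_eq, Matrix.sub_mulVec, Matrix.one_mulVec]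
    funext e
    have h := congrArg (eulerDeriv b) (N.pathSeries_eq d j e)
    rw [map_add, map_sum, eulerDeriv_exitVector] at h
    simp only [Derivation.leibniz, smul_eq_mul] at h
    rw [Finset.sum_add_distrib] at h
    rw [Pi.sub_apply, sub_eq_iff_eq_add, h, Matrix.mulVec, dotProduct]
    have h2 : ∑ e', N.pathSeries d j e' *
        eulerDeriv b (N.transferMatrix d e e' : MvPowerSeries N.E ℤ) =
        if e = b then ∑ e', (N.transferMatrix d e e' : MvPowerSeries N.E ℤ) * N.pathSeries d j e'
          else 0 := by
      have h3 : ∀ e', eulerDeriv b (N.transferMatrix d e e' : MvPowerSeries N.E ℤ) =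
          if e = b then (N.transferMatrix d e e' : MvPowerSeries N.E ℤ) else 0 :=
        fun e' => N.eulerDeriv_transferSeries d b e e'
      simp only [h3]
      split_ifs
      · exact Finset.sum_congr rfl fun _ _ => mul_comm _ _
      · simp
    rw [h2]
    by_cases hb : e = b
    · subst hb
      rw [if_pos rfl, if_pos rfl, Pi.single_eq_same]
      conv_rhs => rw [N.pathSeries_eq d j e]
      simp only [transferSeries]
      ring
    · rw [if_neg hb, if_neg hb, Pi.single_eq_of_ne hb]
      simp only [transferSeries]
      ring
  have h2 := congrArg ((N.kirchhoffSeries d)⁻¹.mulVec) h1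
  rw [Matrix.mulVec_mulVec, Matrix.nonsing_inv_mul _ (N.isUnit_det_kirchhoffSeries d),
    Matrix.one_mulVec] at h2
  have h3 := congrFun h2 e
  rw [h3, Matrix.mulVec_single]
  simp

theorem inv_kirchhoffSeries_apply (d : Plane) {e b : N.E} (h : e ≠ b) :
    (N.kirchhoffSeries d)⁻¹ e b = ∑ g, (N.kirchhoffSeries d)⁻¹ e g * N.transferSeries d g b := by
  have h1 := Matrix.nonsing_inv_mul _ (N.isUnit_det_kirchhoffSeries d)
  have h3 : (N.kirchhoffSeries d)⁻¹ * (1 - N.transferSeries d) = 1 := by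
    rw [← N.kirchhoffSeries_eq d, h1]
  rw [Matrix.mul_sub, Matrix.mul_one] at h3
  have h2 := congrFun (congrFun h3 e) b
  rw [Matrix.sub_apply, Matrix.one_apply_ne h, sub_eq_zero, Matrix.mul_apply] at h2
  exact h2

/-- The numbers of visits of an edge by the paths are encoded by products of a series that depends
on the source and of a series that depends on the sink. At a white vertex the first factors of the
two outgoing edges are proportional, at a black vertex the second factors of the two incoming
edges are. -/
theorem exists_factorization {d : Plane} (hd : ∀ e, planeDet (N.edgeVec e) d ≠ 0)
    (hd' : ∀ a, planeDet (N.disk.side a) d ≠ 0) :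
    ∃ U V : Fin n → N.E → MvPowerSeries N.E ℤ,
      (∀ i ∈ I, ∀ j ∉ I, ∀ b, eulerDeriv b (N.boundarySeries i j) =
        N.endpointSign d i j • (U i b * V j b)) ∧
      (∀ v b c, N.white v = true → N.src b = Sum.inr (v, 1) → N.src c = Sum.inr (v, 2) →
        ∀ i ∈ I, ∀ i' ∈ I, U i b * U i' c = U i c * U i' b) ∧
      (∀ v b c, N.white v = false → N.tgt b = Sum.inr (v, 1) → N.tgt c = Sum.inr (v, 2) →
        ∀ j j', V j b * V j' c = V j c * V j' b) := by
  classical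
  have hex : ∀ i : Fin n, ∃ f : N.E → MvPowerSeries N.E ℤ, ∀ e, N.src e = Sum.inl i →
      f = fun b => (N.kirchhoffSeries d)⁻¹ e b := by
    intro i
    by_cases h : ∃ e, N.src e = Sum.inl i
    · obtain ⟨e, he⟩ := h
      exact ⟨fun b => (N.kirchhoffSeries d)⁻¹ e b,
        fun e' he' => by rw [N.src_injective (he.trans he'.symm)]⟩
    · exact ⟨0, fun e he => absurd ⟨e, he⟩ h⟩
  choose U hU using hex
  refine ⟨U, fun j => N.pathSeries d j, ?_, ?_, ?_⟩
  · intro i hi j hj b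
    obtain ⟨e, he⟩ := N.exists_src_eq hi
    have hij : i ≠ j := fun h => hj (h ▸ hi)
    rw [N.boundarySeries_eq hd hd' hij he, map_zsmul, eulerDeriv_pathSeries, hU i e he]
  · intro v b c hv hb hc i hi i' hi'
    obtain ⟨⟨a, ha⟩, -, -⟩ := N.white_spec v hv
    have key : ∀ i ∈ I, ∀ b k, N.src b = Sum.inr (v, k) → U i b = U i a * N.transferSeries d a b := by
      intro i hi b k hb
      obtain ⟨e, he⟩ := N.exists_src_eq hi
      have hne : e ≠ b := by
        rintro rfl
        rw [he] at hb
        exact Sum.inl_ne_inr hb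
      rw [hU i e he]
      change (N.kirchhoffSeries d)⁻¹ e b = _
      rw [N.inv_kirchhoffSeries_apply d hne, Finset.sum_eq_single a]
      · intro g _ hg
        have : ¬(N.tgt g).vertex = (N.src b).vertex := by
          rw [hb]
          intro h
          exact hg (N.tgt_injective ((N.src_vertex_white hv h).trans ha.symm))
        simp only [transferSeries, transferMatrix, if_neg this]
        simp
      · simp
    rw [key i hi b 1 hb, key i hi c 2 hc, key i' hi' b 1 hb, key i' hi' c 2 hc]
    ring
  · intro v b c hv hb hc j j'
    obtain ⟨⟨a, ha⟩, -, -⟩ := N.black_spec v hv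
    have key : ∀ j b k, N.tgt b = Sum.inr (v, k) →
        N.pathSeries d j b = N.transferSeries d b a * N.pathSeries d j a := by
      intro j b k hb
      rw [N.pathSeries_eq d j b, exitVector, if_neg (by rw [hb]; exact Sum.inr_ne_inl),
        MvPolynomial.coe_zero, zero_add, Finset.sum_eq_single a]
      · rfl
      · intro g _ hg
        have : ¬(N.tgt b).vertex = (N.src g).vertex := by
          rw [hb]
          intro h
          exact hg (N.src_injective ((N.tgt_vertex_black hv h.symm).trans ha.symm))
        simp only [transferMatrix, if_neg this]
        simp
      · simp
    change N.pathSeries d j b * N.pathSeries d j' c = N.pathSeries d j c * N.pathSeries d j' b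
    rw [key j b 1 hb, key j c 2 hc, key j' b 1 hb, key j' c 2 hc]
    ring

end PerfectNetwork

/-! ### Angles in the plane -/

theorem eq_of_coe_angle_eq {x y : ℝ} (h : (x : Real.Angle) = y) (hxy : |x - y| < 2 * Real.pi) :
    x = y := by
  rw [Real.Angle.angle_eq_iff_two_pi_dvd_sub] at h
  obtain ⟨k, hk⟩ := h
  rw [hk, abs_mul, abs_of_pos Real.two_pi_pos] at hxy
  have h1 : |(k : ℝ)| < 1 := by
    by_contra h2
    push Not at h2
    nlinarith [Real.two_pi_pos]
  have h2 : k = 0 := by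
    have : |k| < 1 := by exact_mod_cast h1
    exact Int.abs_lt_one_iff.1 this
  rw [h2] at hk
  simp at hk
  linarith

/-- The oriented angle under which the segment from `p` to `q` is seen from `x`, in `(-π, π]`.
It is `0` when `x` is one of the endpoints. -/
noncomputable def viewAngle (x p q : ℂ) : ℝ := Complex.arg ((q - x) / (p - x))

theorem viewAngle_left (p q : ℂ) : viewAngle p p q = 0 := by simp [viewAngle]

theorem viewAngle_right (p q : ℂ) : viewAngle q p q = 0 := by simp [viewAngle]

theorem coe_viewAngle {x p q : ℂ} (hp : p ≠ x) (hq : q ≠ x) :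
    (viewAngle x p q : Real.Angle) = Complex.arg (q - x) - Complex.arg (p - x) :=
  Complex.arg_div_coe_angle (sub_ne_zero.2 hq) (sub_ne_zero.2 hp)

theorem div_mem_slitPlane {x p q : ℂ} (h : x ∉ segment ℝ p q) :
    (q - x) / (p - x) ∈ Complex.slitPlane := by
  have hp : p - x ≠ 0 := fun h' => h (sub_eq_zero.1 h' ▸ left_mem_segment ℝ p q)
  by_contra hs
  rw [Complex.mem_slitPlane_iff, not_or, not_lt, not_not] at hs
  obtain ⟨hre, him⟩ := hs
  set r : ℝ := ((q - x) / (p - x)).re with hr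
  have hz : (q - x) / (p - x) = (r : ℂ) := Complex.ext (by simp [hr]) (by simp [him])
  have hq : q - x = r * (p - x) := by rw [← hz]; field_simp
  have h1 : (1 - r : ℝ) ≠ 0 := by linarith
  have h1' : (1 - r : ℂ) ≠ 0 := by exact_mod_cast h1
  apply h
  refine ⟨-r / (1 - r), 1 / (1 - r), div_nonneg (by linarith) (by linarith),
    div_nonneg (by norm_num) (by linarith), by field_simp; ring, ?_⟩
  rw [Complex.real_smul, Complex.real_smul]
  push_cast
  field_simp
  linear_combination hq

theorem coe_arg_sub_swap {x y : ℂ} (h : x ≠ y) :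
    (Complex.arg (x - y) : Real.Angle) = Complex.arg (y - x) + Real.pi := by
  rw [← neg_sub y x, Complex.arg_neg_coe_angle (sub_ne_zero.2 h.symm)]

/-- Two disjoint segments: the variation of the angle under which one of them is seen along the other
one is symmetric in the two segments. -/
theorem viewAngle_exchange {x x' p q : ℂ} (h : Disjoint (segment ℝ x x') (segment ℝ p q)) :
    viewAngle x' p q - viewAngle x p q - viewAngle q x x' + viewAngle p x x' = 0 := by
  set y : ℝ → ℂ := fun t => x + t • (x' - x) with hy
  have hy0 : y 0 = x := by simp [hy]
  have hy1 : y 1 = x' := by simp [hy]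
  have hymem : ∀ t ∈ Set.Icc (0 : ℝ) 1, y t ∈ segment ℝ x x' := by
    intro t ht
    refine ⟨1 - t, t, by linarith [ht.2], ht.1, by ring, ?_⟩
    simp only [hy]
    module
  have hsub : ∀ t ∈ Set.Icc (0 : ℝ) 1, segment ℝ x (y t) ⊆ segment ℝ x x' := fun t ht =>
    (convex_segment x x').segment_subset (left_mem_segment ℝ x x') (hymem t ht)
  have hdis : ∀ z ∈ segment ℝ x x', z ∉ segment ℝ p q := fun z hz hz' =>
    Set.disjoint_left.1 h hz hz'
  have hp : p ∈ segment ℝ p q := left_mem_segment ℝ p q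
  have hq : q ∈ segment ℝ p q := right_mem_segment ℝ p q
  have hx : x ∈ segment ℝ x x' := left_mem_segment ℝ x x'
  have hne : ∀ z ∈ segment ℝ x x', ∀ w ∈ segment ℝ p q, w ≠ z := fun z hz w hw hwz =>
    hdis z hz (hwz ▸ hw)
  set f : ℝ → ℝ := fun t =>
    viewAngle (y t) p q - viewAngle x p q - viewAngle q x (y t) + viewAngle p x (y t) with hf
  have hycont : Continuous y := by fun_prop
  have hcont : ContinuousOn f (Set.Icc 0 1) := by
    have c1 : ContinuousOn (fun t => viewAngle (y t) p q) (Set.Icc 0 1) := by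
      intro t ht
      apply ContinuousAt.continuousWithinAt
      refine ContinuousAt.comp (f := fun t => (q - y t) / (p - y t))
        (Complex.continuousAt_arg (div_mem_slitPlane (hdis _ (hymem t ht)))) ?_
      exact ContinuousAt.div (by fun_prop) (by fun_prop)
        (sub_ne_zero.2 (hne _ (hymem t ht) p hp))
    have c2 : ∀ w ∈ segment ℝ p q, ContinuousOn (fun t => viewAngle w x (y t)) (Set.Icc 0 1) := by
      intro w hw t ht
      apply ContinuousAt.continuousWithinAt
      refine ContinuousAt.comp (f := fun t => (y t - w) / (x - w))
        (Complex.continuousAt_arg (div_mem_slitPlane fun hw' => hdis w (hsub t ht hw') hw)) ?_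
      fun_prop
    exact ((c1.sub continuousOn_const).sub (c2 q hq)).add (c2 p hp)
  have hf0 : f 0 = 0 := by
    simp only [hf, hy0, viewAngle]
    rw [div_self (sub_ne_zero.2 (hne x hx q hq).symm), div_self (sub_ne_zero.2 (hne x hx p hp).symm)]
    simp
  have hcoe : ∀ t ∈ Set.Icc (0 : ℝ) 1, (f t : Real.Angle) = 0 := by
    intro t ht
    have hyt := hymem t ht
    simp only [hf]
    rw [Real.Angle.coe_add, Real.Angle.coe_sub, Real.Angle.coe_sub,
      coe_viewAngle (hne _ hyt p hp) (hne _ hyt q hq), coe_viewAngle (hne _ hx p hp) (hne _ hx q hq),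
      coe_viewAngle (hne _ hx q hq).symm (hne _ hyt q hq).symm,
      coe_viewAngle (hne _ hx p hp).symm (hne _ hyt p hp).symm,
      coe_arg_sub_swap (hne _ hyt q hq), coe_arg_sub_swap (hne _ hyt p hp),
      coe_arg_sub_swap (hne _ hx q hq), coe_arg_sub_swap (hne _ hx p hp)]
    abel
  have hpi : ∀ t ∈ Set.Icc (0 : ℝ) 1, f t ≠ Real.pi ∧ f t ≠ -Real.pi := by
    intro t ht
    have := hcoe t ht
    constructor
    · intro h'
      rw [h'] at this
      exact Real.Angle.pi_ne_zero this
    · intro h'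
      rw [h', Real.Angle.coe_neg, neg_eq_zero] at this
      exact Real.Angle.pi_ne_zero this
  -- A continuous function with values in the multiples of `2π` that vanishes at `0` is zero.
  have hf1 : f 1 = 0 := by
    apply eq_of_coe_angle_eq (by simpa using hcoe 1 (by simp))
    rw [sub_zero]
    by_contra hlt
    push Not at hlt
    have hpos := Real.pi_pos
    rcases le_abs.1 hlt with h1 | h1
    · obtain ⟨t, ht, ht'⟩ := intermediate_value_Icc zero_le_one hcont
        (show Real.pi ∈ Set.Icc (f 0) (f 1) from ⟨by rw [hf0]; exact hpos.le, by linarith⟩)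
      exact (hpi t ht).1 ht'
    · obtain ⟨t, ht, ht'⟩ := intermediate_value_Icc' zero_le_one hcont
        (show -Real.pi ∈ Set.Icc (f 1) (f 0) from ⟨by linarith, by rw [hf0]; linarith⟩)
      exact (hpi t ht).2 ht'
  simpa only [hf, hy1] using hf1

/-- For two segments with vectors `u` and `w` starting at a common point: the angle at which the
second segment is seen from the end of the first one, minus the angle at which the first segment
is seen from the end of the second one. -/
noncomputable def cornerAngle (u w : ℂ) : ℝ := Complex.arg (1 - w / u) - Complex.arg (1 - u / w)

theorem cornerAngle_swap (u w : ℂ) : cornerAngle w u = -cornerAngle u w := by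
  simp only [cornerAngle]; ring

theorem viewAngle_add (v : ℂ) {u : ℂ} (w : ℂ) (hu : u ≠ 0) :
    viewAngle (v + u) v (v + w) = Complex.arg (1 - w / u) := by
  rw [viewAngle]
  congr 1
  have : v - (v + u) = -u := by ring
  rw [this]
  field_simp
  ring

theorem viewAngle_swap {x p q : ℂ} (h : viewAngle x q p ≠ Real.pi) :
    viewAngle x p q = -viewAngle x q p := by
  simp only [viewAngle] at h ⊢
  rw [← inv_div, Complex.arg_inv, if_neg h]

theorem coe_cornerAngle {u w : ℂ} (hu : u ≠ 0) (hw : w ≠ 0) (huw : u ≠ w) :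
    (cornerAngle u w : Real.Angle) = Real.pi + Complex.arg w - Complex.arg u := by
  have h1 : 1 - w / u = (u - w) / u := by field_simp
  have h2 : 1 - u / w = (w - u) / w := by field_simp
  rw [cornerAngle, h1, h2, Real.Angle.coe_sub, Complex.arg_div_coe_angle (sub_ne_zero.2 huw) hu,
    Complex.arg_div_coe_angle (sub_ne_zero.2 huw.symm) hw, coe_arg_sub_swap huw]
  abel

theorem cornerAngle_mem {u w : ℂ} (hu : u ≠ 0) (hw : w ≠ 0) (h : 0 < (u / w).im) :
    0 < cornerAngle u w ∧ cornerAngle u w < Real.pi := by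
  have huw : u ≠ w := by
    rintro rfl
    simp [hu] at h
  have h' : (w / u).im < 0 := by
    rw [← inv_div, Complex.inv_im]
    exact div_neg_of_neg_of_pos (by linarith) (Complex.normSq_pos.2 (div_ne_zero hu hw))
  have a1 : 0 < Complex.arg (1 - w / u) ∧ Complex.arg (1 - w / u) < Real.pi := by
    have him : 0 < (1 - w / u).im := by simp; linarith
    refine ⟨lt_of_le_of_ne (Complex.arg_nonneg_iff.2 him.le) fun h0 => ?_, ?_⟩
    · rw [eq_comm, Complex.arg_eq_zero_iff] at h0
      exact him.ne' h0.2
    · exact lt_of_le_of_ne (Complex.arg_le_pi _) fun h0 => by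
        rw [Complex.arg_eq_pi_iff] at h0
        exact him.ne' h0.2
  have a2 : Complex.arg (1 - u / w) < 0 ∧ -Real.pi < Complex.arg (1 - u / w) :=
    ⟨Complex.arg_neg_iff.2 (by simp; linarith), Complex.neg_pi_lt_arg _⟩
  have a3 : 0 < Complex.arg (u / w) ∧ Complex.arg (u / w) < Real.pi := by
    refine ⟨lt_of_le_of_ne (Complex.arg_nonneg_iff.2 h.le) fun h0 => ?_, ?_⟩
    · rw [eq_comm, Complex.arg_eq_zero_iff] at h0
      exact h.ne' h0.2
    · exact lt_of_le_of_ne (Complex.arg_le_pi _) fun h0 => by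
        rw [Complex.arg_eq_pi_iff] at h0
        exact h.ne' h0.2
  have key : cornerAngle u w = Real.pi - Complex.arg (u / w) := by
    apply eq_of_coe_angle_eq
    · rw [coe_cornerAngle hu hw huw, Real.Angle.coe_sub, Complex.arg_div_coe_angle hu hw]
      abel
    · rw [cornerAngle, abs_lt]
      constructor <;> linarith [a1.1, a1.2, a2.1, a2.2, a3.1, a3.2]
  rw [key]
  constructor <;> linarith [a3.1, a3.2]

theorem abs_cornerAngle_le {u w : ℂ} (hu : u ≠ 0) (hw : w ≠ 0) : |cornerAngle u w| ≤ Real.pi := by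
  rcases lt_trichotomy (u / w).im 0 with h | h | h
  · have h' : 0 < (w / u).im := by
      rw [← inv_div, Complex.inv_im]
      exact div_pos (by linarith) (Complex.normSq_pos.2 (div_ne_zero hu hw))
    have := cornerAngle_mem hw hu h'
    rw [cornerAngle_swap] at this
    rw [abs_le]
    constructor <;> linarith [this.1, this.2]
  · have real : ∀ z : ℂ, z.im = 0 → 0 ≤ Complex.arg z ∧ Complex.arg z ≤ Real.pi := fun z hz =>
      ⟨Complex.arg_nonneg_iff.2 hz.ge, Complex.arg_le_pi _⟩
    have h' : (w / u).im = 0 := by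
      rw [← inv_div, Complex.inv_im, h]; simp
    have r1 := real (1 - w / u) (by simp [h'])
    have r2 := real (1 - u / w) (by simp [h])
    rw [cornerAngle, abs_le]
    constructor <;> linarith [r1.1, r1.2, r2.1, r2.2]
  · have := cornerAngle_mem hu hw h
    rw [abs_le]
    constructor <;> linarith [this.1, this.2]

/-- Around a vertex of degree three the corner angles add up to `π`. -/
theorem cornerAngle_sum {u v w : ℂ} (hu : u ≠ 0) (hv : v ≠ 0) (hw : w ≠ 0) (huw : u ≠ w)
    (h1 : 0 < (u / v).im) (h2 : 0 < (v / w).im) :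
    cornerAngle u v + cornerAngle v w + cornerAngle w u = Real.pi := by
  have m1 := cornerAngle_mem hu hv h1
  have m2 := cornerAngle_mem hv hw h2
  have m3 := abs_le.1 (abs_cornerAngle_le hw hu)
  have ne : ∀ {a b : ℂ}, b ≠ 0 → 0 < (a / b).im → a ≠ b := by
    rintro a b hb h rfl
    rw [div_self hb] at h
    simp at h
  apply eq_of_coe_angle_eq
  · rw [Real.Angle.coe_add, Real.Angle.coe_add, coe_cornerAngle hu hv (ne hv h1),
      coe_cornerAngle hv hw (ne hw h2), coe_cornerAngle hw hu huw.symm]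
    have := Real.Angle.coe_pi_add_coe_pi
    calc _ = (Real.pi + Real.pi : Real.Angle) + Real.pi := by abel
      _ = _ := by rw [this, zero_add]
  · rw [abs_lt]
    constructor <;> linarith [m1.1, m1.2, m2.1, m2.2, m3.1, m3.2]

/-- The sum of the angles of a triangle. -/
theorem viewAngle_triangle {a b c : ℂ} (hab : a ≠ b) (hbc : b ≠ c) (hca : c ≠ a)
    (h1 : 0 < ((c - a) / (b - a)).im) (h2 : 0 < ((a - b) / (c - b)).im)
    (h3 : 0 < ((b - c) / (a - c)).im) :
    viewAngle a b c + viewAngle b c a + viewAngle c a b = Real.pi := by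
  have pos : ∀ z : ℂ, 0 < z.im → 0 < Complex.arg z ∧ Complex.arg z < Real.pi := by
    intro z hz
    refine ⟨lt_of_le_of_ne (Complex.arg_nonneg_iff.2 hz.le) fun h0 => ?_, ?_⟩
    · rw [eq_comm, Complex.arg_eq_zero_iff] at h0
      exact hz.ne' h0.2
    · exact lt_of_le_of_ne (Complex.arg_le_pi _) fun h0 => by
        rw [Complex.arg_eq_pi_iff] at h0
        exact hz.ne' h0.2
  have m1 := pos _ h1
  have m2 := pos _ h2
  have m3 := pos _ h3
  apply eq_of_coe_angle_eq
  · rw [Real.Angle.coe_add, Real.Angle.coe_add, coe_viewAngle hab.symm hca, coe_viewAngle hbc.symm hab,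
      coe_viewAngle hca.symm hbc, coe_arg_sub_swap hca, coe_arg_sub_swap hab, coe_arg_sub_swap hbc]
    have := Real.Angle.coe_pi_add_coe_pi
    calc _ = (Real.pi + Real.pi : Real.Angle) + Real.pi := by abel
      _ = _ := by rw [this, zero_add]
  · rw [abs_lt]
    simp only [viewAngle]
    constructor <;> linarith [m1.1, m1.2, m2.1, m2.2, m3.1, m3.2]

/-! ### Exchange angles of segments -/

/-- The identification of the plane with the complex plane. -/
noncomputable def toComplex : Plane →ₗ[ℝ] ℂ := Complex.equivRealProdLm.symm.toLinearMap

theorem toComplex_apply (p : Plane) : toComplex p = ⟨p.1, p.2⟩ := by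
  apply Complex.ext <;> simp [toComplex]

theorem toComplex_injective : Function.Injective toComplex := Complex.equivRealProdLm.symm.injective

theorem segment_toComplex (p q : Plane) :
    segment ℝ (toComplex p) (toComplex q) = toComplex '' segment ℝ p q :=
  (image_segment ℝ toComplex.toAffineMap p q).symm

theorem toComplex_ne_zero {p : Plane} (h : p ≠ 0) : toComplex p ≠ 0 := fun h' =>
  h (toComplex_injective (h'.trans (map_zero _).symm))

theorem im_toComplex_div (u v : Plane) :
    (toComplex v / toComplex u).im = planeDet u v / Complex.normSq (toComplex u) := by
  rw [Complex.div_im]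
  simp only [toComplex_apply, planeDet]
  ring

theorem im_toComplex_div_pos {u v : Plane} (h : 0 < planeDet u v) :
    0 < (toComplex v / toComplex u).im := by
  rw [im_toComplex_div]
  refine div_pos h (Complex.normSq_pos.2 (toComplex_ne_zero ?_))
  rintro rfl
  simp [planeDet] at h

theorem cornerAngle_sum_of_clockwise {u v w : Plane} (h : ClockwiseDirs u v w) :
    cornerAngle (toComplex u) (toComplex v) + cornerAngle (toComplex v) (toComplex w) +
      cornerAngle (toComplex w) (toComplex u) = Real.pi := by
  have key : ∀ {u v w : Plane}, planeDet u v < 0 → planeDet v w < 0 →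
      cornerAngle (toComplex u) (toComplex v) + cornerAngle (toComplex v) (toComplex w) +
      cornerAngle (toComplex w) (toComplex u) = Real.pi := by
    intro u v w h1 h2
    have h1' : 0 < planeDet v u := by rw [planeDet_swap]; linarith
    have h2' : 0 < planeDet w v := by rw [planeDet_swap]; linarith
    refine cornerAngle_sum (toComplex_ne_zero ?_) (toComplex_ne_zero ?_) (toComplex_ne_zero ?_)
      (fun h => ?_) (im_toComplex_div_pos h1') (im_toComplex_div_pos h2')
    · rintro rfl; simp [planeDet] at h1
    · rintro rfl; simp [planeDet] at h1
    · rintro rfl; simp [planeDet] at h2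
    · rw [toComplex_injective h] at h1'
      linarith
  rcases h with ⟨h1, h2⟩ | ⟨h1, h2⟩ | ⟨h1, h2⟩
  · exact key h1 h2
  · rw [← key h1 h2]; ring
  · rw [← key h1 h2]; ring

/-- For two oriented segments, from `p` to `p'` and from `q` to `q'`: the variation of the angle under
which the second one is seen along the first one, minus the variation of the angle under which the
first one is seen along the second one. -/
noncomputable def exchangeAngle (p p' q q' : ℂ) : ℝ :=
  viewAngle p' q q' - viewAngle p q q' - viewAngle q' p p' + viewAngle q p p'

theorem viewAngle_swap_of_notMem {x p q : ℂ} (h : x ∉ segment ℝ p q) :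
    viewAngle x q p = -viewAngle x p q :=
  viewAngle_swap (Complex.mem_slitPlane_iff_arg.1 (div_mem_slitPlane h)).1

theorem exchangeAngle_tail_tail {v p q : ℂ} (hp : p ≠ v) (hq : q ≠ v) :
    exchangeAngle v p v q = cornerAngle (p - v) (q - v) := by
  have h1 := viewAngle_add v (q - v) (sub_ne_zero.2 hp)
  have h2 := viewAngle_add v (p - v) (sub_ne_zero.2 hq)
  rw [add_sub_cancel, add_sub_cancel] at h1 h2
  rw [exchangeAngle, viewAngle_left, viewAngle_left, h1, h2, cornerAngle]
  ring

theorem exchangeAngle_reverse_left {p p' q q' : ℂ} (h : viewAngle q p' p = -viewAngle q p p')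
    (h' : viewAngle q' p' p = -viewAngle q' p p') :
    exchangeAngle p' p q q' = -exchangeAngle p p' q q' := by
  rw [exchangeAngle, exchangeAngle, h, h']
  ring

theorem exchangeAngle_swap (p p' q q' : ℂ) :
    exchangeAngle q q' p p' = -exchangeAngle p p' q q' := by
  rw [exchangeAngle, exchangeAngle]
  ring

theorem exchangeAngle_tail_head {v p q : ℂ} (hp : p ≠ v) (hq : q ≠ v) (hpq : p ∉ segment ℝ v q) :
    exchangeAngle v p q v = -cornerAngle (p - v) (q - v) := by
  rw [exchangeAngle_swap, exchangeAngle_reverse_left (p := v) (p' := q), exchangeAngle_swap,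
    exchangeAngle_tail_tail hp hq]
  · rw [neg_neg]
  · rw [viewAngle_right, viewAngle_left, neg_zero]
  · exact viewAngle_swap_of_notMem hpq

theorem exchangeAngle_head_head {v p q : ℂ} (hp : p ≠ v) (hq : q ≠ v) (hpq : p ∉ segment ℝ v q)
    (hqp : q ∉ segment ℝ v p) :
    exchangeAngle p v q v = cornerAngle (p - v) (q - v) := by
  rw [exchangeAngle_reverse_left (p := v) (p' := p), exchangeAngle_tail_head hp hq hpq, neg_neg]
  · exact viewAngle_swap_of_notMem hqp
  · rw [viewAngle_right, viewAngle_left, neg_zero]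

namespace PerfectNetwork

variable {n : ℕ} {I : Finset (Fin n)} (N : PerfectNetwork n I)

/-! ### Flags -/

/-- The tails and the heads of the edges are all the flags. -/
noncomputable def flagEquiv : N.E ⊕ N.E ≃ NetFlag n N.W := Equiv.ofBijective _ N.flags_bijective

theorem flagEquiv_symm_src (e : N.E) : N.flagEquiv.symm (N.src e) = Sum.inl e :=
  N.flagEquiv.symm_apply_apply (Sum.inl e)

theorem flagEquiv_symm_tgt (e : N.E) : N.flagEquiv.symm (N.tgt e) = Sum.inr e :=
  N.flagEquiv.symm_apply_apply (Sum.inr e)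

theorem sum_flags {M : Type*} [AddCommMonoid M] (G : NetFlag n N.W → M) :
    ∑ a, G a = ∑ e, (G (N.src e) + G (N.tgt e)) := by
  rw [← N.flagEquiv.sum_comp, Fintype.sum_sum_type, ← Finset.sum_add_distrib]
  rfl

/-- The function on flags given by a function at the tails and a function at the heads of the edges. -/
noncomputable def flagFun {M : Type*} (f g : N.E → M) (a : NetFlag n N.W) : M :=
  Sum.elim f g (N.flagEquiv.symm a)

theorem flagFun_src {M : Type*} (f g : N.E → M) (e : N.E) : N.flagFun f g (N.src e) = f e := by
  rw [flagFun, flagEquiv_symm_src]; rfl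

theorem flagFun_tgt {M : Type*} (f g : N.E → M) (e : N.E) : N.flagFun f g (N.tgt e) = g e := by
  rw [flagFun, flagEquiv_symm_tgt]; rfl

theorem sum_flags_eq {M : Type*} [AddCommMonoid M] (G : NetFlag n N.W → M) :
    ∑ a, G a = ∑ b, G (Sum.inl b) + ∑ v, ∑ k, G (Sum.inr (v, k)) := by
  rw [Fintype.sum_sum_type, Fintype.sum_prod_type]

/-- A sum over pairs of edges and over their ends that only involves pairs of flags at a
common internal vertex. -/
theorem sum_flags_flags (G : NetFlag n N.W → NetFlag n N.W → ℝ)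
    (h0 : ∀ b c, G (Sum.inl b) c = 0) (h0' : ∀ b c, G b (Sum.inl c) = 0)
    (h : ∀ v w k l, v ≠ w → G (Sum.inr (v, k)) (Sum.inr (w, l)) = 0) :
    ∑ e, ∑ e', (G (N.src e) (N.src e') + G (N.src e) (N.tgt e') + G (N.tgt e) (N.src e') +
      G (N.tgt e) (N.tgt e')) = ∑ v, ∑ k, ∑ l, G (Sum.inr (v, k)) (Sum.inr (v, l)) := by
  have h1 : ∑ e, ∑ e', (G (N.src e) (N.src e') + G (N.src e) (N.tgt e') + G (N.tgt e) (N.src e') +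
      G (N.tgt e) (N.tgt e')) = ∑ a, ∑ b, G a b := by
    rw [N.sum_flags]
    refine Finset.sum_congr rfl fun e _ => ?_
    rw [N.sum_flags, N.sum_flags, ← Finset.sum_add_distrib]
    refine Finset.sum_congr rfl fun e' _ => ?_
    ring
  rw [h1, N.sum_flags_eq]
  simp only [h0, Finset.sum_const_zero, zero_add]
  refine Finset.sum_congr rfl fun v _ => Finset.sum_congr rfl fun k _ => ?_
  rw [N.sum_flags_eq]
  simp only [h0', Finset.sum_const_zero, zero_add]
  rw [Finset.sum_eq_single v]
  · intro w _ hw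
    exact Finset.sum_eq_zero fun l _ => h v w k l (Ne.symm hw)
  · simp

/-! ### Angles between the edges of a network -/

/-- The position of a vertex in the complex plane. -/
noncomputable def cpos (x : Fin n ⊕ N.W) : ℂ := toComplex (N.pos x)

theorem cpos_injective : Function.Injective N.cpos := toComplex_injective.comp N.pos_injective

/-- The endpoints of an edge as an unordered pair determine the edge. -/
theorem eq_of_openSegment_eq {e s : N.E}
    (h : openSegment ℝ (N.pos (N.src e).vertex) (N.pos (N.tgt e).vertex) =
      openSegment ℝ (N.pos (N.src s).vertex) (N.pos (N.tgt s).vertex)) : e = s := by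
  by_contra hne
  have h1 := N.edge_disjoint e s hne
  have hmem := N.src_add_smul_edgeVec_mem e (t := 1 / 2) (by norm_num) (by norm_num)
  exact Set.disjoint_left.1 h1 hmem (h ▸ hmem)

theorem pos_notMem_segment {e : N.E} {x : Fin n ⊕ N.W} (h : x ≠ (N.src e).vertex)
    (h' : x ≠ (N.tgt e).vertex) :
    N.pos x ∉ segment ℝ (N.pos (N.src e).vertex) (N.pos (N.tgt e).vertex) := by
  rw [← insert_endpoints_openSegment]
  simp only [Set.mem_insert_iff, not_or]
  exact ⟨fun hh => h (N.pos_injective hh), fun hh => h' (N.pos_injective hh),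
    N.vertex_notMem_edge e x⟩

theorem cpos_notMem_segment {e : N.E} {x : Fin n ⊕ N.W} (h : x ≠ (N.src e).vertex)
    (h' : x ≠ (N.tgt e).vertex) :
    N.cpos x ∉ segment ℝ (N.cpos (N.src e).vertex) (N.cpos (N.tgt e).vertex) := by
  rw [cpos, cpos, cpos, segment_toComplex]
  rintro ⟨z, hz, hz'⟩
  exact N.pos_notMem_segment h h' (toComplex_injective hz' ▸ hz)

theorem disjoint_segment {e s : N.E} (h1 : (N.src e).vertex ≠ (N.src s).vertex)
    (h2 : (N.src e).vertex ≠ (N.tgt s).vertex) (h3 : (N.tgt e).vertex ≠ (N.src s).vertex)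
    (h4 : (N.tgt e).vertex ≠ (N.tgt s).vertex) :
    Disjoint (segment ℝ (N.cpos (N.src e).vertex) (N.cpos (N.tgt e).vertex))
      (segment ℝ (N.cpos (N.src s).vertex) (N.cpos (N.tgt s).vertex)) := by
  simp only [cpos]
  rw [segment_toComplex, segment_toComplex, Set.disjoint_image_iff toComplex_injective]
  have hne : e ≠ s := fun h => h1 (by rw [h])
  rw [Set.disjoint_left]
  intro z hz hz'
  have a1 := N.pos_notMem_segment h1 h2
  have a2 := N.pos_notMem_segment h3 h4
  have a3 := N.pos_notMem_segment (Ne.symm h1) (Ne.symm h3)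
  have a4 := N.pos_notMem_segment (Ne.symm h2) (Ne.symm h4)
  have b1 := hz
  have b2 := hz'
  rw [← insert_endpoints_openSegment] at hz hz'
  rcases hz with rfl | rfl | hz
  · exact a1 b2
  · exact a2 b2
  rcases hz' with rfl | rfl | hz'
  · exact a3 b1
  · exact a4 b1
  exact Set.disjoint_left.1 (N.edge_disjoint e s hne) hz hz'

/-- The direction of an edge at one of its flags, away from the vertex. -/
noncomputable def flagDir : NetFlag n N.W → ℂ :=
  N.flagFun (fun e => N.cpos (N.tgt e).vertex - N.cpos (N.src e).vertex)
    (fun e => N.cpos (N.src e).vertex - N.cpos (N.tgt e).vertex)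

open Classical in
/-- The corner angle between two flags at the same vertex, and zero for flags at different vertices. -/
noncomputable def flagAngle (a b : NetFlag n N.W) : ℝ :=
  if a.vertex = b.vertex then cornerAngle (N.flagDir a) (N.flagDir b) else 0

/-- The exchange angle of two edges comes from their common vertex. -/
theorem exchangeAngle_edges (e s : N.E) :
    exchangeAngle (N.cpos (N.src e).vertex) (N.cpos (N.tgt e).vertex) (N.cpos (N.src s).vertex)
      (N.cpos (N.tgt s).vertex) = N.flagAngle (N.src e) (N.src s) - N.flagAngle (N.src e) (N.tgt s) -
        N.flagAngle (N.tgt e) (N.src s) + N.flagAngle (N.tgt e) (N.tgt s) := by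
  have he := N.src_vertex_ne_tgt_vertex e
  have hs := N.src_vertex_ne_tgt_vertex s
  have hce : N.cpos (N.src e).vertex ≠ N.cpos (N.tgt e).vertex := fun h => he (N.cpos_injective h)
  have hcs : N.cpos (N.src s).vertex ≠ N.cpos (N.tgt s).vertex := fun h => hs (N.cpos_injective h)
  simp only [flagAngle, flagDir, flagFun_src, flagFun_tgt]
  by_cases hes : e = s
  · subst hes
    rw [if_pos rfl, if_neg he, if_neg he.symm, if_pos rfl]
    simp [exchangeAngle, cornerAngle]
  have hpar : ¬((N.src e).vertex = (N.src s).vertex ∧ (N.tgt e).vertex = (N.tgt s).vertex) := by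
    rintro ⟨h, h'⟩
    exact hes (N.eq_of_openSegment_eq (by rw [h, h']))
  have hanti : ¬((N.src e).vertex = (N.tgt s).vertex ∧ (N.tgt e).vertex = (N.src s).vertex) := by
    rintro ⟨h, h'⟩
    exact hes (N.eq_of_openSegment_eq (by rw [h, h', openSegment_symm]))
  by_cases h1 : (N.src e).vertex = (N.src s).vertex
  · have h4 : (N.tgt e).vertex ≠ (N.tgt s).vertex := fun h => hpar ⟨h1, h⟩
    rw [if_pos h1, if_neg (h1 ▸ hs), if_neg (h1 ▸ he.symm), if_neg h4, ← h1,
      exchangeAngle_tail_tail hce.symm (h1 ▸ hcs.symm)]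
    ring
  by_cases h2 : (N.src e).vertex = (N.tgt s).vertex
  · have h3 : (N.tgt e).vertex ≠ (N.src s).vertex := fun h => hanti ⟨h2, h⟩
    have h4 : (N.tgt e).vertex ≠ (N.tgt s).vertex := fun h => he (h2.trans h.symm)
    have hmem := N.cpos_notMem_segment h3 h4
    rw [segment_symm, ← h2] at hmem
    rw [if_neg h1, if_pos h2, if_neg h3, if_neg h4, ← h2,
      exchangeAngle_tail_head hce.symm (h2 ▸ hcs) hmem]
    ring
  by_cases h3 : (N.tgt e).vertex = (N.src s).vertex
  · have h4 : (N.tgt e).vertex ≠ (N.tgt s).vertex := fun h => hs (h3.symm.trans h)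
    have hmem := N.cpos_notMem_segment (Ne.symm h2) (Ne.symm h4)
    rw [segment_symm] at hmem
    rw [if_neg h1, if_neg h2, if_pos h3, if_neg h4, ← h3, exchangeAngle_swap,
      exchangeAngle_tail_head (h3 ▸ hcs.symm) hce hmem, cornerAngle_swap]
    ring
  by_cases h4 : (N.tgt e).vertex = (N.tgt s).vertex
  · have hmem := N.cpos_notMem_segment h1 h2
    have hmem' := N.cpos_notMem_segment (Ne.symm h1) (Ne.symm h3)
    rw [segment_symm, ← h4] at hmem
    rw [segment_symm] at hmem'
    rw [if_neg h1, if_neg h2, if_neg h3, if_pos h4, ← h4,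
      exchangeAngle_head_head hce (h4 ▸ hcs) hmem hmem']
    ring
  rw [if_neg h1, if_neg h2, if_neg h3, if_neg h4, exchangeAngle,
    viewAngle_exchange (N.disjoint_segment h1 h2 h3 h4)]
  ring

end PerfectNetwork

namespace PerfectNetwork

variable {n : ℕ} {I : Finset (Fin n)} (N : PerfectNetwork n I)

/-! ### Angles at the corners of the polygon -/

/-- The angle, in `[0, π)`, between the side of the polygon that starts at the boundary vertex `b` and
the ray from `b` to a vertex (and `0` for `b` itself). -/
noncomputable def boundaryAngle (b : Fin n) (x : Fin n ⊕ N.W) : ℝ :=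
  Complex.arg ((N.cpos x - N.cpos (Sum.inl b)) / toComplex (N.disk.side (N.disk.cornerIdx b)))

theorem boundaryAngle_self (b : Fin n) : N.boundaryAngle b (Sum.inl b) = 0 := by
  simp [boundaryAngle]

theorem planeDet_side_pos_nonneg (a : Fin N.disk.numCorners) (x : Fin n ⊕ N.W) :
    0 ≤ planeDet (N.disk.side a) (N.pos x - N.disk.corner a) := by
  rcases x with c | v
  · exact N.disk.planeDet_side_nonneg a _
  · exact (N.innerPos_mem v a).le

theorem boundaryAngle_mem (b : Fin n) (x : Fin n ⊕ N.W) :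
    0 ≤ N.boundaryAngle b x ∧ N.boundaryAngle b x < Real.pi := by
  have hsub : N.cpos x - N.cpos (Sum.inl b) =
      toComplex (N.pos x - N.disk.corner (N.disk.cornerIdx b)) := (map_sub _ _ _).symm
  set a := N.disk.cornerIdx b
  have hdet := N.planeDet_side_pos_nonneg a x
  have him : 0 ≤ ((N.cpos x - N.cpos (Sum.inl b)) / toComplex (N.disk.side a)).im := by
    rw [hsub, im_toComplex_div]
    exact div_nonneg hdet (Complex.normSq_nonneg _)
  refine ⟨Complex.arg_nonneg_iff.2 him, lt_of_le_of_ne (Complex.arg_le_pi _) fun h => ?_⟩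
  rw [boundaryAngle, Complex.arg_eq_pi_iff] at h
  -- Only the corners at the ends of the side are on the line of the side.
  rcases x with c | v
  · by_cases h1 : N.disk.cornerIdx c = a
    · rw [hsub] at h
      have : N.pos (Sum.inl c) = N.disk.corner a := congrArg N.disk.corner h1
      rw [this, sub_self, map_zero, zero_div] at h
      simp at h
    by_cases h2 : N.disk.cornerIdx c = finRotate _ a
    · have : N.pos (Sum.inl c) - N.disk.corner a = N.disk.side a := by
        change N.disk.corner _ - _ = _
        rw [h2]; rfl
      rw [hsub, this, div_self (toComplex_ne_zero (N.disk.side_ne_zero a))] at h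
      norm_num at h
    · have := N.disk.planeDet_side_pos h1 h2
      rw [hsub] at h
      exact (im_toComplex_div_pos this).ne' h.2
  · rw [hsub] at h
    exact (im_toComplex_div_pos (N.innerPos_mem v a)).ne' h.2

theorem viewAngle_boundary (b : Fin n) {x y : Fin n ⊕ N.W} (hx : x ≠ Sum.inl b) (hy : y ≠ Sum.inl b) :
    viewAngle (N.cpos (Sum.inl b)) (N.cpos x) (N.cpos y) =
      N.boundaryAngle b y - N.boundaryAngle b x := by
  have hs := toComplex_ne_zero (N.disk.side_ne_zero (N.disk.cornerIdx b))
  have hx' : N.cpos x ≠ N.cpos (Sum.inl b) := fun h => hx (N.cpos_injective h)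
  have hy' : N.cpos y ≠ N.cpos (Sum.inl b) := fun h => hy (N.cpos_injective h)
  have m1 := N.boundaryAngle_mem b x
  have m2 := N.boundaryAngle_mem b y
  apply eq_of_coe_angle_eq
  · rw [coe_viewAngle hx' hy', Real.Angle.coe_sub, boundaryAngle, boundaryAngle,
      Complex.arg_div_coe_angle (sub_ne_zero.2 hx') hs,
      Complex.arg_div_coe_angle (sub_ne_zero.2 hy') hs]
    abel
  · have h1 := Complex.arg_le_pi ((N.cpos y - N.cpos (Sum.inl b)) / (N.cpos x - N.cpos (Sum.inl b)))
    have h2 := Complex.neg_pi_lt_arg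
      ((N.cpos y - N.cpos (Sum.inl b)) / (N.cpos x - N.cpos (Sum.inl b)))
    rw [abs_lt, viewAngle]
    constructor <;> linarith [m1.1, m1.2, m2.1, m2.2]

/-- The difference of the angles of the chord between two boundary vertices at its two ends. -/
noncomputable def chordAngle (a b : Fin n) : ℝ :=
  N.boundaryAngle a (Sum.inl b) - N.boundaryAngle b (Sum.inl a)

theorem chordAngle_swap (a b : Fin n) : N.chordAngle b a = -N.chordAngle a b := by
  rw [chordAngle, chordAngle]; ring

theorem chordAngle_self (a : Fin n) : N.chordAngle a a = 0 := sub_self _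

theorem chordAngle_triangle {a b c : Fin n} (hab : a < b) (hbc : b < c) :
    N.chordAngle a b + N.chordAngle b c + N.chordAngle c a = -Real.pi := by
  have ne : ∀ {x y : Fin n}, x ≠ y → (Sum.inl x : Fin n ⊕ N.W) ≠ Sum.inl y :=
    fun h h' => h (Sum.inl_injective h')
  have hac := hab.trans hbc
  have cne : ∀ {x y : Fin n}, x ≠ y → N.cpos (Sum.inl x) ≠ N.cpos (Sum.inl y) :=
    fun h h' => ne h (N.cpos_injective h')
  have hpos := N.disk.corner_convex _ _ _ (N.disk.cornerIdx_strictMono hab)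
    (N.disk.cornerIdx_strictMono hbc)
  have him : ∀ {x y z : Fin n}, 0 < planeDet (N.pos (Sum.inl y) - N.pos (Sum.inl x))
      (N.pos (Sum.inl z) - N.pos (Sum.inl x)) →
      0 < ((N.cpos (Sum.inl z) - N.cpos (Sum.inl x)) /
        (N.cpos (Sum.inl y) - N.cpos (Sum.inl x))).im := by
    intro x y z h
    have := im_toComplex_div_pos h
    rwa [map_sub, map_sub] at this
  have h := viewAngle_triangle (cne hab.ne) (cne hbc.ne) (cne hac.ne') (him hpos)
    (him (by simp only [planeDet, Prod.fst_sub, Prod.snd_sub, pos, PolygonalDisk.position,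
      Sum.elim_inl] at hpos ⊢; linarith))
    (him (by simp only [planeDet, Prod.fst_sub, Prod.snd_sub, pos, PolygonalDisk.position,
      Sum.elim_inl] at hpos ⊢; linarith))
  rw [N.viewAngle_boundary a (ne hab.ne') (ne hac.ne'), N.viewAngle_boundary b (ne hbc.ne') (ne hab.ne),
    N.viewAngle_boundary c (ne hac.ne) (ne hbc.ne)] at h
  simp only [chordAngle]
  linarith

theorem chordAngle_cocycle (a b c : Fin n) :
    N.chordAngle a b + N.chordAngle b c + N.chordAngle c a =
      -Real.pi * (ordSign a b + ordSign b c + ordSign c a) := by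
  have lt : ∀ {a b c : Fin n}, a < b → b < c → N.chordAngle a b + N.chordAngle b c +
      N.chordAngle c a = -Real.pi * (ordSign a b + ordSign b c + ordSign c a) := by
    intro a b c h h'
    rw [N.chordAngle_triangle h h']
    simp [ordSign, h, h', h.trans h', (h.trans h').not_gt]
  have e1 := N.chordAngle_swap a b
  have e2 := N.chordAngle_swap b c
  have e3 := N.chordAngle_swap c a
  have s1 := ordSign_swap a b
  have s2 := ordSign_swap b c
  have s3 := ordSign_swap c a
  rcases eq_or_ne a b with rfl | h1
  · rw [chordAngle_self, ordSign_self, s3, e3]; ring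
  rcases eq_or_ne b c with rfl | h2
  · rw [chordAngle_self, ordSign_self, s1, e1]; ring
  rcases eq_or_ne c a with rfl | h3
  · rw [chordAngle_self, ordSign_self, s2, e2]; ring
  rcases lt_or_gt_of_ne h1 with h1 | h1 <;> rcases lt_or_gt_of_ne h2 with h2 | h2 <;>
    rcases lt_or_gt_of_ne h3 with h3 | h3
  · exact absurd (h1.trans (h2.trans h3)) (lt_irrefl _)
  · exact lt h1 h2
  · linarith [lt h3 h1]
  · have := lt h3 h2
    rw [e1, e2, e3, s1, s2, s3] at this
    linarith
  · linarith [lt h2 h3]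
  · have := lt h1 h3
    rw [e1, e2, e3, s1, s2, s3] at this
    linarith
  · have := lt h2 h1
    rw [e1, e2, e3, s1, s2, s3] at this
    linarith
  · exact absurd (h1.trans (h3.trans h2)) (lt_irrefl _)

theorem chordAngle_eq_sCross {i j i' j' : Fin n} (h₁ : i ≠ j) (h₂ : i ≠ j') (h₃ : i' ≠ j)
    (h₄ : i' ≠ j') : N.chordAngle j j' - N.chordAngle j i' - N.chordAngle i j' + N.chordAngle i i' =
      2 * Real.pi * sCross i j i' j' := by
  have c1 := N.chordAngle_cocycle i j j'
  have c2 := N.chordAngle_cocycle i j i'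
  have e1 := N.chordAngle_swap i j'
  have e2 := N.chordAngle_swap i i'
  have s1 := ordSign_swap i j'
  have s2 := ordSign_swap i i'
  rw [sCross_eq h₁ h₂ h₃ h₄]
  rw [e1, s1] at c1
  rw [e2, s2] at c2
  linear_combination c1 - c2

/-! ### Flows -/

/-- A function on the edges is a unit flow from `b_i` to `b_j` if its pairing with the coboundary of any
function on the vertices is the difference of the values at `b_j` and at `b_i`. -/
def IsUnitFlow (i j : Fin n) (f : N.E → ℝ) : Prop :=
  ∀ g : Fin n ⊕ N.W → ℝ, ∑ e, f e * (g (N.tgt e).vertex - g (N.src e).vertex) =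
    g (Sum.inl j) - g (Sum.inl i)

/-- The contribution of an internal vertex to the pairing of two flows. -/
noncomputable def vertexPairing (f f' : N.E → ℝ) (v : N.W) : ℝ :=
  N.flagFun f f (Sum.inr (v, 1)) * N.flagFun f' f' (Sum.inr (v, 2)) -
    N.flagFun f f (Sum.inr (v, 2)) * N.flagFun f' f' (Sum.inr (v, 1))

namespace IsUnitFlow

variable {N} {i j i' j' : Fin n} {f f' : N.E → ℝ}

theorem sum_flagFun (hf : N.IsUnitFlow i j f) (v : N.W) :
    ∑ k, N.flagFun (-f) f (Sum.inr (v, k)) = 0 := by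
  classical
  have h := hf (fun x => if x = Sum.inr v then 1 else 0)
  have h2 : ∑ a : NetFlag n N.W, N.flagFun (-f) f a * (if a.vertex = Sum.inr v then 1 else 0) = 0 := by
    rw [N.sum_flags]
    simp only [flagFun_src, flagFun_tgt, Pi.neg_apply]
    rw [if_neg Sum.inl_ne_inr, if_neg Sum.inl_ne_inr, sub_zero] at h
    exact (Finset.sum_congr rfl fun e _ => by ring).trans h
  rw [N.sum_flags_eq, Finset.sum_eq_zero, zero_add, Finset.sum_eq_single v] at h2
  · simpa [NetFlag.vertex] using h2
  · intro w _ hw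
    simp [NetFlag.vertex, hw]
  · simp
  · simp [NetFlag.vertex]

theorem sum_white (hf : N.IsUnitFlow i j f) {v : N.W} (hv : N.white v = true) :
    N.flagFun f f (Sum.inr (v, 0)) =
      N.flagFun f f (Sum.inr (v, 1)) + N.flagFun f f (Sum.inr (v, 2)) := by
  obtain ⟨⟨a, ha⟩, ⟨b, hb⟩, ⟨c, hc⟩⟩ := N.white_spec v hv
  have h := hf.sum_flagFun v
  rw [Fin.sum_univ_three, ← ha, ← hb, ← hc] at h
  rw [← ha, ← hb, ← hc]
  simp only [flagFun_src, flagFun_tgt, Pi.neg_apply] at h ⊢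
  linarith

theorem sum_black (hf : N.IsUnitFlow i j f) {v : N.W} (hv : N.white v = false) :
    N.flagFun f f (Sum.inr (v, 0)) =
      N.flagFun f f (Sum.inr (v, 1)) + N.flagFun f f (Sum.inr (v, 2)) := by
  obtain ⟨⟨a, ha⟩, ⟨b, hb⟩, ⟨c, hc⟩⟩ := N.black_spec v hv
  have h := hf.sum_flagFun v
  rw [Fin.sum_univ_three, ← ha, ← hb, ← hc] at h
  rw [← ha, ← hb, ← hc]
  simp only [flagFun_src, flagFun_tgt, Pi.neg_apply] at h ⊢
  linarith

theorem eq_of_src (hf : N.IsUnitFlow i j f) {b : Fin n} {e : N.E} (he : N.src e = Sum.inl b) :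
    f e = (if b = i then 1 else 0) - (if b = j then 1 else 0) := by
  classical
  have h := hf (fun x => if x = Sum.inl b then 1 else 0)
  simp only [N.vertex_eq_inl, Sum.inl.injEq] at h
  rw [Finset.sum_eq_single e] at h
  · rw [if_pos he, if_neg (fun h' => N.src_ne_tgt e e (he.trans h'.symm))] at h
    simp only [eq_comm (a := b)]
    linarith
  · intro s _ hs
    rw [if_neg (fun h' => N.src_ne_tgt e s (he.trans h'.symm)),
      if_neg (fun h' => hs (N.src_injective (h'.trans he.symm)))]
    simp
  · simp

theorem eq_of_tgt (hf : N.IsUnitFlow i j f) {b : Fin n} {e : N.E} (he : N.tgt e = Sum.inl b) :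
    f e = (if b = j then 1 else 0) - (if b = i then 1 else 0) := by
  classical
  have h := hf (fun x => if x = Sum.inl b then 1 else 0)
  simp only [N.vertex_eq_inl, Sum.inl.injEq] at h
  rw [Finset.sum_eq_single e] at h
  · rw [if_pos he, if_neg (fun h' => N.src_ne_tgt e e (h'.trans he.symm))] at h
    simp only [eq_comm (a := b)]
    linarith
  · intro s _ hs
    rw [if_neg (fun h' => hs (N.tgt_injective (h'.trans he.symm))),
      if_neg (fun h' => N.src_ne_tgt s e (h'.trans he.symm))]
    simp
  · simp

end IsUnitFlow

/-- The correction term at the edge of a boundary vertex, for the angles seen from it. -/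
noncomputable def boundaryCorrection (b : Fin n) : ℝ :=
  N.flagFun (fun e => -N.boundaryAngle b (N.tgt e).vertex) (fun e => N.boundaryAngle b (N.src e).vertex)
    (Sum.inl b)

/-- The angle under which a flow is seen from a source. -/
theorem IsUnitFlow.sum_viewAngle_src {N : PerfectNetwork n I} {i j : Fin n} {f : N.E → ℝ}
    (hf : N.IsUnitFlow i j f) {b : Fin n} (hb : b ∈ I) (hj : j ∉ I) :
    ∑ e, f e * viewAngle (N.cpos (Sum.inl b)) (N.cpos (N.src e).vertex) (N.cpos (N.tgt e).vertex) =
      N.boundaryAngle b (Sum.inl j) - N.boundaryAngle b (Sum.inl i) +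
        if b = i then N.boundaryCorrection b else 0 := by
  obtain ⟨a, ha⟩ := N.exists_src_eq hb
  have hbj : b ≠ j := fun h => hj (h ▸ hb)
  have hc : N.boundaryCorrection b = -N.boundaryAngle b (N.tgt a).vertex := by
    rw [boundaryCorrection, ← ha, flagFun_src]
  rw [← hf (N.boundaryAngle b), ← sub_eq_iff_eq_add', ← Finset.sum_sub_distrib,
    Finset.sum_eq_single a]
  · rw [hf.eq_of_src ha, ha]
    simp only [NetFlag.vertex, viewAngle_left, boundaryAngle_self, hc, if_neg hbj]
    split_ifs <;> ring
  · intro e _ he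
    rw [N.viewAngle_boundary b, sub_self]
    · exact fun h => he (N.src_injective ((N.vertex_eq_inl.1 h).trans ha.symm))
    · exact fun h => N.src_ne_tgt a e (ha.trans (N.vertex_eq_inl.1 h).symm)
  · simp

/-- The angle under which a flow is seen from a sink. -/
theorem IsUnitFlow.sum_viewAngle_tgt {N : PerfectNetwork n I} {i j : Fin n} {f : N.E → ℝ}
    (hf : N.IsUnitFlow i j f) {b : Fin n} (hb : b ∉ I) (hi : i ∈ I) :
    ∑ e, f e * viewAngle (N.cpos (Sum.inl b)) (N.cpos (N.src e).vertex) (N.cpos (N.tgt e).vertex) =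
      N.boundaryAngle b (Sum.inl j) - N.boundaryAngle b (Sum.inl i) +
        if b = j then N.boundaryCorrection b else 0 := by
  obtain ⟨a, ha⟩ := N.exists_tgt_eq hb
  have hbi : b ≠ i := fun h => hb (h ▸ hi)
  have hc : N.boundaryCorrection b = N.boundaryAngle b (N.src a).vertex := by
    rw [boundaryCorrection, ← ha, flagFun_tgt]
  rw [← hf (N.boundaryAngle b), ← sub_eq_iff_eq_add', ← Finset.sum_sub_distrib,
    Finset.sum_eq_single a]
  · rw [hf.eq_of_tgt ha, ha]
    simp only [NetFlag.vertex, viewAngle_right, boundaryAngle_self, hc, if_neg hbi]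
    split_ifs <;> ring
  · intro e _ he
    rw [N.viewAngle_boundary b, sub_self]
    · exact fun h => N.src_ne_tgt e a ((N.vertex_eq_inl.1 h).trans ha.symm)
    · exact fun h => he (N.tgt_injective ((N.vertex_eq_inl.1 h).trans ha.symm))
  · simp

/-- The sum of the exchange angles of two flows, evaluated at the boundary. -/
theorem sum_exchangeAngle_boundary {i j i' j' : Fin n} {f f' : N.E → ℝ} (hf : N.IsUnitFlow i j f)
    (hf' : N.IsUnitFlow i' j' f') (hi : i ∈ I) (hj : j ∉ I) (hi' : i' ∈ I) (hj' : j' ∉ I) :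
    ∑ e, ∑ s, f e * f' s * exchangeAngle (N.cpos (N.src e).vertex) (N.cpos (N.tgt e).vertex)
      (N.cpos (N.src s).vertex) (N.cpos (N.tgt s).vertex) = 2 * Real.pi * sCross i j i' j' := by
  have ne : ∀ {a b : Fin n}, a ∈ I → b ∉ I → a ≠ b := fun ha hb h => hb (h ▸ ha)
  have h1 : ∑ e, ∑ s, f e * f' s * (viewAngle (N.cpos (N.tgt e).vertex) (N.cpos (N.src s).vertex)
      (N.cpos (N.tgt s).vertex) - viewAngle (N.cpos (N.src e).vertex) (N.cpos (N.src s).vertex)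
      (N.cpos (N.tgt s).vertex)) =
      ∑ s, f' s * viewAngle (N.cpos (Sum.inl j)) (N.cpos (N.src s).vertex) (N.cpos (N.tgt s).vertex) -
      ∑ s, f' s * viewAngle (N.cpos (Sum.inl i)) (N.cpos (N.src s).vertex)
        (N.cpos (N.tgt s).vertex) := by
    rw [Finset.sum_comm, ← Finset.sum_sub_distrib]
    refine Finset.sum_congr rfl fun s _ => ?_
    rw [← mul_sub, ← hf (fun x => viewAngle (N.cpos x) (N.cpos (N.src s).vertex)
      (N.cpos (N.tgt s).vertex)), Finset.mul_sum]
    exact Finset.sum_congr rfl fun e _ => by ring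
  have h2 : ∑ e, ∑ s, f e * f' s * (viewAngle (N.cpos (N.tgt s).vertex) (N.cpos (N.src e).vertex)
      (N.cpos (N.tgt e).vertex) - viewAngle (N.cpos (N.src s).vertex) (N.cpos (N.src e).vertex)
      (N.cpos (N.tgt e).vertex)) =
      ∑ e, f e * viewAngle (N.cpos (Sum.inl j')) (N.cpos (N.src e).vertex) (N.cpos (N.tgt e).vertex) -
      ∑ e, f e * viewAngle (N.cpos (Sum.inl i')) (N.cpos (N.src e).vertex)
        (N.cpos (N.tgt e).vertex) := by
    rw [← Finset.sum_sub_distrib]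
    refine Finset.sum_congr rfl fun e _ => ?_
    rw [← mul_sub, ← hf' (fun x => viewAngle (N.cpos x) (N.cpos (N.src e).vertex)
      (N.cpos (N.tgt e).vertex)), Finset.mul_sum]
    exact Finset.sum_congr rfl fun e _ => by ring
  rw [hf'.sum_viewAngle_tgt hj hi', hf'.sum_viewAngle_src hi hj'] at h1
  rw [hf.sum_viewAngle_tgt hj' hi, hf.sum_viewAngle_src hi' hj] at h2
  rw [← N.chordAngle_eq_sCross (ne hi hj) (ne hi hj') (ne hi' hj) (ne hi' hj')]
  have hjj : (if j = j' then N.boundaryCorrection j else 0) =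
      if j' = j then N.boundaryCorrection j' else 0 := by
    by_cases h : j = j'
    · rw [h]
    · rw [if_neg h, if_neg (Ne.symm h)]
  have hii : (if i = i' then N.boundaryCorrection i else 0) =
      if i' = i then N.boundaryCorrection i' else 0 := by
    by_cases h : i = i'
    · rw [h]
    · rw [if_neg h, if_neg (Ne.symm h)]
  rw [hjj, hii] at h1
  have h3 := congrArg₂ (· - ·) h1 h2
  simp only [← Finset.sum_sub_distrib] at h3
  simp only [chordAngle]
  refine Eq.trans (Finset.sum_congr rfl fun e _ => Finset.sum_congr rfl fun s _ => ?_)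
    (h3.trans ?_)
  · rw [exchangeAngle]; ring
  · ring

/-- The sum of the exchange angles of two flows, evaluated at the internal vertices. -/
theorem sum_exchangeAngle_vertex {i j i' j' : Fin n} {f f' : N.E → ℝ} (hf : N.IsUnitFlow i j f)
    (hf' : N.IsUnitFlow i' j' f') :
    ∑ e, ∑ s, f e * f' s * exchangeAngle (N.cpos (N.src e).vertex) (N.cpos (N.tgt e).vertex)
      (N.cpos (N.src s).vertex) (N.cpos (N.tgt s).vertex) =
      Real.pi * ∑ v, N.vertexPairing f f' v := by
  set G : NetFlag n N.W → NetFlag n N.W → ℝ := fun a b =>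
    N.flagFun (-f) f a * N.flagFun (-f') f' b * N.flagAngle a b with hG
  have h := N.sum_flags_flags G ?_ ?_ ?_
  · have e1 : ∑ e, ∑ s, f e * f' s * exchangeAngle (N.cpos (N.src e).vertex) (N.cpos (N.tgt e).vertex)
        (N.cpos (N.src s).vertex) (N.cpos (N.tgt s).vertex) = ∑ e, ∑ s, (G (N.src e) (N.src s) +
          G (N.src e) (N.tgt s) + G (N.tgt e) (N.src s) + G (N.tgt e) (N.tgt s)) := by
      refine Finset.sum_congr rfl fun e _ => Finset.sum_congr rfl fun s _ => ?_
      simp only [hG, N.exchangeAngle_edges, flagFun_src, flagFun_tgt, Pi.neg_apply]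
      ring
    rw [e1, h, Finset.mul_sum]
    refine Finset.sum_congr rfl fun v _ => ?_
    have s1 := hf.sum_flagFun v
    have s2 := hf'.sum_flagFun v
    simp only [Fin.sum_univ_three, hG, flagAngle, NetFlag.vertex, if_true] at s1 s2 ⊢
    have sw := fun k l => cornerAngle_swap (N.flagDir (Sum.inr (v, k))) (N.flagDir (Sum.inr (v, l)))
    have self : ∀ k, cornerAngle (N.flagDir (Sum.inr (v, k))) (N.flagDir (Sum.inr (v, k))) = 0 :=
      fun k => sub_self _
    have key : cornerAngle (N.flagDir (Sum.inr (v, 0))) (N.flagDir (Sum.inr (v, 1))) +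
        cornerAngle (N.flagDir (Sum.inr (v, 1))) (N.flagDir (Sum.inr (v, 2))) +
        cornerAngle (N.flagDir (Sum.inr (v, 2))) (N.flagDir (Sum.inr (v, 0))) = Real.pi ∧
        N.vertexPairing f f' v = N.flagFun (-f) f (Sum.inr (v, 1)) *
          N.flagFun (-f') f' (Sum.inr (v, 2)) - N.flagFun (-f) f (Sum.inr (v, 2)) *
          N.flagFun (-f') f' (Sum.inr (v, 1)) := by
      have dir : ∀ x, N.cpos x - N.cpos (Sum.inr v) = toComplex (N.pos x - N.innerPos v) := fun x =>
        (map_sub toComplex _ _).symm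
      rcases hw : N.white v with _ | _
      · obtain ⟨⟨a, ha⟩, ⟨b, hb⟩, ⟨c, hc⟩⟩ := N.black_spec v hw
        refine ⟨?_, ?_⟩
        · rw [← cornerAngle_sum_of_clockwise (N.black_clockwise v a b c ha hb hc)]
          rw [← ha, ← hb, ← hc]
          simp only [flagDir, flagFun_src, flagFun_tgt]
          rw [ha, hb, hc]
          simp only [NetFlag.vertex, dir]
          rfl
        · rw [vertexPairing, ← hb, ← hc]
          simp only [flagFun_tgt]
      · obtain ⟨⟨a, ha⟩, ⟨b, hb⟩, ⟨c, hc⟩⟩ := N.white_spec v hw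
        refine ⟨?_, ?_⟩
        · rw [← cornerAngle_sum_of_clockwise (N.white_clockwise v a b c ha hb hc)]
          rw [← ha, ← hb, ← hc]
          simp only [flagDir, flagFun_src, flagFun_tgt]
          rw [ha, hb, hc]
          simp only [NetFlag.vertex, dir]
          rfl
        · rw [vertexPairing, ← hb, ← hc]
          simp only [flagFun_src, Pi.neg_apply]
          ring
    rw [key.2, ← key.1, self, self, self, sw 0 1, sw 1 2, sw 2 0]
    have t1 : N.flagFun (-f) f (Sum.inr (v, 0)) =
      -N.flagFun (-f) f (Sum.inr (v, 1)) - N.flagFun (-f) f (Sum.inr (v, 2)) := by linarith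
    have t2 : N.flagFun (-f') f' (Sum.inr (v, 0)) =
      -N.flagFun (-f') f' (Sum.inr (v, 1)) - N.flagFun (-f') f' (Sum.inr (v, 2)) := by linarith
    rw [t1, t2]
    ring
  · intro b c
    simp only [hG, flagAngle]
    split_ifs with hb
    · have : c = Sum.inl b := N.vertex_eq_inl.1 hb.symm
      rw [this]
      simp [cornerAngle]
    · ring
  · intro b c
    simp only [hG, flagAngle]
    split_ifs with hb
    · have : b = Sum.inl c := N.vertex_eq_inl.1 hb
      rw [this]
      simp [cornerAngle]
    · ring
  · intro v w k l hvw
    simp [hG, flagAngle, NetFlag.vertex, hvw]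

/-- The pairing of two unit flows at the internal vertices only depends on the ends of the flows. -/
theorem sum_vertexPairing {i j i' j' : Fin n} {f f' : N.E → ℝ} (hf : N.IsUnitFlow i j f)
    (hf' : N.IsUnitFlow i' j' f') (hi : i ∈ I) (hj : j ∉ I) (hi' : i' ∈ I) (hj' : j' ∉ I) :
    ∑ v, N.vertexPairing f f' v = 2 * sCross i j i' j' := by
  have h := N.sum_exchangeAngle_boundary hf hf' hi hj hi' hj'
  rw [N.sum_exchangeAngle_vertex hf hf'] at h
  have := Real.pi_pos
  apply mul_left_cancel₀ this.ne'
  linarith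

/-- The bracket of edge weights, paired with two flows. -/
theorem sum_edgeCoeff (P : UniversalParams) {i j i' j' : Fin n} {f f' : N.E → ℝ}
    (hf : N.IsUnitFlow i j f) (hf' : N.IsUnitFlow i' j' f') :
    ∑ e, ∑ s, f e * f' s * N.edgeCoeff P e s = ∑ v, (if N.white v then P.a23 + P.a13 - P.a12
      else P.b23 + P.b13 - P.b12) * N.vertexPairing f f' v := by
  set G : NetFlag n N.W → NetFlag n N.W → ℝ := fun a b =>
    N.flagFun f f a * N.flagFun f' f' b * N.flagCoeff P a b with hG
  have h := N.sum_flags_flags G (fun b c => by simp [hG, flagCoeff])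
    (fun b c => by simp [hG, flagCoeff]) (fun v w k l hvw => by simp [hG, flagCoeff, hvw])
  have e1 : ∑ e, ∑ s, f e * f' s * N.edgeCoeff P e s = ∑ e, ∑ s, (G (N.src e) (N.src s) +
        G (N.src e) (N.tgt s) + G (N.tgt e) (N.src s) + G (N.tgt e) (N.tgt s)) := by
    refine Finset.sum_congr rfl fun e _ => Finset.sum_congr rfl fun s _ => ?_
    simp only [hG, edgeCoeff, flagFun_src, flagFun_tgt]
    ring
  rw [e1, h]
  refine Finset.sum_congr rfl fun v _ => ?_
  have s : ∀ {i j : Fin n} {f : N.E → ℝ}, N.IsUnitFlow i j f → N.flagFun f f (Sum.inr (v, 0)) =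
      N.flagFun f f (Sum.inr (v, 1)) + N.flagFun f f (Sum.inr (v, 2)) := by
    intro i j f hf
    rcases hw : N.white v with _ | _
    · exact hf.sum_black hw
    · exact hf.sum_white hw
  simp only [Fin.sum_univ_three, hG, flagCoeff, vertexPairing, if_true, s hf, s hf']
  split_ifs <;> simp [skewArray] <;> ring

end PerfectNetwork

/-- The coefficients of a product of logarithmic derivatives. -/
theorem coeff_eulerDeriv_mul {E : Type*} [DecidableEq E] (e s : E) (f g : MvPowerSeries E ℝ)
    (m : E →₀ ℕ) :
    MvPowerSeries.coeff m (eulerDeriv e f * eulerDeriv s g) =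
      ∑ p ∈ Finset.HasAntidiagonal.antidiagonal m, (p.1 e * p.2 s : ℝ) *
        (MvPowerSeries.coeff p.1 f * MvPowerSeries.coeff p.2 g) := by
  rw [MvPowerSeries.coeff_mul]
  refine Finset.sum_congr rfl fun p _ => ?_
  rw [coeff_eulerDeriv, coeff_eulerDeriv]
  ring

namespace PerfectNetwork

variable {n : ℕ} {I : Finset (Fin n)} (N : PerfectNetwork n I)

/-! ### The bracket of boundary measurements as power series -/

theorem sum_map_sub_of_isChain {x y : Fin n ⊕ N.W} (g : Fin n ⊕ N.W → ℝ) (P : List N.E)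
    (hP : P.IsChain (fun e e' => (N.tgt e).vertex = (N.src e').vertex))
    (hx : P.head?.map (fun e => (N.src e).vertex) = some x)
    (hy : P.getLast?.map (fun e => (N.tgt e).vertex) = some y) :
    (P.map fun e => g (N.tgt e).vertex - g (N.src e).vertex).sum = g y - g x := by
  induction P generalizing x with
  | nil => simp at hx
  | cons e P ih =>
    obtain rfl : (N.src e).vertex = x := by simpa using hx
    cases P with
    | nil =>
      obtain rfl : (N.tgt e).vertex = y := by simpa using hy
      simp
    | cons e' P =>
      rw [List.isChain_cons_cons] at hP
      rw [List.getLast?_cons_cons] at hy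
      have h := ih (x := (N.src e').vertex) hP.2 (by simp) hy
      rw [List.map_cons, List.sum_cons, h, hP.1]
      ring

/-- The exponents of the monomials of a boundary measurement are unit flows. -/
theorem isUnitFlow_of_coeff_ne_zero {i j : Fin n} {m : N.E →₀ ℕ}
    (h : MvPowerSeries.coeff m (N.boundarySeries i j) ≠ 0) : N.IsUnitFlow i j (fun e => (m e : ℝ)) := by
  classical
  change (∑ P ∈ _ with N.IsPath i j P, N.pathSign i j P) ≠ 0 at h
  obtain ⟨P, hP, -⟩ := Finset.exists_ne_zero_of_sum_ne_zero h
  rw [Finset.mem_filter] at hP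
  have hm : Finsupp.toMultiset m = (P : Multiset N.E) := mem_lists_toMultiset.1 (by convert hP.1)
  obtain ⟨h1, h2, h3⟩ := hP.2
  intro g
  rw [← N.sum_map_sub_of_isChain g P h1 h2 h3]
  set φ : N.E → ℝ := fun e => g (N.tgt e).vertex - g (N.src e).vertex with hφ
  have : (P.map φ).sum = ((P : Multiset N.E).map φ).sum := by
    rw [Multiset.map_coe, Multiset.sum_coe]
  rw [this, Finset.sum_multiset_map_count]
  symm
  refine Eq.trans (Finset.sum_subset (Finset.subset_univ _) fun e _ he => ?_)
    (Finset.sum_congr rfl fun e _ => ?_)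
  · rw [Multiset.count_eq_zero.2 (fun h' => he (Multiset.mem_toFinset.2 h')), zero_smul]
  · rw [← hm, Finsupp.count_toMultiset, nsmul_eq_mul]

/-- The boundary measurement with real coefficients. -/
noncomputable def realSeries (i j : Fin n) : MvPowerSeries N.E ℝ :=
  MvPowerSeries.map (Int.castRingHom ℝ) (N.boundarySeries i j)

theorem isUnitFlow_of_coeff_realSeries_ne_zero {i j : Fin n} {m : N.E →₀ ℕ}
    (h : MvPowerSeries.coeff m (N.realSeries i j) ≠ 0) : N.IsUnitFlow i j (fun e => (m e : ℝ)) := by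
  apply N.isUnitFlow_of_coeff_ne_zero
  intro h'
  rw [realSeries, MvPowerSeries.coeff_map, h', map_zero] at h
  exact h rfl

/-- The edge of a flag. -/
noncomputable def flagEdge (a : NetFlag n N.W) : N.E := N.flagFun id id a

theorem flagEdge_src (e : N.E) : N.flagEdge (N.src e) = e := N.flagFun_src id id e

theorem flagEdge_tgt (e : N.E) : N.flagEdge (N.tgt e) = e := N.flagFun_tgt id id e

theorem flagFun_eq (f : N.E → ℝ) (a : NetFlag n N.W) : N.flagFun f f a = f (N.flagEdge a) := by
  rw [flagEdge, flagFun, flagFun]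
  rcases N.flagEquiv.symm a with e | e <;> rfl

section VertexBracket

variable {R : Type*} [CommRing R]

/-- The antisymmetrized product of the logarithmic derivatives of two series along the second and the
third edge of a vertex. -/
noncomputable def vertexBracket (v : N.W) (f g : MvPowerSeries N.E R) : MvPowerSeries N.E R :=
  eulerDeriv (N.flagEdge (Sum.inr (v, 1))) f * eulerDeriv (N.flagEdge (Sum.inr (v, 2))) g -
    eulerDeriv (N.flagEdge (Sum.inr (v, 2))) f * eulerDeriv (N.flagEdge (Sum.inr (v, 1))) g

theorem vertexBracket_map {S : Type*} [CommRing S] (h : R →+* S) (v : N.W)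
    (f g : MvPowerSeries N.E R) :
    N.vertexBracket v (MvPowerSeries.map h f) (MvPowerSeries.map h g) =
      MvPowerSeries.map h (N.vertexBracket v f g) := by
  simp only [vertexBracket, eulerDeriv_map, map_sub, map_mul]

end VertexBracket

theorem coeff_vertexBracket (v : N.W) (f g : MvPowerSeries N.E ℝ) (m : N.E →₀ ℕ) :
    MvPowerSeries.coeff m (N.vertexBracket v f g) =
      ∑ p ∈ Finset.HasAntidiagonal.antidiagonal m, N.vertexPairing (fun e => (p.1 e : ℝ)) (fun e => (p.2 e : ℝ)) v *
        (MvPowerSeries.coeff p.1 f * MvPowerSeries.coeff p.2 g) := by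
  rw [vertexBracket, map_sub, coeff_eulerDeriv_mul, coeff_eulerDeriv_mul, ← Finset.sum_sub_distrib]
  refine Finset.sum_congr rfl fun p _ => ?_
  simp only [vertexPairing, flagFun_eq]
  ring

theorem sum_smul_vertexBracket_eq (P : UniversalParams) (i j i' j' : Fin n) :
    ∑ e, ∑ s, N.edgeCoeff P e s • (eulerDeriv e (N.realSeries i j) * eulerDeriv s (N.realSeries i' j')) =
      ∑ v, (if N.white v then P.a23 + P.a13 - P.a12 else P.b23 + P.b13 - P.b12) •
        N.vertexBracket v (N.realSeries i j) (N.realSeries i' j') := by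
  ext m
  simp only [map_sum, MvPowerSeries.coeff_smul, coeff_eulerDeriv_mul, coeff_vertexBracket,
    Finset.mul_sum]
  have c1 : ∀ F : N.E → N.E → (N.E →₀ ℕ) × (N.E →₀ ℕ) → ℝ,
      ∑ e, ∑ s, ∑ p ∈ Finset.HasAntidiagonal.antidiagonal m, F e s p =
        ∑ p ∈ Finset.HasAntidiagonal.antidiagonal m, ∑ e, ∑ s, F e s p := by
    intro F
    rw [Finset.sum_congr rfl fun e _ => Finset.sum_comm]
    exact Finset.sum_comm
  rw [c1, Finset.sum_comm (s := Finset.univ) (t := Finset.HasAntidiagonal.antidiagonal m)]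
  refine Finset.sum_congr rfl fun p _ => ?_
  by_cases h1 : MvPowerSeries.coeff p.1 (N.realSeries i j) = 0
  · simp [h1]
  by_cases h2 : MvPowerSeries.coeff p.2 (N.realSeries i' j') = 0
  · simp [h2]
  have h := N.sum_edgeCoeff P (N.isUnitFlow_of_coeff_realSeries_ne_zero h1)
    (N.isUnitFlow_of_coeff_realSeries_ne_zero h2)
  have h3 := congrArg (fun x => x * (MvPowerSeries.coeff p.1 (N.realSeries i j) *
    MvPowerSeries.coeff p.2 (N.realSeries i' j'))) h
  simp only [Finset.sum_mul] at h3
  refine Eq.trans ?_ (h3.trans ?_)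
  · exact Finset.sum_congr rfl fun e _ => Finset.sum_congr rfl fun s _ => by ring
  · exact Finset.sum_congr rfl fun v _ => by ring

theorem sum_vertexBracket {i j i' j' : Fin n} (hi : i ∈ I) (hj : j ∉ I) (hi' : i' ∈ I) (hj' : j' ∉ I) :
    ∑ v, N.vertexBracket v (N.realSeries i j) (N.realSeries i' j') =
      (2 * sCross i j i' j') • (N.realSeries i j * N.realSeries i' j') := by
  classical
  ext m
  simp only [map_sum, MvPowerSeries.coeff_smul, coeff_vertexBracket, MvPowerSeries.coeff_mul,
    Finset.mul_sum]
  rw [Finset.sum_comm]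
  refine Finset.sum_congr rfl fun p _ => ?_
  by_cases h1 : MvPowerSeries.coeff p.1 (N.realSeries i j) = 0
  · simp [h1]
  by_cases h2 : MvPowerSeries.coeff p.2 (N.realSeries i' j') = 0
  · simp [h2]
  have h := N.sum_vertexPairing (N.isUnitFlow_of_coeff_realSeries_ne_zero h1)
    (N.isUnitFlow_of_coeff_realSeries_ne_zero h2) hi hj hi' hj'
  rw [← Finset.sum_mul, h]

/-- Exchanging the sinks of two boundary measurements changes the sign of the contributions of the white
vertices and preserves those of the black ones, up to a common sign. -/
theorem vertexBracket_exchange {d : Plane} (hd : ∀ e, planeDet (N.edgeVec e) d ≠ 0)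
    (hd' : ∀ a, planeDet (N.disk.side a) d ≠ 0) {i j i' j' : Fin n} (hi : i ∈ I) (hj : j ∉ I)
    (hi' : i' ∈ I) (hj' : j' ∉ I) (v : N.W) :
    N.vertexBracket v (N.boundarySeries i j) (N.boundarySeries i' j') =
      ((if N.white v then -1 else 1) * (N.endpointSign d i j * N.endpointSign d i' j' *
        (N.endpointSign d i j' * N.endpointSign d i' j))) •
      N.vertexBracket v (N.boundarySeries i j') (N.boundarySeries i' j) := by
  obtain ⟨U, V, h, hw, hb⟩ := N.exists_factorization hd hd'
  have s1 : N.endpointSign d i j' * N.endpointSign d i j' = 1 := paritySign_mul_self _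
  have s2 : N.endpointSign d i' j * N.endpointSign d i' j = 1 := paritySign_mul_self _
  have s1' := congrArg (Int.cast : ℤ → MvPowerSeries N.E ℤ) s1
  have s2' := congrArg (Int.cast : ℤ → MvPowerSeries N.E ℤ) s2
  push_cast at s1' s2'
  simp only [vertexBracket, h i hi j hj, h i' hi' j' hj', h i hi j' hj', h i' hi' j hj]
  set b := N.flagEdge (Sum.inr (v, 1)) with hbdef
  set c := N.flagEdge (Sum.inr (v, 2)) with hcdef
  simp only [zsmul_eq_mul]
  push_cast
  set x : MvPowerSeries N.E ℤ := (N.endpointSign d i j : MvPowerSeries N.E ℤ)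
  set y : MvPowerSeries N.E ℤ := (N.endpointSign d i' j' : MvPowerSeries N.E ℤ)
  set z : MvPowerSeries N.E ℤ := (N.endpointSign d i j' : MvPowerSeries N.E ℤ)
  set t : MvPowerSeries N.E ℤ := (N.endpointSign d i' j : MvPowerSeries N.E ℤ)
  have e1 : (x * y * (z * t)) * (z * t) = x * y := by
    linear_combination (x * y * t * t) * s1' + (x * y) * s2'
  rcases hv : N.white v with _ | _
  · obtain ⟨-, ⟨b', hb'⟩, ⟨c', hc'⟩⟩ := N.black_spec v hv
    have hbb : b = b' := by rw [hbdef, ← hb', flagEdge_tgt]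
    have hcc : c = c' := by rw [hcdef, ← hc', flagEdge_tgt]
    have key := hb v b c hv (hbb ▸ hb') (hcc ▸ hc') j j'
    simp only [Bool.false_eq_true, if_false]
    linear_combination (x * y * (U i b * U i' c + U i c * U i' b)) * key -
      (U i b * U i' c * V j' b * V j c - U i c * U i' b * V j' c * V j b) * e1
  · obtain ⟨-, ⟨b', hb'⟩, ⟨c', hc'⟩⟩ := N.white_spec v hv
    have hbb : b = b' := by rw [hbdef, ← hb', flagEdge_src]
    have hcc : c = c' := by rw [hcdef, ← hc', flagEdge_src]
    have key := hw v b c hv (hbb ▸ hb') (hcc ▸ hc') i hi i' hi'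
    simp only [if_true]
    linear_combination (x * y * (V j b * V j' c + V j c * V j' b)) * key +
      (U i b * U i' c * V j' b * V j c - U i c * U i' b * V j' c * V j b) * e1

/-- The bracket of two boundary measurements. -/
theorem sum_edgeCoeff_smul_eulerDeriv (P : UniversalParams) {i j i' j' : Fin n} (hi : i ∈ I)
    (hj : j ∉ I) (hi' : i' ∈ I) (hj' : j' ∉ I) :
    ∑ e, ∑ s, N.edgeCoeff P e s • (eulerDeriv e (N.realSeries i j) * eulerDeriv s (N.realSeries i' j')) =
      (((P.a23 + P.a13 - P.a12) - (P.b23 + P.b13 - P.b12)) * sPar i j i' j') •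
          (N.realSeries i j' * N.realSeries i' j) +
        (((P.a23 + P.a13 - P.a12) + (P.b23 + P.b13 - P.b12)) * sCross i j i' j') •
          (N.realSeries i j * N.realSeries i' j') := by
  have ne : ∀ {a b : Fin n}, a ∈ I → b ∉ I → a ≠ b := fun ha hb h => hb (h ▸ ha)
  obtain ⟨d, hd, hd'⟩ := N.exists_generic_direction
  set κ : ℤ := N.endpointSign d i j * N.endpointSign d i' j' *
    (N.endpointSign d i j' * N.endpointSign d i' j) with hκ
  set α := P.a23 + P.a13 - P.a12
  set β := P.b23 + P.b13 - P.b12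
  have hex : ∀ v, N.vertexBracket v (N.realSeries i j) (N.realSeries i' j') =
      ((if N.white v then -1 else 1) * κ : ℝ) •
        N.vertexBracket v (N.realSeries i j') (N.realSeries i' j) := by
    intro v
    have h := congrArg (MvPowerSeries.map (Int.castRingHom ℝ))
      (N.vertexBracket_exchange hd hd' hi hj hi' hj' v)
    rw [map_zsmul, ← vertexBracket_map, ← vertexBracket_map] at h
    simp only [realSeries]
    rw [h, ← hκ, ← Int.cast_smul_eq_zsmul ℝ]
    push_cast
    rfl
  have h1 := N.sum_vertexBracket hi hj hi' hj'
  have h2 := N.sum_vertexBracket hi hj' hi' hj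
  have hκ2 : (κ : ℝ) * sPar i j i' j' = sPar i j i' j' := by
    by_cases hs : sPar i j i' j' = 0
    · rw [hs, mul_zero]
    · have h := N.endpointSign_mul d (ne hi hj) (ne hi hj') (ne hi' hj) (ne hi' hj') hs
      have s1 : N.endpointSign d i j' * N.endpointSign d i j' = 1 := paritySign_mul_self _
      have s2 : N.endpointSign d i' j * N.endpointSign d i' j = 1 := paritySign_mul_self _
      have : κ = 1 := by
        rw [hκ, h]
        linear_combination (N.endpointSign d i' j * N.endpointSign d i' j) * s1 + s2
      rw [this]; simp
  -- The difference of the contributions of the white and of the black vertices.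
  have h3 : ∑ v, (if N.white v then 1 else -1 : ℝ) •
      N.vertexBracket v (N.realSeries i j) (N.realSeries i' j') =
      (2 * sPar i j i' j') • (N.realSeries i j' * N.realSeries i' j) := by
    have : ∀ v, (if N.white v then 1 else -1 : ℝ) •
        N.vertexBracket v (N.realSeries i j) (N.realSeries i' j') =
        (-κ : ℝ) • N.vertexBracket v (N.realSeries i j') (N.realSeries i' j) := by
      intro v
      rw [hex, smul_smul]
      congr 1
      split_ifs <;> ring
    rw [Finset.sum_congr rfl fun v _ => this v, ← Finset.smul_sum, h2, smul_smul]
    congr 1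
    rw [← hκ2, sPar_eq_neg_sCross (ne hi hj) (ne hi hj') (ne hi' hj) (ne hi' hj')]
    ring
  rw [N.sum_smul_vertexBracket_eq]
  have h4 : ∀ v, (if N.white v then α else β) •
      N.vertexBracket v (N.realSeries i j) (N.realSeries i' j') =
      ((α + β) / 2) • N.vertexBracket v (N.realSeries i j) (N.realSeries i' j') +
      ((α - β) / 2) • (if N.white v then 1 else -1 : ℝ) •
        N.vertexBracket v (N.realSeries i j) (N.realSeries i' j') := by
    intro v
    rw [smul_smul, ← add_smul]
    congr 1
    split_ifs <;> ring
  rw [Finset.sum_congr rfl fun v _ => h4 v, Finset.sum_add_distrib, ← Finset.smul_sum,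
    ← Finset.smul_sum, h1, h3, smul_smul, smul_smul, add_comm]
  congr 2 <;> ring

end PerfectNetwork

/-! ### Values of rational power series -/

section Values

variable {E : Type*}

theorem hasFDerivAt_eval [Fintype E] [DecidableEq E] (p : MvPolynomial E ℝ) (y : E → ℝ) :
    HasFDerivAt (fun y => MvPolynomial.eval y p)
      (∑ e, MvPolynomial.eval y (MvPolynomial.pderiv e p) •
        ContinuousLinearMap.proj (R := ℝ) (φ := fun _ : E => ℝ) e) y := by
  induction p using MvPolynomial.induction_on with
  | C a => simpa using hasFDerivAt_const a y
  | add p q hp hq =>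
    simp only [map_add, add_smul, Finset.sum_add_distrib]
    exact hp.add hq
  | mul_X p e hp =>
    have h := hp.mul (hasFDerivAt_apply (𝕜 := ℝ) (F' := fun _ : E => ℝ) e y)
    simp only [map_mul, MvPolynomial.eval_X]
    refine h.congr_fderiv ?_
    ext v
    simp [Derivation.leibniz, MvPolynomial.pderiv_X, Pi.single_apply, add_mul, Finset.sum_add_distrib,
      Finset.mul_sum, mul_assoc, apply_ite]

theorem partialDeriv_eval [Fintype E] [DecidableEq E] (p : MvPolynomial E ℝ) (e : E) (y : E → ℝ) :
    partialDeriv (fun y => MvPolynomial.eval y p) e y =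
      MvPolynomial.eval y (MvPolynomial.pderiv e p) := by
  rw [partialDeriv, (hasFDerivAt_eval p y).fderiv]
  simp [Pi.single_apply]

/-- The power series `F` is a fraction regular at `y`, with value `v` there. -/
def HasValueAt (y : E → ℝ) (F : MvPowerSeries E ℝ) (v : ℝ) : Prop :=
  ∃ p q : MvPolynomial E ℝ, (q : MvPowerSeries E ℝ) * F = p ∧ MvPolynomial.eval y q ≠ 0 ∧
    v = MvPolynomial.eval y p / MvPolynomial.eval y q

namespace HasValueAt

variable {y : E → ℝ} {F G : MvPowerSeries E ℝ} {v w : ℝ}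

theorem unique (hF : HasValueAt y F v) (hF' : HasValueAt y F w) : v = w := by
  obtain ⟨p, q, h1, h2, rfl⟩ := hF
  obtain ⟨p', q', h1', h2', rfl⟩ := hF'
  have h : p * q' = p' * q := by
    apply MvPolynomial.coe_injective
    rw [MvPolynomial.coe_mul, MvPolynomial.coe_mul, ← h1, ← h1']
    ring
  rw [div_eq_div_iff h2 h2', ← map_mul, ← map_mul, h]

theorem add (hF : HasValueAt y F v) (hG : HasValueAt y G w) : HasValueAt y (F + G) (v + w) := by
  obtain ⟨p, q, h1, h2, rfl⟩ := hF
  obtain ⟨p', q', h1', h2', rfl⟩ := hG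
  refine ⟨p * q' + p' * q, q * q', ?_, ?_, ?_⟩
  · simp only [MvPolynomial.coe_mul, MvPolynomial.coe_add]
    rw [← h1, ← h1']
    ring
  · rw [map_mul]
    exact mul_ne_zero h2 h2'
  · simp only [map_add, map_mul]
    field_simp

theorem mul (hF : HasValueAt y F v) (hG : HasValueAt y G w) : HasValueAt y (F * G) (v * w) := by
  obtain ⟨p, q, h1, h2, rfl⟩ := hF
  obtain ⟨p', q', h1', h2', rfl⟩ := hG
  refine ⟨p * p', q * q', ?_, ?_, ?_⟩
  · simp only [MvPolynomial.coe_mul]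
    rw [← h1, ← h1']
    ring
  · rw [map_mul]
    exact mul_ne_zero h2 h2'
  · simp only [map_mul]
    field_simp

theorem smul (t : ℝ) (hF : HasValueAt y F v) : HasValueAt y (t • F) (t * v) := by
  obtain ⟨p, q, h1, h2, rfl⟩ := hF
  refine ⟨t • p, q, ?_, h2, ?_⟩
  · rw [mul_smul_comm, h1, MvPolynomial.coe_smul]
  · rw [MvPolynomial.smul_eval]
    ring

theorem sum {ι : Type*} (s : Finset ι) {F : ι → MvPowerSeries E ℝ} {v : ι → ℝ}
    (h : ∀ i ∈ s, HasValueAt y (F i) (v i)) : HasValueAt y (∑ i ∈ s, F i) (∑ i ∈ s, v i) := by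
  classical
  induction s using Finset.induction_on with
  | empty => exact ⟨0, 1, by simp, by simp, by simp⟩
  | insert a s ha ih =>
    rw [Finset.sum_insert ha, Finset.sum_insert ha]
    exact (h a (Finset.mem_insert_self a s)).add
      (ih fun i hi => h i (Finset.mem_insert_of_mem hi))

/-- The values of the logarithmic derivatives of a fraction. -/
theorem eulerDeriv [Fintype E] [DecidableEq E] {φ : (E → ℝ) → ℝ}
    {p q : MvPolynomial E ℝ} (hF : (q : MvPowerSeries E ℝ) * F = p)
    (hq : MvPolynomial.eval y q ≠ 0)
    (hφ : φ =ᶠ[nhds y] fun y => MvPolynomial.eval y p / MvPolynomial.eval y q) (e : E) :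
    HasValueAt y (eulerDeriv e F) (y e * partialDeriv φ e y) := by
  refine ⟨MvPolynomial.X e * (MvPolynomial.pderiv e p * q - p * MvPolynomial.pderiv e q), q * q,
    ?_, ?_, ?_⟩
  · have h := congrArg (MvPowerSeries.pderiv ℝ e) hF
    rw [Derivation.leibniz, MvPowerSeries.pderiv_coe, MvPowerSeries.pderiv_coe] at h
    simp only [smul_eq_mul] at h
    have hsub : ((MvPolynomial.pderiv e p * q - p * MvPolynomial.pderiv e q : MvPolynomial E ℝ) :
        MvPowerSeries E ℝ) = (MvPolynomial.pderiv e p : MvPowerSeries E ℝ) * q -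
        p * (MvPolynomial.pderiv e q : MvPowerSeries E ℝ) := by
      rw [← MvPolynomial.coe_mul, ← MvPolynomial.coe_mul]
      exact map_sub (MvPolynomial.coeToMvPowerSeries.ringHom (σ := E) (R := ℝ)) _ _
    simp only [MvPolynomial.coe_mul, hsub, MvPolynomial.coe_X]
    change _ * (MvPowerSeries.X e * MvPowerSeries.pderiv ℝ e F) = _
    rw [← hF, ← h]
    ring
  · rw [map_mul]
    exact mul_ne_zero hq hq
  · have hd : partialDeriv φ e y = (MvPolynomial.eval y (MvPolynomial.pderiv e p) *
        MvPolynomial.eval y q - MvPolynomial.eval y p *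
        MvPolynomial.eval y (MvPolynomial.pderiv e q)) / MvPolynomial.eval y q ^ 2 := by
      have hdp := (hasFDerivAt_eval p y).differentiableAt
      have hdq := (hasFDerivAt_eval q y).differentiableAt
      have hdφ : DifferentiableAt ℝ φ y :=
        (DifferentiableAt.fun_mul hdp (DifferentiableAt.fun_inv hdq hq)).congr_of_eventuallyEq hφ
      have hmul : (fun y => φ y * MvPolynomial.eval y q) =ᶠ[nhds y]
          fun y => MvPolynomial.eval y p := by
        filter_upwards [hφ, hdq.continuousAt.eventually_ne hq] with z hz hz'
        rw [hz, div_mul_cancel₀ _ hz']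
      have h := congrArg (fun L : (E → ℝ) →L[ℝ] ℝ => L (Pi.single e (1 : ℝ))) hmul.fderiv_eq
      rw [fderiv_fun_mul hdφ hdq, hφ.eq_of_nhds] at h
      simp only [add_apply, smul_apply, smul_eq_mul] at h
      change _ * partialDeriv _ e y + _ * partialDeriv _ e y = partialDeriv _ e y at h
      rw [partialDeriv_eval, partialDeriv_eval] at h
      rw [← h]
      field_simp
      ring
    rw [hd]
    simp only [map_mul, map_sub, MvPolynomial.eval_X]
    ring

end HasValueAt

end Values

theorem aeval_eq_eval_map {E : Type} (y : E → ℝ) (p : MvPolynomial E ℤ) :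
    MvPolynomial.aeval y p = MvPolynomial.eval y (MvPolynomial.map (Int.castRingHom ℝ) p) := by
  rw [MvPolynomial.aeval_def, MvPolynomial.eval_map]
  rfl

theorem IsFractionOf.map_mul {E : Type} {g : MvPowerSeries E ℤ} {p q : MvPolynomial E ℤ}
    (h : IsFractionOf g p q) :
    (MvPolynomial.map (Int.castRingHom ℝ) q : MvPowerSeries E ℝ) *
      MvPowerSeries.map (Int.castRingHom ℝ) g = (MvPolynomial.map (Int.castRingHom ℝ) p) := by
  have hmap : ∀ p : MvPolynomial E ℤ, ((MvPolynomial.map (Int.castRingHom ℝ) p :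
      MvPolynomial E ℝ) : MvPowerSeries E ℝ) =
      MvPowerSeries.map (Int.castRingHom ℝ) (p : MvPowerSeries E ℤ) := by
    intro p
    ext m
    rw [MvPolynomial.coeff_coe, MvPolynomial.coeff_map, MvPowerSeries.coeff_map,
      MvPolynomial.coeff_coe]
  rw [hmap, hmap, ← h.2, _root_.map_mul]

theorem rationalValue_eq {E : Type} {g : MvPowerSeries E ℤ} {p q : MvPolynomial E ℤ}
    (h : IsFractionOf g p q) {y : E → ℝ} (hy : MvPolynomial.aeval y q ≠ 0) :
    rationalValue g y = MvPolynomial.aeval y p / MvPolynomial.aeval y q := by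
  have hex : ∃ r : ℝ, ∃ p q, IsFractionOf g p q ∧ MvPolynomial.aeval y q ≠ 0 ∧
    r = MvPolynomial.aeval y p / MvPolynomial.aeval y q := ⟨_, p, q, h, hy, rfl⟩
  rw [rationalValue, dif_pos hex]
  obtain ⟨p', q', h', hy', he⟩ := hex.choose_spec
  rw [he, div_eq_div_iff hy' hy, ← map_mul, ← map_mul]
  congr 1
  apply MvPolynomial.coe_injective
  rw [MvPolynomial.coe_mul, MvPolynomial.coe_mul, ← h.2, ← h'.2]
  ring

theorem eventually_rationalValue_eq {E : Type} [Fintype E] [DecidableEq E] {g : MvPowerSeries E ℤ}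
    {p q : MvPolynomial E ℤ}
    (h : IsFractionOf g p q) {y : E → ℝ} (hy : MvPolynomial.aeval y q ≠ 0) :
    rationalValue g =ᶠ[nhds y] fun y => MvPolynomial.eval y (MvPolynomial.map (Int.castRingHom ℝ) p) /
      MvPolynomial.eval y (MvPolynomial.map (Int.castRingHom ℝ) q) := by
  rw [aeval_eq_eval_map] at hy
  have hc : ContinuousAt (fun y => MvPolynomial.eval y (MvPolynomial.map (Int.castRingHom ℝ) q)) y :=
    (hasFDerivAt_eval _ y).continuousAt
  filter_upwards [hc.eventually_ne hy] with z hz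
  rw [← aeval_eq_eval_map] at hz
  rw [rationalValue_eq h hz, aeval_eq_eval_map, aeval_eq_eval_map]

namespace PerfectNetwork

variable {n : ℕ} {I : Finset (Fin n)} (N : PerfectNetwork n I)

/-! ### The boundary measurement map is Poisson -/

section Poisson

variable {k m : ℕ} (hk : I.card = k) (hm : Iᶜ.card = m)

theorem orderEmb_ne (p : Fin k) (q : Fin m) : I.orderEmbOfFin hk p ≠ Iᶜ.orderEmbOfFin hm q := fun h =>
  Finset.mem_compl.1 (Finset.orderEmbOfFin_mem Iᶜ hm q) (h ▸ Finset.orderEmbOfFin_mem I hk p)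

theorem exists_isFractionOf_entrySeries (a : Fin k × Fin m) :
    ∃ p q, IsFractionOf (N.entrySeries hk hm a) p q :=
  N.exists_isFractionOf_boundarySeries (Finset.orderEmbOfFin_mem I hk a.1) (orderEmb_ne hk hm a.1 a.2)

theorem hasValueAt_realSeries {y : N.E → ℝ} (hy : y ∈ N.domain hk hm)
    (a : Fin k × Fin m) :
    HasValueAt y (N.realSeries (I.orderEmbOfFin hk a.1) (Iᶜ.orderEmbOfFin hm a.2))
      (N.boundaryMap hk hm y a) := by
  obtain ⟨p, q, h, hq⟩ := hy.2 a
  refine ⟨_, _, h.map_mul, ?_, ?_⟩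
  · rwa [← aeval_eq_eval_map]
  · rw [← aeval_eq_eval_map, ← aeval_eq_eval_map]
    exact rationalValue_eq h hq

theorem hasValueAt_eulerDeriv_realSeries {y : N.E → ℝ} (hy : y ∈ N.domain hk hm)
    (a : Fin k × Fin m) (e : N.E) :
    HasValueAt y (eulerDeriv e (N.realSeries (I.orderEmbOfFin hk a.1) (Iᶜ.orderEmbOfFin hm a.2)))
      (y e * partialDeriv (fun y => N.boundaryMap hk hm y a) e y) := by
  obtain ⟨p, q, h, hq⟩ := hy.2 a
  refine HasValueAt.eulerDeriv h.map_mul ?_ (eventually_rationalValue_eq h hq) e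
  rwa [← aeval_eq_eval_map]

theorem differentiableAt_boundaryMap {y : N.E → ℝ} (hy : y ∈ N.domain hk hm)
    (a : Fin k × Fin m) :
    DifferentiableAt ℝ (fun y => N.boundaryMap hk hm y a) y := by
  obtain ⟨p, q, h, hq⟩ := hy.2 a
  refine DifferentiableAt.congr_of_eventuallyEq ?_ (eventually_rationalValue_eq h hq)
  rw [aeval_eq_eval_map] at hq
  exact DifferentiableAt.fun_mul (hasFDerivAt_eval _ y).differentiableAt
    (DifferentiableAt.fun_inv (hasFDerivAt_eval _ y).differentiableAt hq)

theorem partialDeriv_comp_boundaryMap {y : N.E → ℝ} (hy : y ∈ N.domain hk hm)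
    (f : smoothFunctions (Fin k × Fin m)) (e : N.E) :
    partialDeriv (f.1 ∘ N.boundaryMap hk hm) e y =
      ∑ a, partialDeriv f.1 a (N.boundaryMap hk hm y) *
        partialDeriv (fun y => N.boundaryMap hk hm y a) e y := by
  have h1 : DifferentiableAt ℝ (N.boundaryMap hk hm) y :=
    differentiableAt_pi.2 fun a => N.differentiableAt_boundaryMap hk hm hy a
  have h2 := differentiable_smoothFunctions f (N.boundaryMap hk hm y)
  simp only [partialDeriv]
  rw [fderiv_comp y h2 h1, ContinuousLinearMap.comp_apply]
  set v := fderiv ℝ (N.boundaryMap hk hm) y (Pi.single e 1) with hv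
  have hva : ∀ a, fderiv ℝ (fun y => N.boundaryMap hk hm y a) y (Pi.single e 1) = v a := by
    intro a
    rw [hv, fderiv_apply h1]
    rfl
  simp only [hva]
  have hv' : v = ∑ a, v a • (Pi.single a (1 : ℝ) : Fin k × Fin m → ℝ) := by
    ext a
    simp [Finset.sum_apply, Pi.single_apply]
  conv_lhs => rw [hv', map_sum]
  refine Finset.sum_congr rfl fun a _ => ?_
  rw [map_smul, smul_eq_mul, mul_comm]

/-- The brackets of the entries of the boundary measurement map. -/
theorem edgeBracket_boundaryMap_entries {y : N.E → ℝ} (hy : y ∈ N.domain hk hm)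
    (P : UniversalParams) (a b : Fin k × Fin m) :
    N.edgeBracket P (fun y => N.boundaryMap hk hm y a) (fun y => N.boundaryMap hk hm y b) y =
      (entryBracket (I.orderEmbOfFin hk) (Iᶜ.orderEmbOfFin hm) (P.a23 + P.a13 - P.a12)
        (P.b23 + P.b13 - P.b12) a b).1 (N.boundaryMap hk hm y) := by
  have mI := Finset.orderEmbOfFin_mem I hk
  have mJ : ∀ q, Iᶜ.orderEmbOfFin hm q ∉ I := fun q =>
    Finset.mem_compl.1 (Finset.orderEmbOfFin_mem Iᶜ hm q)
  have hL : HasValueAt y (∑ e, ∑ s, N.edgeCoeff P e s •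
      (eulerDeriv e (N.realSeries (I.orderEmbOfFin hk a.1) (Iᶜ.orderEmbOfFin hm a.2)) *
        eulerDeriv s (N.realSeries (I.orderEmbOfFin hk b.1) (Iᶜ.orderEmbOfFin hm b.2)))) _ :=
    HasValueAt.sum _ fun e _ => HasValueAt.sum _ fun s _ => HasValueAt.smul _
      ((N.hasValueAt_eulerDeriv_realSeries hk hm hy a e).mul
        (N.hasValueAt_eulerDeriv_realSeries hk hm hy b s))
  rw [N.sum_edgeCoeff_smul_eulerDeriv P (mI a.1) (mJ a.2) (mI b.1) (mJ b.2)] at hL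
  have hR := (((N.hasValueAt_realSeries hk hm hy (a.1, b.2)).mul
    (N.hasValueAt_realSeries hk hm hy (b.1, a.2))).smul
      (((P.a23 + P.a13 - P.a12) - (P.b23 + P.b13 - P.b12)) * sPar (I.orderEmbOfFin hk a.1)
        (Iᶜ.orderEmbOfFin hm a.2) (I.orderEmbOfFin hk b.1) (Iᶜ.orderEmbOfFin hm b.2))).add
    (((N.hasValueAt_realSeries hk hm hy a).mul (N.hasValueAt_realSeries hk hm hy b)).smul
      (((P.a23 + P.a13 - P.a12) + (P.b23 + P.b13 - P.b12)) * sCross (I.orderEmbOfFin hk a.1)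
        (Iᶜ.orderEmbOfFin hm a.2) (I.orderEmbOfFin hk b.1) (Iᶜ.orderEmbOfFin hm b.2)))
  refine Eq.trans ?_ ((hL.unique hR).trans rfl)
  rw [edgeBracket, quadraticBracket]
  exact Finset.sum_congr rfl fun e _ => Finset.sum_congr rfl fun s _ => by ring

theorem edgeBracket_comp_boundaryMap {y : N.E → ℝ} (hy : y ∈ N.domain hk hm)
    (P : UniversalParams)
    (f g : smoothFunctions (Fin k × Fin m)) :
    N.edgeBracket P (f.1 ∘ N.boundaryMap hk hm) (g.1 ∘ N.boundaryMap hk hm) y =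
      ∑ a, ∑ b, N.edgeBracket P (fun y => N.boundaryMap hk hm y a) (fun y => N.boundaryMap hk hm y b) y *
        partialDeriv f.1 a (N.boundaryMap hk hm y) * partialDeriv g.1 b (N.boundaryMap hk hm y) := by
  simp only [edgeBracket, quadraticBracket, N.partialDeriv_comp_boundaryMap hk hm hy,
    Finset.mul_sum, Finset.sum_mul]
  have swap : ∀ F : N.E → N.E → Fin k × Fin m → Fin k × Fin m → ℝ,
      ∑ e, ∑ s, ∑ b, ∑ a, F e s a b = ∑ a, ∑ b, ∑ e, ∑ s, F e s a b := by
    intro F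
    calc _ = ∑ e, ∑ b, ∑ s, ∑ a, F e s a b := Finset.sum_congr rfl fun e _ => Finset.sum_comm
      _ = ∑ b, ∑ e, ∑ s, ∑ a, F e s a b := Finset.sum_comm
      _ = ∑ b, ∑ e, ∑ a, ∑ s, F e s a b :=
          Finset.sum_congr rfl fun b _ => Finset.sum_congr rfl fun e _ => Finset.sum_comm
      _ = ∑ b, ∑ a, ∑ e, ∑ s, F e s a b := Finset.sum_congr rfl fun b _ => Finset.sum_comm
      _ = _ := Finset.sum_comm
  rw [swap]
  refine Finset.sum_congr rfl fun a _ => Finset.sum_congr rfl fun b _ =>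
    Finset.sum_congr rfl fun e _ => Finset.sum_congr rfl fun s _ => ?_
  ring

end Poisson
end PerfectNetwork

/-! ### A network with a cycle -/

theorem PolygonalDisk.convex_interior {n : ℕ} (D : PolygonalDisk n) : Convex ℝ D.interior := by
  intro x hx y hy s t hs ht hst a
  have h1 := hx a
  have h2 := hy a
  have h3 : s • x + t • y - D.corner a = s • (x - D.corner a) + t • (y - D.corner a) := by
    have : D.corner a = (s + t) • D.corner a := by rw [hst, one_smul]
    rw [smul_sub, smul_sub]
    nth_rewrite 1 [this]
    module
  rw [h3, planeDet_add_right, planeDet_smul_right, planeDet_smul_right]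
  rcases hs.eq_or_lt with rfl | hs
  · rw [zero_add] at hst
    rw [hst]
    linarith
  · nlinarith [mul_pos hs h1, mul_nonneg ht h2.le]

/-- A polygon inscribed in a parabola, whose corners are the points with abscissas `-1, 0, ..., n`; all of
them but the first and the last one are boundary vertices. -/
noncomputable def parabolicDisk (n : ℕ) (hn : 3 ≤ n) : PolygonalDisk n where
  numCorners := n + 2
  three_le_numCorners := by omega
  corner c := ((c : ℝ) - 1, ((c : ℝ) - 1) ^ 2)
  corner_convex a b c hab hbc := by
    have h1 : (0 : ℝ) < (b : ℝ) - a := by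
      rw [sub_pos]; exact_mod_cast hab
    have h2 : (0 : ℝ) < (c : ℝ) - b := by
      rw [sub_pos]; exact_mod_cast hbc
    have h3 : (0 : ℝ) < (c : ℝ) - a := by linarith
    have := mul_pos (mul_pos h1 h2) h3
    simp only [planeDet, Prod.fst_sub, Prod.snd_sub]
    linarith
  cornerIdx i := ⟨i + 1, by omega⟩
  cornerIdx_strictMono i j h := by
    rw [Fin.lt_def] at h ⊢
    simpa using h

theorem parabolicDisk_corner {n : ℕ} (hn : 3 ≤ n) (i : Fin n) :
    (parabolicDisk n hn).corner ((parabolicDisk n hn).cornerIdx i) = ((i : ℝ), (i : ℝ) ^ 2) := by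
  simp [parabolicDisk]

theorem mem_interior_parabolicDisk {n : ℕ} (hn : 3 ≤ n) {a : ℕ} (ha : a < n) {t : ℝ} (h0 : 0 < t)
    (h1 : t ≤ 1) : (((a : ℝ), (a : ℝ) ^ 2 + t) : Plane) ∈ (parabolicDisk n hn).interior := by
  intro c
  have hv := PolygonalDisk.val_finRotate c
  have hc : (c : ℕ) < n + 2 := c.2
  change 0 < planeDet ((((finRotate _ c : Fin (n + 2)) : ℕ) : ℝ) - 1 - (((c : ℕ) : ℝ) - 1),
    ((((finRotate _ c : Fin (n + 2)) : ℕ) : ℝ) - 1) ^ 2 - (((c : ℕ) : ℝ) - 1) ^ 2)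
    ((a : ℝ) - (((c : ℕ) : ℝ) - 1), (a : ℝ) ^ 2 + t - (((c : ℕ) : ℝ) - 1) ^ 2)
  change ((finRotate _ c : Fin (n + 2)) : ℕ) = if (c : ℕ) + 1 < n + 2 then (c : ℕ) + 1 else 0 at hv
  generalize (c : ℕ) = c' at *
  rw [hv]
  split_ifs with h
  · push_cast
    have key : 0 ≤ ((a : ℝ) - c' + 1) * (a - c') := by
      rcases le_or_gt c' a with h' | h'
      · have : (c' : ℝ) ≤ a := by exact_mod_cast h'
        exact mul_nonneg (by linarith) (by linarith)
      · have : (a : ℝ) + 1 ≤ c' := by exact_mod_cast h'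
        exact mul_nonneg_of_nonpos_of_nonpos (by linarith) (by linarith)
    simp only [planeDet]
    linarith
  · have hc' : c' = n + 1 := by omega
    have h3 : (3 : ℝ) ≤ n := by exact_mod_cast hn
    have ha' : (a : ℝ) + 1 ≤ n := by exact_mod_cast ha
    have ha0 : (0 : ℝ) ≤ a := by positivity
    subst hc'
    push_cast
    simp only [planeDet]
    have key : 0 < ((a : ℝ) + 1) * (n - a) - t := by nlinarith
    nlinarith [mul_pos (show (0 : ℝ) < n + 1 by linarith) key]

section CycleNetwork

variable {n : ℕ} (I : Finset (Fin n))

/-- The tails of the edges of the cycle network: the edges are the spokes, between the boundary vertices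
and the internal ones, and the edges of a directed cycle through all internal vertices. -/
def cycleSrc : Fin n ⊕ Fin n → NetFlag n (Fin n)
  | Sum.inl a => if a ∈ I then Sum.inl a else Sum.inr (a, 2)
  | Sum.inr a => if a ∈ I then Sum.inr (a, 0) else Sum.inr (a, 1)

/-- The heads of the edges of the cycle network. -/
def cycleTgt : Fin n ⊕ Fin n → NetFlag n (Fin n)
  | Sum.inl a => if a ∈ I then Sum.inr (a, 1) else Sum.inl a
  | Sum.inr a => if finRotate n a ∈ I then Sum.inr (finRotate n a, 2) else Sum.inr (finRotate n a, 0)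

theorem cycleTgt_prev (v : Fin n) : cycleTgt I (Sum.inr ((finRotate n).symm v)) =
    if v ∈ I then Sum.inr (v, 2) else Sum.inr (v, 0) := by
  simp only [cycleTgt, Equiv.apply_symm_apply]

theorem cycleFlags_surjective : Function.Surjective (Sum.elim (cycleSrc I) (cycleTgt I)) := by
  rintro (a | ⟨v, k⟩)
  · by_cases ha : a ∈ I
    · exact ⟨Sum.inl (Sum.inl a), by simp [cycleSrc, ha]⟩
    · exact ⟨Sum.inr (Sum.inl a), by simp [cycleTgt, ha]⟩
  · by_cases hv : v ∈ I <;> fin_cases k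
    · exact ⟨Sum.inl (Sum.inr v), by simp [cycleSrc, hv]⟩
    · exact ⟨Sum.inr (Sum.inl v), by simp [cycleTgt, hv]⟩
    · exact ⟨Sum.inr (Sum.inr ((finRotate n).symm v)), (cycleTgt_prev I v).trans (if_pos hv)⟩
    · exact ⟨Sum.inr (Sum.inr ((finRotate n).symm v)), (cycleTgt_prev I v).trans (if_neg hv)⟩
    · exact ⟨Sum.inl (Sum.inr v), by simp [cycleSrc, hv]⟩
    · exact ⟨Sum.inl (Sum.inl v), by simp [cycleSrc, hv]⟩

/-- The graph of the cycle network. -/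
def cycleGraph : PerfectGraph n I where
  W := Fin n
  E := Fin n ⊕ Fin n
  src := cycleSrc I
  tgt := cycleTgt I
  flags_bijective := (Fintype.bijective_iff_surjective_and_card _).2
    ⟨cycleFlags_surjective I, by simp; ring⟩
  source_iff a := by
    constructor
    · intro ha
      exact ⟨Sum.inl a, by simp [cycleSrc, ha]⟩
    · rintro ⟨b | b, hb⟩ <;> simp only [cycleSrc] at hb <;> split_ifs at hb with h
      · obtain rfl := Sum.inl_injective hb
        exact h
  white v := decide (v ∉ I)
  white_spec v hv := by
    have hv : v ∉ I := by simpa using hv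
    exact ⟨⟨Sum.inr ((finRotate n).symm v), (cycleTgt_prev I v).trans (if_neg hv)⟩,
      ⟨Sum.inr v, by simp [cycleSrc, hv]⟩, ⟨Sum.inl v, by simp [cycleSrc, hv]⟩⟩
  black_spec v hv := by
    have hv : v ∈ I := by simpa using hv
    exact ⟨⟨Sum.inr v, by simp [cycleSrc, hv]⟩, ⟨Sum.inl v, by simp [cycleTgt, hv]⟩,
      ⟨Sum.inr ((finRotate n).symm v), (cycleTgt_prev I v).trans (if_pos hv)⟩⟩

/-- The positions of the internal vertices of the cycle network. -/
def cyclePos (a : Fin n) : Plane := ((a : ℝ), (a : ℝ) ^ 2 + 1)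

/-- A parametrization of the interiors of the edges of the cycle network. -/
def cycleEdgePoint : Fin n ⊕ Fin n → ℝ → Plane
  | Sum.inl a, t => ((a : ℝ), (a : ℝ) ^ 2 + t)
  | Sum.inr a, t => ((a : ℝ) + t * ((finRotate n a : Fin n) - a),
      (a : ℝ) ^ 2 + t * (((finRotate n a : Fin n) : ℝ) ^ 2 - (a : ℝ) ^ 2) + 1)

theorem exists_eq_cycleEdgePoint (hn : 3 ≤ n) {e : Fin n ⊕ Fin n} {z : Plane}
    (hz : z ∈ openSegment ℝ ((parabolicDisk n hn).position cyclePos (cycleSrc I e).vertex)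
      ((parabolicDisk n hn).position cyclePos (cycleTgt I e).vertex)) :
    ∃ t : ℝ, 0 < t ∧ t < 1 ∧ z = cycleEdgePoint e t := by
  have hv : ∀ a : Fin n, (parabolicDisk n hn).position cyclePos (Sum.inr a) = cyclePos a := fun _ => rfl
  have hb : ∀ a : Fin n, (parabolicDisk n hn).position (W := Fin n) cyclePos (Sum.inl a) =
      ((a : ℝ), (a : ℝ) ^ 2) := fun a => parabolicDisk_corner hn a
  rcases e with a | a
  · by_cases ha : a ∈ I
    · simp only [cycleSrc, cycleTgt, ha, if_true, NetFlag.vertex, hv, hb] at hz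
      obtain ⟨s, t, hs, ht, hst, rfl⟩ := hz
      refine ⟨t, ht, by linarith, Prod.ext ?_ ?_⟩
      · simp [cyclePos, cycleEdgePoint]
        linear_combination (a : ℝ) * hst
      · simp [cyclePos, cycleEdgePoint]
        linear_combination (a : ℝ) ^ 2 * hst
    · simp only [cycleSrc, cycleTgt, ha, if_false, NetFlag.vertex, hv, hb] at hz
      obtain ⟨s, t, hs, ht, hst, rfl⟩ := hz
      refine ⟨s, hs, by linarith, Prod.ext ?_ ?_⟩
      · simp [cyclePos, cycleEdgePoint]
        linear_combination (a : ℝ) * hst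
      · simp [cyclePos, cycleEdgePoint]
        linear_combination (a : ℝ) ^ 2 * hst
  · have h1 : (cycleSrc I (Sum.inr a)).vertex = Sum.inr a := by
      simp only [cycleSrc]; split_ifs <;> rfl
    have h2 : (cycleTgt I (Sum.inr a)).vertex = Sum.inr (finRotate n a) := by
      simp only [cycleTgt]; split_ifs <;> rfl
    rw [h1, h2, hv, hv] at hz
    obtain ⟨s, t, hs, ht, hst, rfl⟩ := hz
    refine ⟨t, ht, by linarith, Prod.ext ?_ ?_⟩
    · simp [cyclePos, cycleEdgePoint]
      linear_combination (a : ℝ) * hst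
    · simp [cyclePos, cycleEdgePoint]
      linear_combination ((a : ℝ) ^ 2 + 1) * hst

theorem cast_ne_cast_add {a c : ℕ} {t : ℝ} (h0 : 0 < t) (h1 : t < 1) : (c : ℝ) ≠ a + t := by
  intro h
  have h2 : (a : ℝ) < c := by linarith
  have h3 : (c : ℝ) < (a + 1 : ℕ) := by push_cast; linarith
  have h2 : a < c := by exact_mod_cast h2
  have h3 : c < a + 1 := by exact_mod_cast h3
  omega

/-- The edges of the cycle lie on the chords of a parabola. -/
theorem cycleEdgePoint_inr (a : Fin n) (t : ℝ) :
    ((a : ℕ) + 1 < n ∧ cycleEdgePoint (Sum.inr a) t =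
      ((a : ℝ) + t, ((a : ℝ) + t) ^ 2 + t * (1 - t) + 1)) ∨
    ((a : ℕ) + 1 = n ∧ cycleEdgePoint (Sum.inr a) t = ((a : ℝ) * (1 - t), (a : ℝ) ^ 2 * (1 - t) + 1)) := by
  have hv := PolygonalDisk.val_finRotate a
  have ha := a.2
  simp only [cycleEdgePoint, hv]
  split_ifs with h
  · left
    refine ⟨h, Prod.ext ?_ ?_⟩ <;> push_cast <;> ring
  · right
    refine ⟨by omega, Prod.ext ?_ ?_⟩ <;> push_cast <;> ring

theorem cycleEdgePoint_spoke_ne (c a : Fin n) {s t : ℝ} (hs : s < 1)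
    (ht0 : 0 < t) (ht1 : t < 1) : cycleEdgePoint (Sum.inl c) s ≠ cycleEdgePoint (Sum.inr a) t := by
  intro h
  rcases cycleEdgePoint_inr a t with ⟨ha, ha'⟩ | ⟨ha, ha'⟩ <;> rw [ha'] at h <;>
    simp only [cycleEdgePoint, Prod.mk.injEq] at h <;> obtain ⟨h1, h2⟩ := h
  · exact cast_ne_cast_add ht0 ht1 h1
  · have hca : (c : ℕ) ≤ a := by omega
    have hca : (c : ℝ) ≤ a := by exact_mod_cast hca
    have h3 : (c : ℝ) ^ 2 + s = a * c + 1 := by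
      rw [h2]
      linear_combination -(a : ℝ) * h1
    nlinarith [mul_nonneg (show (0 : ℝ) ≤ c by positivity) (sub_nonneg.2 hca)]

theorem cycleEdgePoint_ne (hn : 3 ≤ n) {e e' : Fin n ⊕ Fin n} (h : e ≠ e') {s t : ℝ} (hs0 : 0 < s) (hs1 : s < 1)
    (ht0 : 0 < t) (ht1 : t < 1) : cycleEdgePoint e s ≠ cycleEdgePoint e' t := by
  rcases e with a | a <;> rcases e' with b | b
  · intro h'
    simp only [cycleEdgePoint, Prod.mk.injEq] at h'
    have : (a : ℕ) = b := by exact_mod_cast h'.1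
    exact h (congrArg Sum.inl (Fin.ext this))
  · exact cycleEdgePoint_spoke_ne a b hs1 ht0 ht1
  · exact (cycleEdgePoint_spoke_ne b a ht1 hs0 hs1).symm
  · have hab : (a : ℕ) ≠ b := fun h' => h (congrArg Sum.inr (Fin.ext h'))
    -- A short chord of the parabola against the chord from the last to the first vertex.
    have key : ∀ {a b : Fin n} {s t : ℝ}, 0 < s → s < 1 → (a : ℕ) + 1 < n → (b : ℕ) + 1 = n →
        (((a : ℝ) + s, ((a : ℝ) + s) ^ 2 + s * (1 - s) + 1) : Plane) ≠
          ((b : ℝ) * (1 - t), (b : ℝ) ^ 2 * (1 - t) + 1) := by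
      intro a b s t hs0 hs1 ha hb h'
      obtain ⟨h1, h2⟩ := Prod.mk.inj h'
      obtain ⟨r, hr⟩ : ∃ r : ℕ, (b : ℕ) = a + r + 1 := ⟨b - a - 1, by omega⟩
      have hr' : (b : ℝ) = a + r + 1 := by exact_mod_cast hr
      have h3 : ((a : ℝ) + s) * (r + (1 - s)) = s * (1 - s) := by
        have : ((a : ℝ) + s) ^ 2 + s * (1 - s) = b * ((a : ℝ) + s) := by
          rw [h1]
          rw [h1] at h2
          linear_combination h2
        rw [hr'] at this
        linear_combination -this
      have h4 : (1 : ℝ) ≤ a + r := by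
        have : 1 ≤ (a : ℕ) + r := by omega
        exact_mod_cast this
      have ha0 : (0 : ℝ) ≤ a := by positivity
      have hr0 : (0 : ℝ) ≤ r := by positivity
      rcases ha0.eq_or_lt with h5 | h5
      · have : (0 : ℝ) < r := by linarith
        nlinarith [mul_pos hs0 this]
      · nlinarith [mul_pos h5 (sub_pos.2 hs1), mul_nonneg ha0 hr0, mul_nonneg hs0.le hr0]
    rcases cycleEdgePoint_inr a s with ⟨ha, ha'⟩ | ⟨ha, ha'⟩ <;>
      rcases cycleEdgePoint_inr b t with ⟨hb, hb'⟩ | ⟨hb, hb'⟩ <;> rw [ha', hb']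
    · intro h'
      have h1 := (Prod.mk.inj h').1
      rcases lt_or_gt_of_ne hab with h2 | h2
      · have : ((a : ℕ) : ℝ) + 1 ≤ b := by exact_mod_cast h2
        linarith
      · have : ((b : ℕ) : ℝ) + 1 ≤ a := by exact_mod_cast h2
        linarith
    · exact key hs0 hs1 ha hb
    · exact (key ht0 ht1 hb ha).symm
    · omega

theorem cyclePos_ne_cycleEdgePoint (hn : 3 ≤ n) (c : Fin n) (e : Fin n ⊕ Fin n) {t : ℝ} (h0 : 0 < t) (h1 : t < 1) :
    cyclePos c ≠ cycleEdgePoint e t := by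
  intro h
  rcases e with a | a
  · simp only [cyclePos, cycleEdgePoint, Prod.mk.injEq] at h
    obtain ⟨h2, h3⟩ := h
    rw [h2] at h3
    linarith
  · rcases cycleEdgePoint_inr a t with ⟨ha, ha'⟩ | ⟨ha, ha'⟩ <;> rw [ha'] at h <;>
      simp only [cyclePos, Prod.mk.injEq] at h <;> obtain ⟨h2, h3⟩ := h
    · exact cast_ne_cast_add h0 h1 h2
    · have h4 : (c : ℝ) * (c - a) = 0 := by linear_combination h3 - (a : ℝ) * h2
      have h5 : (0 : ℝ) < a := by
        have : 0 < (a : ℕ) := by omega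
        exact_mod_cast this
      nlinarith [mul_pos h5 h0, mul_pos h5 (sub_pos.2 h1), mul_pos (mul_pos h5 h0)
        (mul_pos h5 (sub_pos.2 h1))]

theorem cyclePos_mem (hn : 3 ≤ n) (a : Fin n) : cyclePos a ∈ (parabolicDisk n hn).interior :=
  mem_interior_parabolicDisk hn a.2 one_pos le_rfl

/-- At each internal vertex the edge from the previous vertex of the cycle, the edge to the next one and
the spoke go clockwise. -/
theorem clockwiseDirs_cycle (hn : 3 ≤ n) {a b : Fin n} (hb : finRotate n a = b) :
    ClockwiseDirs (cyclePos a - cyclePos b) (cyclePos (finRotate n b) - cyclePos b)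
      ((parabolicDisk n hn).position (W := Fin n) cyclePos (Sum.inl b) - cyclePos b) := by
  have hs : (parabolicDisk n hn).position (W := Fin n) cyclePos (Sum.inl b) - cyclePos b = (0, -1) := by
    have : (parabolicDisk n hn).position (W := Fin n) cyclePos (Sum.inl b) = ((b : ℝ), (b : ℝ) ^ 2) :=
      parabolicDisk_corner hn b
    rw [this]
    simp [cyclePos]
  have h1 := PolygonalDisk.val_finRotate a
  have h2 := PolygonalDisk.val_finRotate b
  rw [hb] at h1
  rw [hs]
  simp only [ClockwiseDirs, planeDet, cyclePos, Prod.fst_sub, Prod.snd_sub]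
  have h3 : (3 : ℝ) ≤ n := by exact_mod_cast hn
  have ha := a.2
  split_ifs at h1 h2 with h4 h5 h5
  · left
    rw [h2, h1]
    push_cast
    constructor <;> nlinarith
  · right; right
    have : (n : ℝ) = (a : ℕ) + 2 := by
      have : n = (a : ℕ) + 2 := by omega
      exact_mod_cast this
    rw [h2, h1]
    push_cast
    constructor <;> nlinarith
  · left
    have : (n : ℝ) = (a : ℕ) + 1 := by
      have : n = (a : ℕ) + 1 := by omega
      exact_mod_cast this
    rw [h2, h1]
    push_cast
    constructor <;> nlinarith
  · omega

end CycleNetwork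

section CycleNetwork

variable {n : ℕ} (I : Finset (Fin n))

theorem cycleSrc_vertex_inr (a : Fin n) : (cycleSrc I (Sum.inr a)).vertex = Sum.inr a := by
  simp only [cycleSrc]; split_ifs <;> rfl

theorem cycleTgt_vertex_inr (a : Fin n) :
    (cycleTgt I (Sum.inr a)).vertex = Sum.inr (finRotate n a) := by
  simp only [cycleTgt]; split_ifs <;> rfl

theorem cycleEdge_subset (hn : 3 ≤ n) (e : Fin n ⊕ Fin n) :
    openSegment ℝ ((parabolicDisk n hn).position cyclePos (cycleSrc I e).vertex)
      ((parabolicDisk n hn).position cyclePos (cycleTgt I e).vertex) ⊆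
        (parabolicDisk n hn).interior := by
  rcases e with a | a
  · intro z hz
    obtain ⟨t, h0, h1, rfl⟩ := exists_eq_cycleEdgePoint I hn hz
    exact mem_interior_parabolicDisk hn a.2 h0 h1.le
  · rw [cycleSrc_vertex_inr, cycleTgt_vertex_inr]
    exact (openSegment_subset_segment ℝ _ _).trans
      ((parabolicDisk n hn).convex_interior.segment_subset (cyclePos_mem hn _) (cyclePos_mem hn _))

theorem cycleSrc_injective : Function.Injective (cycleSrc I) :=
  (cycleGraph I).flags_bijective.1.comp Sum.inl_injective

theorem cycleTgt_injective : Function.Injective (cycleTgt I) :=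
  (cycleGraph I).flags_bijective.1.comp Sum.inr_injective

theorem cyclePos_injective : Function.Injective (cyclePos (n := n)) := by
  intro a b h
  have : (a : ℝ) = b := (Prod.mk.inj h).1
  exact Fin.ext (by exact_mod_cast this)

theorem position_notMem_cycleEdge (hn : 3 ≤ n) (e : Fin n ⊕ Fin n) (v : Fin n ⊕ Fin n) :
    (parabolicDisk n hn).position cyclePos v ∉
      openSegment ℝ ((parabolicDisk n hn).position cyclePos (cycleSrc I e).vertex)
        ((parabolicDisk n hn).position cyclePos (cycleTgt I e).vertex) := by
  intro hv
  rcases v with c | c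
  · have h1 : (parabolicDisk n hn).corner ((parabolicDisk n hn).cornerIdx c) ∈ _ :=
      cycleEdge_subset I hn e hv
    have h2 := h1 ((parabolicDisk n hn).cornerIdx c)
    rw [sub_self] at h2
    simp [planeDet] at h2
  · obtain ⟨t, h0, h1, ht⟩ := exists_eq_cycleEdgePoint I hn hv
    exact cyclePos_ne_cycleEdgePoint hn c e h0 h1 ht

theorem cycle_white_clockwise (hn : 3 ≤ n) {v : Fin n} {e₁ e₂ e₃ : Fin n ⊕ Fin n}
    (h₁ : cycleTgt I e₁ = Sum.inr (v, 0)) (h₂ : cycleSrc I e₂ = Sum.inr (v, 1))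
    (h₃ : cycleSrc I e₃ = Sum.inr (v, 2)) : ClockwiseDirs
      ((parabolicDisk n hn).position cyclePos (cycleSrc I e₁).vertex - cyclePos v)
      ((parabolicDisk n hn).position cyclePos (cycleTgt I e₂).vertex - cyclePos v)
      ((parabolicDisk n hn).position cyclePos (cycleTgt I e₃).vertex - cyclePos v) := by
  have hv : v ∉ I := by
    rcases e₂ with a | a <;> simp only [cycleSrc] at h₂ <;> split_ifs at h₂ with h <;>
      have h₄ := Prod.mk.inj (Sum.inr_injective h₂)
    · exact absurd h₄.2 (by decide)
    · exact absurd h₄.2 (by decide)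
    · exact h₄.1 ▸ h
  obtain ⟨a, rfl⟩ := (finRotate n).surjective v
  obtain rfl : e₁ = Sum.inr a := cycleTgt_injective I (h₁.trans (if_neg hv).symm)
  obtain rfl : e₂ = Sum.inr (finRotate n a) := cycleSrc_injective I (h₂.trans (if_neg hv).symm)
  obtain rfl : e₃ = Sum.inl (finRotate n a) := cycleSrc_injective I (h₃.trans (if_neg hv).symm)
  have h := clockwiseDirs_cycle hn (a := a) rfl
  have h4 : (cycleTgt I (Sum.inl (finRotate n a))).vertex = Sum.inl (finRotate n a) := by
    simp only [cycleTgt, hv, if_false, NetFlag.vertex]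
  rw [cycleSrc_vertex_inr, cycleTgt_vertex_inr, h4]
  exact h

theorem cycle_black_clockwise (hn : 3 ≤ n) {v : Fin n} {e₁ e₂ e₃ : Fin n ⊕ Fin n}
    (h₁ : cycleSrc I e₁ = Sum.inr (v, 0)) (h₂ : cycleTgt I e₂ = Sum.inr (v, 1))
    (h₃ : cycleTgt I e₃ = Sum.inr (v, 2)) : ClockwiseDirs
      ((parabolicDisk n hn).position cyclePos (cycleTgt I e₁).vertex - cyclePos v)
      ((parabolicDisk n hn).position cyclePos (cycleSrc I e₂).vertex - cyclePos v)
      ((parabolicDisk n hn).position cyclePos (cycleSrc I e₃).vertex - cyclePos v) := by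
  have hv : v ∈ I := by
    rcases e₁ with a | a <;> simp only [cycleSrc] at h₁ <;> split_ifs at h₁ with h <;>
      have h₄ := Prod.mk.inj (Sum.inr_injective h₁)
    · exact absurd h₄.2 (by decide)
    · exact h₄.1 ▸ h
    · exact absurd h₄.2 (by decide)
  obtain ⟨a, rfl⟩ := (finRotate n).surjective v
  obtain rfl : e₁ = Sum.inr (finRotate n a) := cycleSrc_injective I (h₁.trans (if_pos hv).symm)
  obtain rfl : e₂ = Sum.inl (finRotate n a) := cycleTgt_injective I (h₂.trans (if_pos hv).symm)
  obtain rfl : e₃ = Sum.inr a := cycleTgt_injective I (h₃.trans (if_pos hv).symm)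
  have h := clockwiseDirs_cycle hn (a := a) rfl
  have h4 : (cycleSrc I (Sum.inl (finRotate n a))).vertex = Sum.inl (finRotate n a) := by
    simp only [cycleSrc, hv, if_true, NetFlag.vertex]
  rw [cycleSrc_vertex_inr, cycleTgt_vertex_inr, h4]
  -- The clockwise order is invariant under cyclic permutations.
  rcases h with ⟨h, h'⟩ | ⟨h, h'⟩ | ⟨h, h'⟩
  · exact Or.inr (Or.inr ⟨h, h'⟩)
  · exact Or.inl ⟨h, h'⟩
  · exact Or.inr (Or.inl ⟨h, h'⟩)

/-- The cycle network: the internal vertices form a directed cycle, and each of them is connected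
with a boundary vertex. -/
noncomputable def cycleNetwork (hn : 3 ≤ n) : PerfectNetwork n I where
  toPerfectGraph := cycleGraph I
  disk := parabolicDisk n hn
  innerPos := cyclePos
  innerPos_injective := cyclePos_injective
  innerPos_mem a := cyclePos_mem hn a
  edge_subset e := cycleEdge_subset I hn e
  edge_disjoint e e' h := by
    rw [Set.disjoint_left]
    intro z hz hz'
    obtain ⟨t, h0, h1, rfl⟩ := exists_eq_cycleEdgePoint I hn hz
    obtain ⟨s, h0', h1', hs⟩ := exists_eq_cycleEdgePoint I hn hz'
    exact cycleEdgePoint_ne hn h h0 h1 h0' h1' hs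
  vertex_notMem_edge e v := position_notMem_cycleEdge I hn e v
  white_clockwise _ _ _ _ h₁ h₂ h₃ := cycle_white_clockwise I hn h₁ h₂ h₃
  black_clockwise _ _ _ _ h₁ h₂ h₃ := cycle_black_clockwise I hn h₁ h₂ h₃

/-! ### The boundary measurements of the cycle network do not vanish -/

theorem PerfectNetwork.paritySign_ne_zero (x : ZMod 2) : PerfectNetwork.paritySign x ≠ 0 := by
  intro h
  have := PerfectNetwork.paritySign_mul_self x
  rw [h] at this
  simp at this

theorem PerfectNetwork.eq_zero_of_paritySign_smul {A : Type*} [AddCommGroup A] {x : ZMod 2} {F : A}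
    (h : PerfectNetwork.paritySign x • F = 0) : F = 0 := by
  rw [← one_smul ℤ F, ← PerfectNetwork.paritySign_mul_self x, mul_smul, h, smul_zero]

theorem X_ne_zero_of_int {E : Type*} (e : E) : (MvPowerSeries.X e : MvPowerSeries E ℤ) ≠ 0 := by
  classical
  intro h
  have := congrArg (MvPowerSeries.coeff (Finsupp.single e 1)) h
  rw [MvPowerSeries.coeff_X, if_pos rfl, map_zero] at this
  exact one_ne_zero this

/-- The transfer matrix acts on the generating series of paths. -/
theorem PerfectNetwork.coe_transferMatrix_mul (N : PerfectNetwork n I) (d : Plane) (j : Fin n)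
    {e e' : N.E} (h : (N.tgt e).vertex = (N.src e').vertex) :
    (N.transferMatrix d e e' : MvPowerSeries N.E ℤ) * N.pathSeries d j e' =
      MvPowerSeries.X e * (N.turnSign d e e' • N.pathSeries d j e') := by
  rw [transferMatrix, if_pos h, MvPolynomial.coe_smul, MvPolynomial.coe_X, smul_mul_assoc,
    mul_smul_comm]
  rfl

theorem PerfectNetwork.coe_transferMatrix_eq_zero (N : PerfectNetwork n I) (d : Plane)
    {e e' : N.E} (h : (N.tgt e).vertex ≠ (N.src e').vertex) :
    (N.transferMatrix d e e' : MvPowerSeries N.E ℤ) = 0 := by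
  rw [transferMatrix, if_neg h, MvPolynomial.coe_zero]

variable (hn : 3 ≤ n)

/-- The edge of the cycle network at a boundary vertex. -/
def spokeEdge (c : Fin n) : (cycleNetwork I hn).E := (Sum.inl c : Fin n ⊕ Fin n)

/-- The edge of the cycle network from an internal vertex to the next one. -/
def rimEdge (c : Fin n) : (cycleNetwork I hn).E := (Sum.inr c : Fin n ⊕ Fin n)

/-- The internal vertices of the cycle network. -/
def rimVertex (c : Fin n) : (cycleNetwork I hn).W := c

theorem src_spokeEdge {c : Fin n} (hc : c ∈ I) :
    (cycleNetwork I hn).src (spokeEdge I hn c) = Sum.inl c := if_pos hc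

theorem tgt_spokeEdge {c : Fin n} (hc : c ∉ I) :
    (cycleNetwork I hn).tgt (spokeEdge I hn c) = Sum.inl c := if_neg hc

theorem tgt_spokeEdge_vertex {c : Fin n} (hc : c ∈ I) :
    ((cycleNetwork I hn).tgt (spokeEdge I hn c)).vertex = Sum.inr (rimVertex I hn c) :=
  congrArg NetFlag.vertex (if_pos hc : (cycleNetwork I hn).tgt (spokeEdge I hn c) = _)

theorem tgt_rimEdge_vertex (c : Fin n) :
    ((cycleNetwork I hn).tgt (rimEdge I hn c)).vertex = Sum.inr (rimVertex I hn (finRotate n c)) :=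
  cycleTgt_vertex_inr I c

theorem src_vertex_eq_iff (e : (cycleNetwork I hn).E) (c : Fin n) :
    ((cycleNetwork I hn).src e).vertex = Sum.inr (rimVertex I hn c) ↔
      e = rimEdge I hn c ∨ (c ∉ I ∧ e = spokeEdge I hn c) := by
  have key : ∀ e : Fin n ⊕ Fin n, (cycleSrc I e).vertex = Sum.inr c ↔
      e = Sum.inr c ∨ (c ∉ I ∧ e = Sum.inl c) := by
    rintro (a | a)
    · by_cases ha : a ∈ I <;> simp only [cycleSrc, ha, if_true, if_false, NetFlag.vertex,
        reduceCtorEq, false_or, Sum.inl.injEq, Sum.inr.injEq, false_iff, not_and]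
      · rintro h rfl
        exact h ha
      · exact ⟨fun h => ⟨h ▸ ha, h⟩, fun h => h.2⟩
    · simp [cycleSrc_vertex_inr]
  exact key e

theorem spokeEdge_ne_rimEdge (b c : Fin n) : spokeEdge I hn b ≠ rimEdge I hn c := Sum.inl_ne_inr

theorem pathSeries_spokeEdge_sink (d : Plane) (j : Fin n) {c : Fin n} (hc : c ∉ I) :
    (cycleNetwork I hn).pathSeries d j (spokeEdge I hn c) =
      if c = j then MvPowerSeries.X (spokeEdge I hn c) else 0 := by
  have ht := tgt_spokeEdge I hn hc
  rw [PerfectNetwork.pathSeries_eq, Finset.sum_eq_zero]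
  · rw [PerfectNetwork.exitVector, ht, add_zero]
    simp only [Sum.inl.injEq]
    split_ifs
    · exact MvPolynomial.coe_X _
    · exact MvPolynomial.coe_zero
  · intro e _
    rw [PerfectNetwork.coe_transferMatrix_eq_zero, zero_mul]
    rw [ht]
    intro h
    exact hc (((cycleNetwork I hn).source_iff c).2
      ⟨e, (cycleNetwork I hn).vertex_eq_inl.1 h.symm⟩)

theorem pathSeries_spokeEdge_source (d : Plane) (j : Fin n) {c : Fin n} (hc : c ∈ I) :
    (cycleNetwork I hn).pathSeries d j (spokeEdge I hn c) =
      MvPowerSeries.X (spokeEdge I hn c) *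
        ((cycleNetwork I hn).turnSign d (spokeEdge I hn c) (rimEdge I hn c) •
          (cycleNetwork I hn).pathSeries d j (rimEdge I hn c)) := by
  have ht := tgt_spokeEdge_vertex I hn hc
  have hne : (cycleNetwork I hn).tgt (spokeEdge I hn c) ≠ Sum.inl j := by
    rw [Ne, ← PerfectNetwork.vertex_eq_inl, ht]
    exact Sum.inr_ne_inl
  rw [PerfectNetwork.pathSeries_eq, PerfectNetwork.exitVector, if_neg hne, MvPolynomial.coe_zero,
    zero_add, Finset.sum_eq_single (rimEdge I hn c)]
  · exact PerfectNetwork.coe_transferMatrix_mul I _ d j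
      (ht.trans ((src_vertex_eq_iff I hn _ c).2 (Or.inl rfl)).symm)
  · intro e _ he
    rw [PerfectNetwork.coe_transferMatrix_eq_zero, zero_mul]
    rw [ht]
    intro h
    rcases (src_vertex_eq_iff I hn e c).1 h.symm with h | h
    · exact he h
    · exact h.1 hc
  · exact fun h => absurd (Finset.mem_univ _) h

theorem pathSeries_rimEdge (d : Plane) (j : Fin n) (a : Fin n) :
    (cycleNetwork I hn).pathSeries d j (rimEdge I hn a) =
      MvPowerSeries.X (rimEdge I hn a) *
        ((cycleNetwork I hn).turnSign d (rimEdge I hn a) (rimEdge I hn (finRotate n a)) •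
          (cycleNetwork I hn).pathSeries d j (rimEdge I hn (finRotate n a)) +
        if finRotate n a ∈ I then 0 else
          (cycleNetwork I hn).turnSign d (rimEdge I hn a) (spokeEdge I hn (finRotate n a)) •
            (cycleNetwork I hn).pathSeries d j (spokeEdge I hn (finRotate n a))) := by
  have ht := tgt_rimEdge_vertex I hn a
  have hne : (cycleNetwork I hn).tgt (rimEdge I hn a) ≠ Sum.inl j := by
    rw [Ne, ← PerfectNetwork.vertex_eq_inl, ht]
    exact Sum.inr_ne_inl
  rw [PerfectNetwork.pathSeries_eq, PerfectNetwork.exitVector, if_neg hne, MvPolynomial.coe_zero,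
    zero_add, mul_add, Fintype.sum_eq_add (rimEdge I hn (finRotate n a))
      (spokeEdge I hn (finRotate n a)) (spokeEdge_ne_rimEdge I hn _ _).symm]
  · congr 1
    · exact PerfectNetwork.coe_transferMatrix_mul I _ d j
        (ht.trans ((src_vertex_eq_iff I hn _ _).2 (Or.inl rfl)).symm)
    · split_ifs with h
      · rw [PerfectNetwork.coe_transferMatrix_eq_zero, zero_mul, mul_zero]
        rw [ht]
        intro h'
        rcases (src_vertex_eq_iff I hn _ _).1 h'.symm with h' | h'
        · exact spokeEdge_ne_rimEdge I hn _ _ h'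
        · exact h'.1 h
      · exact PerfectNetwork.coe_transferMatrix_mul I _ d j
          (ht.trans ((src_vertex_eq_iff I hn _ _).2 (Or.inr ⟨h, rfl⟩)).symm)
  · rintro e ⟨he, he'⟩
    rw [PerfectNetwork.coe_transferMatrix_eq_zero, zero_mul]
    rw [ht]
    intro h'
    rcases (src_vertex_eq_iff I hn _ _).1 h'.symm with h' | h'
    · exact he h'
    · exact he' h'.2

theorem pathSeries_rimEdge_ne_zero (d : Plane) {j : Fin n} (hj : j ∉ I) (a : Fin n) :
    (cycleNetwork I hn).pathSeries d j (rimEdge I hn a) ≠ 0 := by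
  classical
  -- Induction on the number of steps from `a` to `j` along the cycle.
  generalize hg : (if (a : ℕ) < j then (j : ℕ) - a else j + n - a) = g
  induction g using Nat.strong_induction_on generalizing a with
  | _ g ih =>
    rw [pathSeries_rimEdge]
    refine mul_ne_zero (X_ne_zero_of_int _) fun h0 => ?_
    by_cases hj' : finRotate n a = j
    · rw [if_neg (hj' ▸ hj), hj', pathSeries_spokeEdge_sink I hn d j hj, if_pos rfl] at h0
      -- The series of the paths from the edge of the cycle after `j` is divisible by its weight.
      rw [pathSeries_rimEdge I hn d j j] at h0
      have h1 := congrArg (MvPowerSeries.coeff (Finsupp.single (spokeEdge I hn j) 1)) h0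
      have h3 : ∀ G : MvPowerSeries (cycleNetwork I hn).E ℤ,
          MvPowerSeries.coeff (Finsupp.single (spokeEdge I hn j) 1)
            (MvPowerSeries.X (rimEdge I hn j) * G) = 0 := by
        intro G
        change MvPowerSeries.coeff _ (MvPowerSeries.monomial (Finsupp.single _ 1) 1 * G) = 0
        rw [MvPowerSeries.coeff_monomial_mul, if_neg]
        intro hle
        have := hle (rimEdge I hn j)
        rw [Finsupp.single_eq_same, Finsupp.single_eq_of_ne (spokeEdge_ne_rimEdge I hn j j).symm] at this
        exact absurd this (by decide)
      rw [map_add, map_zsmul, map_zsmul, map_zero, h3, MvPowerSeries.coeff_X, if_pos rfl, smul_zero,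
        zero_add, smul_eq_mul, mul_one] at h1
      exact PerfectNetwork.paritySign_ne_zero _ h1
    · have hv := PolygonalDisk.val_finRotate a
      have hne : ((finRotate n a : Fin n) : ℕ) ≠ j := fun h => hj' (Fin.ext h)
      have hprev := ih _ ?_ (finRotate n a) rfl
      · have hzero : (if finRotate n a ∈ I then 0 else
            (cycleNetwork I hn).turnSign d (rimEdge I hn a) (spokeEdge I hn (finRotate n a)) •
              (cycleNetwork I hn).pathSeries d j (spokeEdge I hn (finRotate n a))) = 0 := by
          split_ifs with h
          · rfl
          · rw [pathSeries_spokeEdge_sink I hn d j h, if_neg hj', smul_zero]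
        rw [hzero, add_zero] at h0
        exact hprev (PerfectNetwork.eq_zero_of_paritySign_smul h0)
      · rw [← hg]
        have ha := a.2
        have hjn := j.2
        split_ifs at hv ⊢ <;> omega

theorem boundarySeries_cycleNetwork_ne_zero {i j : Fin n} (hi : i ∈ I) (hj : j ∉ I) :
    (cycleNetwork I hn).boundarySeries i j ≠ 0 := by
  obtain ⟨d, hd, hd'⟩ := (cycleNetwork I hn).exists_generic_direction
  rw [(cycleNetwork I hn).boundarySeries_eq hd hd' (ne_of_mem_of_not_mem hi hj)
    (src_spokeEdge I hn hi)]
  intro h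
  replace h := PerfectNetwork.eq_zero_of_paritySign_smul h
  rw [pathSeries_spokeEdge_source I hn d j hi] at h
  rcases mul_eq_zero.1 h with h | h
  · exact X_ne_zero_of_int _ h
  · exact pathSeries_rimEdge_ne_zero I hn d hj i (PerfectNetwork.eq_zero_of_paritySign_smul h)

end CycleNetwork

/-! ### Uniqueness of the bracket -/

namespace PerfectNetwork

variable {n : ℕ} {I : Finset (Fin n)} (N : PerfectNetwork n I)

/-- There are edge weights at which all boundary measurements that do not vanish identically are
regular and nonzero. -/
theorem exists_mem_domain_ne_zero {k m : ℕ} (hk : I.card = k) (hm : Iᶜ.card = m)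
    (h : ∀ a, N.entrySeries hk hm a ≠ 0) :
    ∃ y ∈ N.domain hk hm, ∀ a, N.boundaryMap hk hm y a ≠ 0 := by
  choose p q hpq using fun a => N.exists_isFractionOf_entrySeries hk hm a
  have hp : ∀ a, p a ≠ 0 := by
    intro a h0
    have h1 := (hpq a).2
    rw [h0, MvPolynomial.coe_zero] at h1
    rcases mul_eq_zero.1 h1 with h2 | h2
    · exact (hpq a).1 (MvPolynomial.coe_injective _ _ (h2.trans MvPolynomial.coe_zero.symm))
    · exact h a h2
  set Q : MvPolynomial N.E ℤ := (∏ e, MvPolynomial.X e) * ∏ a, (p a * q a) with hQ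
  have hQ0 : Q ≠ 0 := mul_ne_zero (Finset.prod_ne_zero_iff.2 fun e _ => MvPolynomial.X_ne_zero e)
    (Finset.prod_ne_zero_iff.2 fun a _ => mul_ne_zero (hp a) (hpq a).1)
  have hQ1 : MvPolynomial.map (Int.castRingHom ℝ) Q ≠ 0 := fun h0 =>
    hQ0 (MvPolynomial.map_injective _ Int.cast_injective (h0.trans (map_zero _).symm))
  obtain ⟨y, hy⟩ : ∃ y, MvPolynomial.eval y (MvPolynomial.map (Int.castRingHom ℝ) Q) ≠ 0 := by
    by_contra hcon
    push Not at hcon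
    exact hQ1 (MvPolynomial.funext fun y => (hcon y).trans (map_zero _).symm)
  rw [← aeval_eq_eval_map, hQ, map_mul, map_prod, map_prod] at hy
  obtain ⟨h1, h2⟩ := mul_ne_zero_iff.1 hy
  have h1' := Finset.prod_ne_zero_iff.1 h1
  have h2' : ∀ a, MvPolynomial.aeval y (p a) ≠ 0 ∧ MvPolynomial.aeval y (q a) ≠ 0 := fun a =>
    mul_ne_zero_iff.1 (by rw [← map_mul]; exact Finset.prod_ne_zero_iff.1 h2 a (Finset.mem_univ a))
  refine ⟨y, ⟨fun e => by simpa using h1' e (Finset.mem_univ e), fun a => ⟨p a, q a, hpq a, (h2' a).2⟩⟩,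
    fun a => ?_⟩
  rw [boundaryMap, rationalValue_eq (hpq a) (h2' a).2]
  exact div_ne_zero (h2' a).1 (h2' a).2

end PerfectNetwork

section Uniqueness

variable {n k m : ℕ} {I : Finset (Fin n)} (hk : I.card = k) (hm : Iᶜ.card = m)

/-- The Poisson bracket on matrices whose rows are indexed by the sources and columns by the sinks. -/
noncomputable def boundaryBracket (α β : ℝ) : PoissonBracket (smoothFunctions (Fin k × Fin m)) :=
  matrixBracket (I.orderEmbOfFin hk).injective (Iᶜ.orderEmbOfFin hm).injective
    (PerfectNetwork.orderEmb_ne hk hm) α β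

/-- The boundary measurement map of every network is Poisson. -/
theorem PerfectNetwork.isPoissonMap_boundaryBracket (N : PerfectNetwork n I) (P : UniversalParams) :
    N.IsPoissonMap P hk hm
      (boundaryBracket hk hm (P.a23 + P.a13 - P.a12) (P.b23 + P.b13 - P.b12)) := by
  refine ⟨N.exists_isFractionOf_entrySeries hk hm, fun f g y hy => ?_⟩
  rw [N.edgeBracket_comp_boundaryMap hk hm hy, boundaryBracket, matrixBracket_apply]
  refine Finset.sum_congr rfl fun a _ => Finset.sum_congr rfl fun b _ => ?_
  rw [N.edgeBracket_boundaryMap_entries hk hm hy]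

/-- In the bracket of two entries of the same row only `α` occurs. -/
theorem entryBracket_row (α β : ℝ) (p : Fin k) (q q' : Fin m) :
    entryBracket (I.orderEmbOfFin hk) (Iᶜ.orderEmbOfFin hm) α β (p, q) (p, q') =
      (α * -ordSign (Iᶜ.orderEmbOfFin hm q) (Iᶜ.orderEmbOfFin hm q') +
        α * ordSign (Iᶜ.orderEmbOfFin hm q) (I.orderEmbOfFin hk p) +
        α * ordSign (I.orderEmbOfFin hk p) (Iᶜ.orderEmbOfFin hm q')) •
        (coordFn (p, q) * coordFn (p, q')) := by
  have h := PerfectNetwork.orderEmb_ne hk hm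
  rw [entryBracket, sPar_eq_neg_sCross (h _ _) (h _ _) (h _ _) (h _ _),
    sCross_eq (h _ _) (h _ _) (h _ _) (h _ _), sCross_eq (h _ _) (h _ _) (h _ _) (h _ _),
    mul_comm (coordFn (p, q')) (coordFn (p, q)), ← add_smul, ordSign_self,
    ordSign_swap (Iᶜ.orderEmbOfFin hm q) (Iᶜ.orderEmbOfFin hm q'),
    ordSign_swap (I.orderEmbOfFin hk p) (Iᶜ.orderEmbOfFin hm q),
    ordSign_swap (I.orderEmbOfFin hk p) (Iᶜ.orderEmbOfFin hm q')]
  congr 1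
  ring

/-- In the bracket of two entries of the same column only `β` occurs. -/
theorem entryBracket_column (α β : ℝ) (p p' : Fin k) (q : Fin m) :
    entryBracket (I.orderEmbOfFin hk) (Iᶜ.orderEmbOfFin hm) α β (p, q) (p', q) =
      (β * -ordSign (I.orderEmbOfFin hk p) (I.orderEmbOfFin hk p') +
        β * ordSign (I.orderEmbOfFin hk p) (Iᶜ.orderEmbOfFin hm q) +
        β * ordSign (Iᶜ.orderEmbOfFin hm q) (I.orderEmbOfFin hk p')) •
        (coordFn (p, q) * coordFn (p', q)) := by
  have h := PerfectNetwork.orderEmb_ne hk hm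
  rw [entryBracket, sPar_eq_neg_sCross (h _ _) (h _ _) (h _ _) (h _ _),
    sCross_eq (h _ _) (h _ _) (h _ _) (h _ _), ← add_smul, ordSign_self]
  congr 1
  ring

/-- For three distinct points the signs do not cancel. -/
theorem ordSign_triangle_ne_zero {a b c : Fin n} (h1 : a ≠ b) (h2 : b ≠ c) (h3 : c ≠ a) :
    -ordSign a b + ordSign a c + ordSign c b ≠ 0 := by
  rcases lt_or_gt_of_ne h1 with h1 | h1 <;> rcases lt_or_gt_of_ne h2 with h2 | h2 <;>
    rcases lt_or_gt_of_ne h3 with h3 | h3 <;> simp only [ordSign, h1, h2, h3, h1.not_gt, h2.not_gt,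
      h3.not_gt, if_true, if_false] <;> norm_num

/-- Evaluate the brackets of the entries at a point where all the entries for the cycle network are
nonzero: those of a row determine `α`, and those of a column determine `β`. -/
theorem boundaryBracket_unique (P : UniversalParams) {α β α' β' : ℝ}
    (h : ∀ N : PerfectNetwork n I, N.IsPoissonMap P hk hm (boundaryBracket hk hm α β))
    (h' : ∀ N : PerfectNetwork n I, N.IsPoissonMap P hk hm (boundaryBracket hk hm α' β')) :
    boundaryBracket hk hm α β = boundaryBracket hk hm α' β' := by
  have hne := PerfectNetwork.orderEmb_ne hk hm
  have key : 3 ≤ n → ∃ M : Fin k × Fin m → ℝ, (∀ a, M a ≠ 0) ∧ ∀ a b,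
      (entryBracket (I.orderEmbOfFin hk) (Iᶜ.orderEmbOfFin hm) α β a b).1 M =
        (entryBracket (I.orderEmbOfFin hk) (Iᶜ.orderEmbOfFin hm) α' β' a b).1 M := by
    intro hn
    obtain ⟨y, hy, hM⟩ := (cycleNetwork I hn).exists_mem_domain_ne_zero hk hm fun a =>
      boundarySeries_cycleNetwork_ne_zero I hn (Finset.orderEmbOfFin_mem I hk a.1)
        (Finset.mem_compl.1 (Finset.orderEmbOfFin_mem Iᶜ hm a.2))
    refine ⟨_, hM, fun a b => ?_⟩
    have h1 := (h (cycleNetwork I hn)).2 (coordFn a) (coordFn b) y hy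
    have h2 := (h' (cycleNetwork I hn)).2 (coordFn a) (coordFn b) y hy
    rw [boundaryBracket, matrixBracket_coordFn] at h1 h2
    rw [← h1, ← h2]
  have three : ∀ {a b c : Fin n}, a ≠ b → b ≠ c → c ≠ a → 3 ≤ n := by
    intro a b c h1 h2 h3
    have := a.2
    have := b.2
    have := c.2
    have : (a : ℕ) ≠ b := fun h => h1 (Fin.ext h)
    have : (b : ℕ) ≠ c := fun h => h2 (Fin.ext h)
    have : (c : ℕ) ≠ a := fun h => h3 (Fin.ext h)
    omega
  have hα : ∀ (p : Fin k) (q q' : Fin m), q ≠ q' → α = α' := by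
    intro p q q' hq
    have hq' : Iᶜ.orderEmbOfFin hm q ≠ Iᶜ.orderEmbOfFin hm q' :=
      fun h0 => hq ((Iᶜ.orderEmbOfFin hm).injective h0)
    obtain ⟨M, hM, he⟩ := key (three hq' (hne p q').symm (hne p q))
    have h1 := he (p, q) (p, q')
    rw [entryBracket_row, entryBracket_row] at h1
    change _ * (M _ * M _) = _ * (M _ * M _) at h1
    have h2 := mul_right_cancel₀ (mul_ne_zero (hM (p, q)) (hM (p, q'))) h1
    refine mul_right_cancel₀ (ordSign_triangle_ne_zero hq' (hne p q').symm (hne p q)) ?_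
    linarith
  have hβ : ∀ (p p' : Fin k) (q : Fin m), p ≠ p' → β = β' := by
    intro p p' q hp
    have hp' : I.orderEmbOfFin hk p ≠ I.orderEmbOfFin hk p' :=
      fun h0 => hp ((I.orderEmbOfFin hk).injective h0)
    obtain ⟨M, hM, he⟩ := key (three hp' (hne p' q) (hne p q).symm)
    have h1 := he (p, q) (p', q)
    rw [entryBracket_column, entryBracket_column] at h1
    change _ * (M _ * M _) = _ * (M _ * M _) at h1
    have h2 := mul_right_cancel₀ (mul_ne_zero (hM (p, q)) (hM (p', q))) h1
    refine mul_right_cancel₀ (ordSign_triangle_ne_zero hp' (hne p' q) (hne p q).symm) ?_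
    linarith
  refine matrixBracket_congr _ _ _ ?_
  rintro ⟨p, q⟩ ⟨p', q'⟩
  by_cases hp : p = p'
  · subst hp
    rw [entryBracket_row, entryBracket_row]
    by_cases hq : q = q'
    · subst hq
      rw [ordSign_self, ordSign_swap (I.orderEmbOfFin hk p) (Iᶜ.orderEmbOfFin hm q)]
      congr 1
      ring
    · rw [hα p q q' hq]
  · rw [hβ p p' q hp]
    by_cases hq : q = q'
    · subst hq
      rw [entryBracket_column, entryBracket_column]
    · rw [hα p q q' hq]

end Uniqueness

theorem theorem3p3 (n k m : ℕ) (I : Finset (Fin n)) (hk : I.card = k) (hm : Iᶜ.card = m) :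
    ∃ Φ : ℝ → ℝ → PoissonBracket (smoothFunctions (Fin k × Fin m)),
      (∀ (α β : ℝ) (p p' : Fin k) (q q' : Fin m),
        (Φ α β).bracket (coordFn (p, q)) (coordFn (p', q')) =
          ((α - β) * sPar (I.orderEmbOfFin hk p) (Iᶜ.orderEmbOfFin hm q)
              (I.orderEmbOfFin hk p') (Iᶜ.orderEmbOfFin hm q')) •
            (coordFn (p, q') * coordFn (p', q)) +
          ((α + β) * sCross (I.orderEmbOfFin hk p) (Iᶜ.orderEmbOfFin hm q)
              (I.orderEmbOfFin hk p') (Iᶜ.orderEmbOfFin hm q')) •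
            (coordFn (p, q) * coordFn (p', q'))) ∧
      ∀ P : UniversalParams,
        (∀ N : PerfectNetwork n I,
          N.IsPoissonMap P hk hm (Φ (P.a23 + P.a13 - P.a12) (P.b23 + P.b13 - P.b12))) ∧
        ∀ α β : ℝ, (∀ N : PerfectNetwork n I, N.IsPoissonMap P hk hm (Φ α β)) →
          Φ α β = Φ (P.a23 + P.a13 - P.a12) (P.b23 + P.b13 - P.b12) := by
  refine ⟨boundaryBracket hk hm, fun α β p p' q q' => matrixBracket_coordFn _ _ _ α β (p, q) (p', q'),
    fun P => ⟨fun N => N.isPoissonMap_boundaryBracket hk hm P, fun α β h =>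
      boundaryBracket_unique hk hm P h fun N => N.isPoissonMap_boundaryBracket hk hm P⟩⟩
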